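/- Let $p$ be a prime, let $F \subset K \subset \overline{\mathbb{Q}}_p$ be finite extensions of $\mathbb{Q}_p$ with $F/\mathbb{Q}_p$ unramified, let $O_F, O_K$ be their rings of integers, and let $S$ be the set of embeddings of $F$ in $\overline{\mathbb{Q}}_p$. Let $v$ be the $p$-adic valuation with $v(p)=1$; the valuation of a nonzero ideal of $O_K$ is the valuation of a generator. Let $H$ be a finite flat commutative group scheme of $p$-power order over $O_K$ with an action of $O_F$ (a ring homomorphism $O_F \to \mathrm{End}(H)$). Let $\omega_H$ be its module of differentials, i.e. the conormal module of the unit section of $H$, an $O_K$-module on which $O_F$ acts. For $s \in S$ let $\omega_{H,s} \subset \omega_H$ be the submodule on which $O_F$ acts through $s : O_F \to O_K$, and put $$\deg_s H := v(\mathrm{Fitt}_0\, \omega_{H,s}),$$ where $\mathrm{Fitt}_0$ is the zeroth Fitting ideal. (1) For every such $H$, the ideals $\mathrm{Fitt}_0\,\omega_{H,s}$ are principal and nonzero, so that $\deg_s H$ is well defined, and $\sum_{s \in S} \deg_s H$ is the degree of $H$ in the sense of Fargues. That is, $\omega_H \simeq \bigoplus_{j=1}^n O_K/(a_j)$ for some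 $n \ge 0$ and nonzero $a_1,\dots,a_n \in O_K$, and for every such decomposition $\sum_{s \in S}\deg_s H = \sum_{j=1}^n v(a_j)$. (2) The functions $\deg_s$ are additive: if $H_1, H_2, H_3$ are three such group schemes and $$0 \to H_1 \to H_2 \to H_3 \to 0$$ is an exact sequence with $O_F$-equivariant maps (that is, $H_2 \to H_3$ is faithfully flat with kernel $H_1$), then for every $s \in S$ $$\deg_s H_2 = \deg_s H_1 + \deg_s H_3.$$ -/

import Mathlib

open CategoryTheory AlgebraicGeometry MonoidalCategory CartesianMonoidalCategory MonObj

noncomputable section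

namespace PartialDegree

section Fitting

/-- The zeroth Fitting ideal of a finitely generated module `M` over a commutative ring `R`:
the ideal generated by the `n × n` minors of the relation matrix of a generating family
`m₁, …, mₙ` of `M`, that is, by the determinants of the square matrices whose rows are relations
between the `mᵢ`. This ideal is the same for every finite generating family; all of them are
allowed here, so that no choice has to be made. -/
def fittingIdeal (R M : Type) [CommRing R] [AddCommGroup M] [Module R M] : Ideal R :=
  Ideal.span {d : R | ∃ (n : ℕ) (m : Fin n → M) (A : Matrix (Fin n) (Fin n) R),
    Submodule.span R (Set.range m) = ⊤ ∧ (∀ i, ∑ j, A i j • m j = 0) ∧ d = A.det}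

end Fitting

section GroupSchemes

/-- A finite flat commutative group scheme over `Spec R` together with an action of the
commutative ring `O`, i.e. a ring homomorphism from `O` to the ring of endomorphisms of the group
scheme. In `act_add`, the product on the right is the group law on `Hom(X, X)` induced by the
commutative group structure of the target `X`. -/
structure FiniteFlatModuleScheme (R : CommRingCat.{0}) (O : Type) [CommRing O] where
  X : Over (Spec R)
  [grp : GrpObj X]
  [comm : IsCommMonObj X]
  [finite : IsFinite X.hom]
  [flat : Flat X.hom]
  act : O → (X ⟶ X)
  act_isMonHom : ∀ a, IsMonHom (act a)
  act_one : act 1 = 𝟙 X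
  act_mul : ∀ a b, act (a * b) = act b ≫ act a
  act_add : ∀ a b, act (a + b) = act a * act b

attribute [instance] FiniteFlatModuleScheme.grp FiniteFlatModuleScheme.comm
  FiniteFlatModuleScheme.finite FiniteFlatModuleScheme.flat FiniteFlatModuleScheme.act_isMonHom

variable {R : CommRingCat.{0}} {O : Type} [CommRing O]

namespace FiniteFlatModuleScheme

/-- The order of `H` (the rank of `H` over the base) is a power of `p`. -/
def HasPowerOrder (p : ℕ) (H : FiniteFlatModuleScheme R O) : Prop :=
  ∃ n : ℕ, ∀ t : Spec R, H.X.hom.finrank t = p ^ n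

/-- The `R`-algebra of global functions of `H`. -/
abbrev functions (H : FiniteFlatModuleScheme R O) : CommAlgCat.{0} R :=
  ((algΓ R).obj H.X).unop

/-- The ideal of functions on `H` which vanish along the unit section. -/
def augmentationIdeal (H : FiniteFlatModuleScheme R O) : Ideal H.functions :=
  RingHom.ker ((algΓ R).map η[H.X]).unop.hom

/-- The module of (invariant) differentials `ω_H = e^* Ω¹_{H/R}` of `H`, that is, the conormal
module `I / I²` of the unit section `e`, as an `R`-module. -/
abbrev omega (H : FiniteFlatModuleScheme R O) : Type := H.augmentationIdeal.Cotangent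

/-- Pull back of functions along the action of `a`. -/
def actFunctions (H : FiniteFlatModuleScheme R O) (a : O) : H.functions →ₐ[R] H.functions :=
  ((algΓ R).map (H.act a)).unop.hom

lemma augmentationIdeal_le_comap (H : FiniteFlatModuleScheme R O) (a : O) :
    H.augmentationIdeal ≤ H.augmentationIdeal.comap (H.actFunctions a) := by
  intro x hx
  have h : η[H.X] ≫ H.act a = η[H.X] := IsMonHom.one_hom (H.act a)
  have h2 := congrArg (fun f => ((algΓ R).map f).unop.hom x) h
  simp only [Functor.map_comp, unop_comp, CommAlgCat.hom_comp, AlgHom.comp_apply] at h2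
  rw [augmentationIdeal, RingHom.mem_ker] at hx
  rw [Ideal.mem_comap, augmentationIdeal, RingHom.mem_ker]
  exact h2.trans hx

/-- The action of `a` on `ω_H`, by pull back of differentials. -/
def actOmega (H : FiniteFlatModuleScheme R O) (a : O) : H.omega →ₗ[R] H.omega :=
  Ideal.mapCotangent H.augmentationIdeal H.augmentationIdeal (H.actFunctions a)
    (H.augmentationIdeal_le_comap a)

/-- `0 → H₁ → H₂ → H₃ → 0` is an exact sequence of finite flat `O`-module schemes: `i` and `q` are
`O`-equivariant homomorphisms of group schemes, `i` is a kernel of `q` (the fibre of `q` over the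
unit section), and `q` is faithfully flat. -/
structure IsShortExact (H₁ H₂ H₃ : FiniteFlatModuleScheme R O)
    (i : H₁.X ⟶ H₂.X) (q : H₂.X ⟶ H₃.X) : Prop where
  isMonHom_left : IsMonHom i
  isMonHom_right : IsMonHom q
  equivariant_left : ∀ a, H₁.act a ≫ i = i ≫ H₂.act a
  equivariant_right : ∀ a, H₂.act a ≫ q = q ≫ H₃.act a
  isKernel : IsPullback i (toUnit H₁.X) q η[H₃.X]
  flat : Flat q.left
  surjective : Surjective q.left

end FiniteFlatModuleScheme

end GroupSchemes

section Local

variable {p : ℕ} [Fact p.Prime]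

/-- The ring of integers of a field `E` with `ℚ_p ⊆ E ⊆ ℚ̄_p`: the integral closure of `ℤ_p`
in `E`. -/
def integers (E : IntermediateField ℚ_[p] (PadicAlgCl p)) : Type := integralClosure ℤ_[p] E

instance (E : IntermediateField ℚ_[p] (PadicAlgCl p)) : CommRing (integers E) :=
  inferInstanceAs (CommRing (integralClosure ℤ_[p] E))

instance (E : IntermediateField ℚ_[p] (PadicAlgCl p)) : Algebra ℤ_[p] (integers E) :=
  inferInstanceAs (Algebra ℤ_[p] (integralClosure ℤ_[p] E))

/-- The inclusion of the ring of integers of `E` in `E`. -/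
def toField (E : IntermediateField ℚ_[p] (PadicAlgCl p)) : integers E →+* E :=
  (integralClosure ℤ_[p] E).toSubring.subtype

/-- The inclusion of the ring of integers of `E` in `ℚ̄_p`. -/
abbrev incl (E : IntermediateField ℚ_[p] (PadicAlgCl p)) (x : integers E) : PadicAlgCl p :=
  (toField E x : PadicAlgCl p)

/-- The `p`-adic valuation of a nonzero element of `ℚ̄_p`, normalised by `v p = 1`. -/
def val (x : PadicAlgCl p) : ℝ := -Real.logb p ‖x‖

open Classical in
/-- The valuation of a nonzero principal ideal of the ring of integers of `E`: the valuation of a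
generator (all generators have the same valuation). The value is irrelevant for other ideals. -/
def idealVal {E : IntermediateField ℚ_[p] (PadicAlgCl p)} (J : Ideal (integers E)) : ℝ :=
  if h : ∃ x, J = Ideal.span {x} then val (incl E h.choose) else 0

variable {F K : IntermediateField ℚ_[p] (PadicAlgCl p)}

/-- Finite flat group schemes over the ring of integers of `K` with an action of the ring of
integers of `F`. -/
abbrev ModuleScheme (F K : IntermediateField ℚ_[p] (PadicAlgCl p)) : Type 1 :=
  FiniteFlatModuleScheme (CommRingCat.of (integers K)) (integers F)

/-- The part `ω_{H,s}` of `ω_H` where the ring of integers `O_F` acts through the embedding `s` of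
`F` in `ℚ̄_p`: the elements `w` such that `a · w = s(a) w` for all `a ∈ O_F`, where `s(a)` is
regarded as an element `b` of the ring of integers of `K`. -/
def isotypic (H : ModuleScheme F K) (s : F →ₐ[ℚ_[p]] PadicAlgCl p) :
    Submodule (integers K) H.omega where
  carrier := {w | ∀ (a : integers F) (b : integers K), incl K b = s (toField F a) →
    H.actOmega a w = b • w}
  add_mem' hx hy a b hab := by rw [map_add, smul_add, hx a b hab, hy a b hab]
  zero_mem' a b _ := by rw [map_zero, smul_zero]
  smul_mem' c x hx a b hab := by
    have h := (H.actOmega a).map_smul c x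
    exact h.trans (by rw [hx a b hab, smul_comm])

/-- The Fitting ideal `Fitt₀ ω_{H,s}`. -/
def isotypicFitting (H : ModuleScheme F K) (s : F →ₐ[ℚ_[p]] PadicAlgCl p) : Ideal (integers K) :=
  fittingIdeal (integers K) (isotypic H s)

/-- The partial degree `deg_s H = v (Fitt₀ ω_{H,s})`. -/
def partialDeg (s : F →ₐ[ℚ_[p]] PadicAlgCl p) (H : ModuleScheme F K) : ℝ :=
  idealVal (isotypicFitting H s)

/-- `d` is the degree of `H` in the sense of Fargues: `ω_H` is isomorphic to
`O_K / (a₁) ⊕ … ⊕ O_K / (aₙ)` with all `aⱼ` nonzero, and `d = v(a₁) + … + v(aₙ)`. -/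
def IsFarguesDegree (H : ModuleScheme F K) (d : ℝ) : Prop :=
  ∃ (n : ℕ) (a : Fin n → integers K), (∀ j, a j ≠ 0) ∧
    Nonempty (H.omega ≃ₗ[integers K] ((j : Fin n) → integers K ⧸ Ideal.span {a j})) ∧
    d = ∑ j, val (incl K (a j))

end Local

end PartialDegree

end

/-!
The additivity of the partial degrees follows from two opposite inequalities.

*Subadditivity of each partial degree.* An exact sequence `0 → H₁ → H₂ → H₃ → 0` induces a right exact
sequence `ω₃ → ω₂ → ω₁ → 0` (`IsShortExact.pullOmega_exact`). Since `O_F` is unramified over `ℤ_p`,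
the algebra `O_F ⊗ O_F` contains the idempotent of the diagonal, which provides `O_K`-linear
projections of `ω` onto its isotypic parts; hence these parts form right exact sequences as well, and
`ω` is their direct sum (`eigenPart_exact`, `eigenEquiv`). For the direct sum, all conjugates of `F`
have to be contained in `K`, that is, `F` has to be normal over `ℚ_p`; this holds because the integers
of `F` are spanned by Teichmüller lifts (`algHom_mem_of_unramified`). As Fitting ideals are
submultiplicative in right exact sequences (`fittingIdeal_mul_le`), `deg_s H₂ ≤ deg_s H₁ + deg_s H₃`
for all `s`. Moreover, `ω` is torsion since the generic fibre of `H` is étale (`ker_counit_le_sq`,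
`eq_zero_of_forall_algHom`, `exists_smul_cotangent_eq_zero`), so that it is a finite direct sum of
modules `O_K / (a)` with `a ≠ 0`, its Fitting ideal is the product of the ideals `(a)`, and the sum of
the partial degrees is the Fargues degree.

*Superadditivity of the Fargues degree.* Over the valuation ring `V` of `ℚ̄_p`, the functions on `H`
form a Hopf order `A` in the algebra of functions on the finite `p`-group `Γ` of geometric points of
`H` (`isHopfOrder_pointsOrder`). Let `δ₁` be the characteristic function of the unit element, and
consider the ideal of all `r ∈ V` with `r δ₁ ∈ A`.
* It contains the Fitting ideal of `ω`: the determinant of a relation matrix of `I / I²`, where `I` is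
  the augmentation ideal, lifts to a function which annihilates `I`
  (`exists_annihilator_of_mem_fittingIdeal`).
* In an exact sequence, an element of this ideal for `H₂` is the product of elements for `H₁` and `H₃`,
  by integration over the fibres of the quotient map (`IsHopfOrder.exists_mul_of_single_mem`). This
  rests on the existence of integrals (`IsHopfOrder.exists_integral`).
* It is contained in the Fitting ideal of `ω` (`IsHopfOrder.mem_fittingIdeal`). Like the
  ideal itself, Fitting ideals of cotangent spaces are compatible with exact sequences
  (`IsHopfOrder.fittingIdeal_mul_le`), so that a central subgroup of order `p` reduces this to orders
  of rank `p`. For these `I / I²` is cyclic (`IsHopfOrder.exists_generator`) and its Fitting ideal is its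
  annihilator; and `r δ₁ ∈ A` implies that `r` annihilates `I / I²`.

Together, the Fitting ideal of `ω₂` is contained in the product of those of `ω₁` and `ω₃`
(`mem_span_mul_of_exact`), so the sum over `s` of `deg_s H₂` is at least the sum of
`deg_s H₁ + deg_s H₃`, and all the inequalities between partial degrees are equalities.
-/

noncomputable section

namespace PartialDegree

/-! ### The Hopf algebra of functions on an affine group scheme -/

section FunctionsOnGroupSchemes

open Functor Opposite TensorProduct

variable {R : CommRingCat.{0}}

/-- An affine scheme over `Spec R` is the spectrum of its algebra of functions. -/
def affineIso (X : Over (Spec R)) [IsAffine X.left] : X ≅ (algSpec R).obj ((algΓ R).obj X) :=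
  haveI : IsIso ((algΓAlgSpecAdjunction R).unit.app X) :=
    (algΓAlgSpecAdjunction R).isIso_unit_app_iff_mem_essImage.2 (essImage_algSpec.2 inferInstance)
  asIso ((algΓAlgSpecAdjunction R).unit.app X)

lemma affineIso_naturality {X Y : Over (Spec R)} [IsAffine X.left] [IsAffine Y.left] (f : X ⟶ Y) :
    (affineIso X).hom ≫ (algSpec R).map ((algΓ R).map f) = f ≫ (affineIso Y).hom :=
  ((algΓAlgSpecAdjunction R).unit.naturality f).symm

/-- The functions on an affine group scheme form a cogroup object. -/
instance grpObjFunctions (X : Over (Spec R)) [IsAffine X.left] [GrpObj X] :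
    GrpObj ((algΓ R).obj X) :=
  letI : GrpObj ((algSpec R).obj ((algΓ R).obj X)) := GrpObj.ofIso (affineIso X)
  algSpec.fullyFaithful.grpObj _

lemma algSpec_map_mul (X : Over (Spec R)) [IsAffine X.left] [GrpObj X]
    {B : (CommAlgCat R)ᵒᵖ} (u v : B ⟶ (algΓ R).obj X) :
    (algSpec R).map (u * v) ≫ (affineIso X).inv =
      ((algSpec R).map u ≫ (affineIso X).inv) * ((algSpec R).map v ≫ (affineIso X).inv) := by
  let i : GrpObj ((algSpec R).obj ((algΓ R).obj X)) := GrpObj.ofIso (affineIso X)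
  have h : (algSpec R).map μ[(algΓ R).obj X] = OplaxMonoidal.δ (algSpec R) _ _ ≫ i.mul :=
    algSpec.fullyFaithful.map_preimage _
  have h2 : IsMonHom (affineIso X).inv := inferInstance
  rw [← MonObj.mul_comp]
  congr 1
  rw [Hom.mul_def, Functor.map_comp, h, ← Category.assoc, OplaxMonoidal.lift_δ]
  rfl

lemma algΓ_map_mul {X T : Over (Spec R)} [IsAffine X.left] [GrpObj X] [IsAffine T.left]
    (f g : T ⟶ X) : (algΓ R).map (f * g) = (algΓ R).map f * (algΓ R).map g := by
  apply (algSpec R).map_injective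
  rw [← cancel_mono (affineIso X).inv, algSpec_map_mul]
  have h (f : T ⟶ X) : (algSpec R).map ((algΓ R).map f) ≫ (affineIso X).inv =
    (affineIso T).inv ≫ f := by
    rw [Iso.comp_inv_eq, Category.assoc, Iso.eq_inv_comp, affineIso_naturality]
  rw [h, h, h, ← MonObj.comp_mul]

lemma algSpec_map_one (X : Over (Spec R)) [IsAffine X.left] [GrpObj X] :
    (algSpec R).map η[(algΓ R).obj X] ≫ (affineIso X).inv =
      OplaxMonoidal.η (algSpec R) ≫ η[X] := by
  let i : GrpObj ((algSpec R).obj ((algΓ R).obj X)) := GrpObj.ofIso (affineIso X)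
  have h : (algSpec R).map η[(algΓ R).obj X] = OplaxMonoidal.η (algSpec R) ≫ i.one :=
    algSpec.fullyFaithful.map_preimage _
  have h2 : IsMonHom (affineIso X).inv := inferInstance
  rw [h, Category.assoc]
  congr 1
  exact h2.one_hom

lemma algΓ_map_comp_inv {X T : Over (Spec R)} [IsAffine X.left] [IsAffine T.left] (f : T ⟶ X) :
    (algSpec R).map ((algΓ R).map f) ≫ (affineIso X).inv = (affineIso T).inv ≫ f := by
  rw [Iso.comp_inv_eq, Category.assoc, Iso.eq_inv_comp, affineIso_naturality]

instance isMonHom_algΓ_map {X Y : Over (Spec R)} [IsAffine X.left] [IsAffine Y.left] [GrpObj X]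
    [GrpObj Y] (f : X ⟶ Y) [IsMonHom f] : IsMonHom ((algΓ R).map f) where
  one_hom := by
    apply (algSpec R).map_injective
    rw [← cancel_mono (affineIso Y).inv, Functor.map_comp, Category.assoc, algΓ_map_comp_inv,
      ← Category.assoc, algSpec_map_one, algSpec_map_one, Category.assoc, IsMonHom.one_hom]
  mul_hom := by
    have h : (fst _ _ * snd _ _) ≫ (algΓ R).map f =
        (fst _ _ ≫ (algΓ R).map f) * (snd _ _ ≫ (algΓ R).map f) := by
      apply (algSpec R).map_injective
      rw [← cancel_mono (affineIso Y).inv, algSpec_map_mul, Functor.map_comp, Category.assoc,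
        algΓ_map_comp_inv, ← Category.assoc, algSpec_map_mul, MonObj.mul_comp]
      simp only [Functor.map_comp, Category.assoc, algΓ_map_comp_inv]
    rw [Hom.mul_def, Hom.mul_def, CartesianMonoidalCategory.lift_fst_snd, Category.id_comp] at h
    rw [h]
    congr 1
    ext <;> simp

/-- The algebra of functions on an affine group scheme is a Hopf algebra. -/
instance hopfFunctions (X : Over (Spec R)) [IsAffine X.left] [GrpObj X] :
    HopfAlgebra R ((algΓ R).obj X).unop := inferInstance

/-- Pull back of functions along a morphism. -/
abbrev pullFunctions {X Y : Over (Spec R)} (f : X ⟶ Y) :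
    ((algΓ R).obj Y).unop →ₐ[R] ((algΓ R).obj X).unop := ((algΓ R).map f).unop.hom

lemma pullFunctions_mul {X T : Over (Spec R)} [IsAffine X.left] [GrpObj X] [IsAffine T.left]
    (f g : T ⟶ X) : pullFunctions (f * g) =
      (Algebra.TensorProduct.lift (pullFunctions f) (pullFunctions g) fun _ _ ↦ .all _ _).comp
        (Bialgebra.comulAlgHom R ((algΓ R).obj X).unop) := by
  have h := algΓ_map_mul f g
  exact congr($(h).unop.hom)

/-- Pull back of functions along a homomorphism of group schemes. -/
def pullBialgHom {X Y : Over (Spec R)} [IsAffine X.left] [IsAffine Y.left] [GrpObj X]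
    [GrpObj Y] (f : X ⟶ Y) [IsMonHom f] :
    ((algΓ R).obj Y).unop →ₐc[R] ((algΓ R).obj X).unop :=
  .ofAlgHom (pullFunctions f)
    congr(($(IsMonHom.one_hom (f := (algΓ R).map f))).unop.hom)
    congr(($((IsMonHom.mul_hom (f := (algΓ R).map f)).symm)).unop.hom)

/-- The functions vanishing along the unit section are the kernel of the counit. -/
lemma ker_pullFunctions_one (X : Over (Spec R)) [IsAffine X.left] [GrpObj X] :
    RingHom.ker (pullFunctions η[X]) =
      RingHom.ker (Bialgebra.counitAlgHom R ((algΓ R).obj X).unop) := by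
  have hU : IsAffine (𝟙_ (Over (Spec R))).left := inferInstanceAs (IsAffine (Spec R))
  let e := asIso (OplaxMonoidal.η (algSpec R)) ≪≫ affineIso (𝟙_ (Over (Spec R)))
  obtain ⟨g, hg⟩ := (algSpec R).map_surjective e.hom
  obtain ⟨g', hg'⟩ := (algSpec R).map_surjective e.inv
  have hgg : g ≫ g' = 𝟙 _ := (algSpec R).map_injective (by simp [hg, hg'])
  have hgg' : g' ≫ g = 𝟙 _ := (algSpec R).map_injective (by simp [hg, hg'])
  have key : g ≫ (algΓ R).map η[X] = η[(algΓ R).obj X] := by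
    apply (algSpec R).map_injective
    rw [← cancel_mono (affineIso X).inv, algSpec_map_one, Functor.map_comp, Category.assoc,
      algΓ_map_comp_inv, hg]
    simp [e]
  have key' : (algΓ R).map η[X] = g' ≫ η[(algΓ R).obj X] := by
    rw [← key, ← Category.assoc, hgg', Category.id_comp]
  ext x
  simp only [RingHom.mem_ker]
  have h1 : η[(algΓ R).obj X].unop.hom x = g.unop.hom (pullFunctions η[X] x) :=
    congr(($key).unop.hom x).symm
  have h2 : pullFunctions η[X] x = g'.unop.hom (η[(algΓ R).obj X].unop.hom x) :=
    congr(($key').unop.hom x)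
  constructor
  · intro h
    exact h1.trans (by rw [h, map_zero])
  · intro h
    rw [h2]
    exact (congrArg _ h).trans (map_zero _)

end FunctionsOnGroupSchemes

/-! ### Finiteness, flatness and kernels in terms of functions -/

section FunctionsAndKernels

open Functor Opposite TensorProduct

variable {R : CommRingCat.{0}}

instance isIso_affineIso_inv_left (X : Over (Spec R)) [IsAffine X.left] :
    IsIso (affineIso X).inv.left :=
  inferInstanceAs (IsIso ((Over.forget _).map (affineIso X).inv))

instance isIso_affineIso_hom_left (X : Over (Spec R)) [IsAffine X.left] :
    IsIso (affineIso X).hom.left :=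
  inferInstanceAs (IsIso ((Over.forget _).map (affineIso X).hom))

-- The following four facts are found by instance search, but not for the explicit composites below,
-- whose middle objects are displayed in different ways.
lemma isFinite_isIso_comp {A B C : Scheme.{0}} (e : A ⟶ B) (_ : IsIso e) (f : B ⟶ C) [IsFinite f] :
    IsFinite (e ≫ f) := inferInstance

lemma flat_isIso_comp {A B C : Scheme.{0}} (e : A ⟶ B) (_ : IsIso e) (f : B ⟶ C) [Flat f] :
    Flat (e ≫ f) := inferInstance

lemma flat_isIso_comp_isIso {A B C D : Scheme.{0}} (e : A ⟶ B) (_ : IsIso e) (f : B ⟶ C) [Flat f]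
    (e' : C ⟶ D) (_ : IsIso e') : Flat (e ≫ f ≫ e') := inferInstance

lemma surjective_isIso_comp_isIso {A B C D : Scheme.{0}} (e : A ⟶ B) (_ : IsIso e) (f : B ⟶ C)
    [Surjective f] (e' : C ⟶ D) (_ : IsIso e') : Surjective (e ≫ f ≫ e') := inferInstance

lemma specMap_algebraMap_functions (X : Over (Spec R)) [IsAffine X.left] :
    Spec.map (CommRingCat.ofHom (algebraMap R ((algΓ R).obj X).unop)) =
      (affineIso X).inv.left ≫ X.hom :=
  (Over.w (affineIso X).inv).symm

lemma finite_functions (X : Over (Spec R)) [IsAffine X.left] [IsFinite X.hom] :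
    Module.Finite R ((algΓ R).obj X).unop := by
  rw [← RingHom.finite_algebraMap]
  have h : IsFinite (Spec.map (CommRingCat.ofHom (algebraMap R ((algΓ R).obj X).unop))) := by
    rw [specMap_algebraMap_functions]
    exact isFinite_isIso_comp _ (isIso_affineIso_inv_left X) _
  exact (IsFinite.SpecMap_iff (f := CommRingCat.ofHom _)).1 h

lemma flat_functions (X : Over (Spec R)) [IsAffine X.left] [Flat X.hom] :
    Module.Flat R ((algΓ R).obj X).unop := by
  rw [← RingHom.flat_algebraMap_iff]
  have h : Flat (Spec.map (CommRingCat.ofHom (algebraMap R ((algΓ R).obj X).unop))) := by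
    rw [specMap_algebraMap_functions]
    exact flat_isIso_comp _ (isIso_affineIso_inv_left X) _
  exact Flat.SpecMap_iff.1 h

lemma rankAtStalk_functions (X : Over (Spec R)) [IsAffine X.left] [Flat X.hom] [IsFinite X.hom]
    (t : Spec R) :
    Module.rankAtStalk ((algΓ R).obj X).unop (show PrimeSpectrum R from t) = X.hom.finrank t := by
  have h1 := finite_functions X
  have h2 := flat_functions X
  have h := Scheme.Hom.finrank_SpecMap_algebraMap R ((algΓ R).obj X).unop t
  rw [← h]
  have h3 := specMap_algebraMap_functions X
  have h4 := Scheme.Hom.finrank_comp_left_of_isIso (affineIso X).inv.left X.hom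
  rw [← h4, ← h3]
  rfl

lemma specMap_pullFunctions {X Y : Over (Spec R)} [IsAffine X.left] [IsAffine Y.left] (f : X ⟶ Y) :
    Spec.map (CommRingCat.ofHom (pullFunctions f).toRingHom) =
      (affineIso X).inv.left ≫ f.left ≫ (affineIso Y).hom.left := by
  have h : (algSpec R).map ((algΓ R).map f) = (affineIso X).inv ≫ f ≫ (affineIso Y).hom := by
    rw [Iso.eq_inv_comp, affineIso_naturality]
  exact congr(($h).left)

lemma flat_pullFunctions {X Y : Over (Spec R)} [IsAffine X.left] [IsAffine Y.left] (f : X ⟶ Y)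
    [Flat f.left] : (pullFunctions f).toRingHom.Flat := by
  have h : Flat (Spec.map (CommRingCat.ofHom (pullFunctions f).toRingHom)) := by
    rw [specMap_pullFunctions]
    exact flat_isIso_comp_isIso _ (isIso_affineIso_inv_left X) _ _
      (isIso_affineIso_hom_left Y)
  exact Flat.SpecMap_iff.1 h

lemma comap_pullFunctions_surjective {X Y : Over (Spec R)} [IsAffine X.left] [IsAffine Y.left]
    (f : X ⟶ Y) [Surjective f.left] :
    Function.Surjective (PrimeSpectrum.comap (pullFunctions f).toRingHom) := by
  have h : Surjective (Spec.map (CommRingCat.ofHom (pullFunctions f).toRingHom)) := by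
    rw [specMap_pullFunctions]
    exact surjective_isIso_comp_isIso _ (isIso_affineIso_inv_left X) _ _
      (isIso_affineIso_hom_left Y)
  exact h.surj

lemma algSpec_map_hom_one {X : Over (Spec R)} [IsAffine X.left] [GrpObj X] {B : (CommAlgCat R)ᵒᵖ} :
    (algSpec R).map (1 : B ⟶ (algΓ R).obj X) ≫ (affineIso X).inv = 1 := by
  rw [Hom.one_def, Functor.map_comp, Category.assoc, algSpec_map_one, Hom.one_def, ← Category.assoc]
  congr 1

/-- The functions on the kernel of a homomorphism `q` of affine group schemes are the functions
on the source modulo the ideal generated by the pull back of the augmentation ideal. -/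
lemma pullFunctions_kernel {X₁ X₂ X₃ : Over (Spec R)} [IsAffine X₁.left] [IsAffine X₂.left]
    [IsAffine X₃.left] [GrpObj X₃] (i : X₁ ⟶ X₂) (q : X₂ ⟶ X₃)
    (h : IsPullback i (toUnit X₁) q η[X₃]) :
    Function.Surjective (pullFunctions i) ∧ RingHom.ker (pullFunctions i) =
      (RingHom.ker (Bialgebra.counitAlgHom R ((algΓ R).obj X₃).unop)).map (pullFunctions q) := by
  set I := RingHom.ker (Bialgebra.counitAlgHom R ((algΓ R).obj X₃).unop) with hI
  set J := I.map (pullFunctions q) with hJ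
  let B : CommAlgCat.{0} R := CommAlgCat.of R (((algΓ R).obj X₂).unop ⧸ J)
  let m : ((algΓ R).obj X₂).unop ⟶ B := CommAlgCat.ofHom (Ideal.Quotient.mkₐ R J)
  have hJle : J ≤ RingHom.ker (pullFunctions i) := by
    rw [hJ, Ideal.map_le_iff_le_comap]
    intro a ha
    rw [hI, ← ker_pullFunctions_one, RingHom.mem_ker] at ha
    rw [Ideal.mem_comap, RingHom.mem_ker]
    have h1 : pullFunctions i (pullFunctions q a) =
        pullFunctions (toUnit X₁) (pullFunctions η[X₃] a) := by
      have := congrArg (fun f => pullFunctions f a) h.w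
      simp only [pullFunctions, Functor.map_comp] at this
      exact this
    rw [h1, ha, map_zero]
  have hm : m.op ≫ (algΓ R).map q = 1 := by
    apply Quiver.Hom.unop_inj
    ext a
    change Ideal.Quotient.mk J (pullFunctions q a) =
      algebraMap R B (Bialgebra.counitAlgHom R ((algΓ R).obj X₃).unop a)
    have h2 : pullFunctions q (a - algebraMap R _
        (Bialgebra.counitAlgHom R ((algΓ R).obj X₃).unop a)) ∈ J := by
      apply Ideal.mem_map_of_mem
      rw [hI, RingHom.mem_ker, _root_.map_sub, AlgHom.commutes]
      simp
    rw [_root_.map_sub, AlgHom.commutes] at h2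
    exact (Ideal.Quotient.eq.2 h2)
  let T : Over (Spec R) := (algSpec R).obj (op B)
  let b : T ⟶ X₂ := (algSpec R).map m.op ≫ (affineIso X₂).inv
  have hb : b ≫ q = toUnit T ≫ η[X₃] := by
    rw [Category.assoc, ← algΓ_map_comp_inv, ← Functor.map_comp_assoc, hm, algSpec_map_hom_one]
    rfl
  let l : T ⟶ X₁ := h.lift b (toUnit T) hb
  have hl : l ≫ i = b := h.lift_fst _ _ _
  obtain ⟨u, hu⟩ := (algSpec R).map_surjective (l ≫ (affineIso X₁).hom)
  have hu2 : u ≫ (algΓ R).map i = m.op := by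
    apply (algSpec R).map_injective
    rw [← cancel_mono (affineIso X₂).inv, Functor.map_comp, Category.assoc, algΓ_map_comp_inv, hu]
    simp [hl, b]
  have hu3 (a) : u.unop.hom (pullFunctions i a) = Ideal.Quotient.mk J a :=
    congr(($hu2).unop.hom a)
  have hker : RingHom.ker (pullFunctions i) = J := by
    refine le_antisymm (fun a ha => ?_) hJle
    rw [RingHom.mem_ker] at ha
    rw [← Ideal.Quotient.eq_zero_iff_mem, ← hu3, ha, map_zero]
  refine ⟨?_, hker⟩
  let v : B ⟶ ((algΓ R).obj X₁).unop :=
    CommAlgCat.ofHom (Ideal.Quotient.liftₐ J (pullFunctions i) hJle)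
  have hv : (v.op ≫ u) ≫ (algΓ R).map i = (algΓ R).map i := by
    rw [Category.assoc, hu2]
    apply Quiver.Hom.unop_inj
    ext a
    rfl
  have hid : v.op ≫ u = 𝟙 _ := by
    apply (algSpec R).map_injective
    have h5 : (affineIso X₁).hom ≫ (algSpec R).map (v.op ≫ u) ≫ (affineIso X₁).inv = 𝟙 _ := by
      apply h.hom_ext
      · rw [Category.id_comp, Category.assoc, Category.assoc, ← algΓ_map_comp_inv,
          ← Functor.map_comp_assoc, hv, algΓ_map_comp_inv, Iso.hom_inv_id_assoc]
      · exact toUnit_unique _ _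
    rw [← Category.assoc, Iso.comp_inv_eq, Category.id_comp] at h5
    rw [← cancel_epi (affineIso X₁).hom, h5]
    simp
  intro a
  obtain ⟨c, hc⟩ := Ideal.Quotient.mk_surjective (u.unop.hom a)
  refine ⟨c, ?_⟩
  have h6 : v.hom (u.unop.hom a) = a := congr(($hid).unop.hom a)
  rw [← h6, ← hc]
  rfl

end FunctionsAndKernels

/-! ### Fitting ideals -/

section FittingLemmas

variable {R : Type} [CommRing R]

/-- The generators of the Fitting ideal may be indexed by an arbitrary finite type. -/
lemma det_mem_fittingIdeal {M : Type} [AddCommGroup M] [Module R M] {σ : Type*} [Fintype σ]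
    [DecidableEq σ] (m : σ → M) (A : Matrix σ σ R) (hm : Submodule.span R (Set.range m) = ⊤)
    (hA : ∀ i, ∑ j, A i j • m j = 0) : A.det ∈ fittingIdeal R M := by
  let e := (Fintype.equivFin σ).symm
  refine Ideal.subset_span ⟨Fintype.card σ, m ∘ e, A.submatrix e e, ?_, fun i => ?_, ?_⟩
  · rwa [Set.range_comp, e.surjective.range_eq, Set.image_univ]
  · rw [← hA (e i)]
    exact Equiv.sum_comp e (fun j => A (e i) j • m j)
  · rw [Matrix.det_submatrix_equiv_self]

lemma fittingIdeal_le_of_surjective {M N : Type} [AddCommGroup M] [Module R M] [AddCommGroup N]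
    [Module R N] (f : M →ₗ[R] N) (hf : Function.Surjective f) :
    fittingIdeal R M ≤ fittingIdeal R N := by
  refine Ideal.span_le.2 ?_
  rintro _ ⟨n, m, A, hm, hA, rfl⟩
  refine det_mem_fittingIdeal (f ∘ m) A ?_ fun i => ?_
  · rw [Set.range_comp, ← Submodule.map_span, hm, Submodule.map_top, LinearMap.range_eq_top.2 hf]
  · have := congrArg f (hA i)
    simpa using this

lemma fittingIdeal_congr {M N : Type} [AddCommGroup M] [Module R M] [AddCommGroup N]
    [Module R N] (e : M ≃ₗ[R] N) : fittingIdeal R M = fittingIdeal R N :=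
  le_antisymm (fittingIdeal_le_of_surjective e.toLinearMap e.surjective)
    (fittingIdeal_le_of_surjective e.symm.toLinearMap e.symm.surjective)

/-- The zeroth Fitting ideal is submultiplicative in right exact sequences: relation matrices of
the outer terms fit into a block triangular relation matrix of the middle term. -/
lemma fittingIdeal_mul_le {M₁ M₂ M₃ : Type} [AddCommGroup M₁] [Module R M₁] [AddCommGroup M₂]
    [Module R M₂] [AddCommGroup M₃] [Module R M₃] (f : M₃ →ₗ[R] M₂) (g : M₂ →ₗ[R] M₁)
    (hg : Function.Surjective g) (h : LinearMap.ker g ≤ LinearMap.range f) :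
    fittingIdeal R M₁ * fittingIdeal R M₃ ≤ fittingIdeal R M₂ := by
  rw [fittingIdeal, fittingIdeal, Ideal.span_mul_span', Ideal.span_le]
  rintro _ ⟨_, ⟨n, m, A, hm, hA, rfl⟩, _, ⟨k, l, B, hl, hB, rfl⟩, rfl⟩
  choose m' hm' using fun i => hg (m i)
  have h1 (i) : ∃ c : Fin k → R, f (∑ j, c j • l j) = ∑ j, A i j • m' j := by
    have : ∑ j, A i j • m' j ∈ LinearMap.ker g := by
      rw [LinearMap.mem_ker, map_sum, ← hA i]
      simp [hm']
    obtain ⟨x, hx⟩ := h this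
    have hx' : x ∈ Submodule.span R (Set.range l) := hl ▸ Submodule.mem_top
    obtain ⟨c, rfl⟩ := (Submodule.mem_span_range_iff_exists_fun R).1 hx'
    exact ⟨c, hx⟩
  choose c hc using h1
  have hdet : A.det * B.det = (Matrix.fromBlocks A (-Matrix.of c) 0 B).det :=
    (Matrix.det_fromBlocks_zero₂₁ _ _ _).symm
  rw [SetLike.mem_coe]
  change A.det * B.det ∈ _
  rw [hdet]
  refine det_mem_fittingIdeal (Sum.elim m' (f ∘ l)) _ ?_ ?_
  · rw [eq_top_iff]
    intro x _
    have hx : g x ∈ Submodule.span R (Set.range m) := hm ▸ Submodule.mem_top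
    obtain ⟨d, hd⟩ := (Submodule.mem_span_range_iff_exists_fun R).1 hx
    have h2 : x - ∑ j, d j • m' j ∈ LinearMap.ker g := by
      rw [LinearMap.mem_ker, map_sub, ← hd]
      simp [hm']
    obtain ⟨y, hy⟩ := h h2
    have hy' : y ∈ Submodule.span R (Set.range l) := hl ▸ Submodule.mem_top
    rw [← sub_add_cancel x (∑ j, d j • m' j), ← hy]
    refine Submodule.add_mem _ ?_ (Submodule.sum_mem _ fun j _ => Submodule.smul_mem _ _
      (Submodule.subset_span ⟨Sum.inl j, rfl⟩))
    have h3 : f y ∈ (Submodule.span R (Set.range l)).map f := Submodule.mem_map_of_mem hy'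
    rw [Submodule.map_span, ← Set.range_comp] at h3
    refine Submodule.span_mono ?_ h3
    rintro _ ⟨j, rfl⟩
    exact ⟨Sum.inr j, rfl⟩
  · rintro (i | i)
    · simp [← hc]
    · have := congrArg f (hB i)
      simpa using this

/-- A relation matrix between generators of `∏ⱼ R / (aⱼ)` has determinant divisible by `∏ⱼ aⱼ`. -/
lemma det_mem_span_prod {σ κ : Type*} [Fintype σ] [DecidableEq σ] [Fintype κ] [DecidableEq κ]
    (a : κ → R) (m : σ → (j : κ) → R ⧸ Ideal.span {a j})
    (A : Matrix σ σ R) (hm : Submodule.span R (Set.range m) = ⊤)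
    (hA : ∀ i, ∑ j, A i j • m j = 0) : A.det ∈ Ideal.span {∏ j, a j} := by
  choose X hX using fun i j => Ideal.Quotient.mk_surjective (m i j)
  have h1 (i j) : ∃ w, ∑ l, A i l * X l j = w * a j := by
    have h2 : ∑ l, A i l * X l j ∈ Ideal.span {a j} := by
      rw [← Ideal.Quotient.eq_zero_iff_mem, map_sum]
      have := congrFun (hA i) j
      simp only [Finset.sum_apply, Pi.smul_apply, Pi.zero_apply] at this
      rw [← this]
      refine Finset.sum_congr rfl fun l _ => ?_
      rw [map_mul, hX, Algebra.smul_def]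
      rfl
    obtain ⟨w, hw⟩ := Ideal.mem_span_singleton'.1 h2
    exact ⟨w, hw.symm⟩
  choose W hW using h1
  have h3 (j : κ) : ∃ y : σ → R, ∑ i, y i • m i = Pi.single j 1 :=
    (Submodule.mem_span_range_iff_exists_fun R).1 (hm ▸ Submodule.mem_top)
  choose Y hY using h3
  have h4 (j l) : ∃ z, (1 : Matrix κ κ R) j l - ∑ i, Y j i * X i l = z * a l := by
    have h2 : (1 : Matrix κ κ R) j l - ∑ i, Y j i * X i l ∈ Ideal.span {a l} := by
      rw [← Ideal.Quotient.eq_zero_iff_mem, map_sub, map_sum, sub_eq_zero]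
      have := congrFun (hY j) l
      simp only [Finset.sum_apply, Pi.smul_apply] at this
      have h5 : Ideal.Quotient.mk (Ideal.span {a l}) ((1 : Matrix κ κ R) j l) =
          (Pi.single j 1 : (j : κ) → R ⧸ Ideal.span {a j}) l := by
        rw [Matrix.one_apply]
        by_cases hjl : j = l
        · subst hjl; simp
        · simp [hjl]
      rw [h5, ← this]
      refine Finset.sum_congr rfl fun i _ => ?_
      rw [map_mul, hX, Algebra.smul_def]
      rfl
    obtain ⟨z, hz⟩ := Ideal.mem_span_singleton'.1 h2
    exact ⟨z, hz.symm⟩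
  choose Z hZ using h4
  -- Passing from the generators `m` to `m` together with the standard generators does not change
  -- the determinant; in terms of the standard generators, all relations are multiples of the `aⱼ`.
  have e1 : Matrix.fromBlocks A 0 (-Matrix.of Y) 1 * Matrix.fromBlocks 1 (Matrix.of X) 0 1 =
      Matrix.fromBlocks A (Matrix.of W) (-Matrix.of Y) (Matrix.of Z) *
        Matrix.fromBlocks 1 0 0 (Matrix.diagonal a) := by
    rw [Matrix.fromBlocks_multiply, Matrix.fromBlocks_multiply]
    congr 1
    · simp
    · ext i j; simp [Matrix.mul_apply, hW, Matrix.diagonal_apply]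
    · simp
    · ext i j
      have := hZ i j
      simp only [Matrix.mul_zero, Matrix.mul_one, Matrix.neg_mul,
        Matrix.add_apply, Matrix.neg_apply, Matrix.mul_diagonal, Matrix.of_apply, ← this]
      simp [Matrix.mul_apply]
      ring
  have e2 := congrArg Matrix.det e1
  rw [Matrix.det_mul, Matrix.det_mul, Matrix.det_fromBlocks_zero₁₂, Matrix.det_fromBlocks_zero₂₁,
    Matrix.det_fromBlocks_zero₂₁, Matrix.det_diagonal] at e2
  simp only [Matrix.det_one, _root_.mul_one, _root_.one_mul] at e2
  rw [e2]
  exact Ideal.mul_mem_left _ _ (Ideal.mem_span_singleton_self _)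

lemma fittingIdeal_pi_quotient {κ : Type} [Fintype κ] (a : κ → R) :
    fittingIdeal R ((j : κ) → R ⧸ Ideal.span {a j}) = Ideal.span {∏ j, a j} := by
  classical
  apply le_antisymm
  · refine Ideal.span_le.2 ?_
    rintro _ ⟨n, m, A, hm, hA, rfl⟩
    exact det_mem_span_prod a m A hm hA
  · rw [Ideal.span_singleton_le_iff_mem, ← Matrix.det_diagonal]
    refine det_mem_fittingIdeal (fun j => Pi.single j 1) _ ?_ fun i => ?_
    · rw [eq_top_iff]
      intro x _
      choose y hy using fun j => Ideal.Quotient.mk_surjective (x j)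
      refine (Submodule.mem_span_range_iff_exists_fun R).2 ⟨y, ?_⟩
      ext j
      rw [Finset.sum_apply, Finset.sum_eq_single j]
      · rw [Pi.smul_apply, Pi.single_eq_same, ← hy j, Algebra.smul_def, _root_.mul_one]; rfl
      · intro l _ hl
        rw [Pi.smul_apply, Pi.single_eq_of_ne (Ne.symm hl), smul_zero]
      · simp
    · rw [Finset.sum_eq_single i]
      · rw [Matrix.diagonal_apply_eq]
        ext j
        rw [Pi.smul_apply]
        by_cases hij : j = i
        · subst hij
          rw [Pi.single_eq_same, Algebra.smul_def, _root_.mul_one]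
          exact Ideal.Quotient.eq_zero_iff_mem.2 (Ideal.mem_span_singleton_self _)
        · rw [Pi.single_eq_of_ne hij, smul_zero]; rfl
      · intro j _ hj
        rw [Matrix.diagonal_apply_ne _ (Ne.symm hj), zero_smul]
      · simp

/-- A finitely generated torsion module over a principal ideal domain is a finite product of
cyclic modules `R / (a)` with `a ≠ 0`. -/
lemma exists_equiv_pi_quotient [IsDomain R] [IsPrincipalIdealRing R] (M : Type) [AddCommGroup M]
    [Module R M] [Module.Finite R M] (hM : ∃ r : R, r ≠ 0 ∧ ∀ x : M, r • x = 0) :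
    ∃ (n : ℕ) (a : Fin n → R), (∀ j, a j ≠ 0) ∧
      Nonempty (M ≃ₗ[R] ((j : Fin n) → R ⧸ Ideal.span {a j})) := by
  classical
  have ht : Module.IsTorsion R M := by
    obtain ⟨r, hr, h⟩ := hM
    intro x
    exact ⟨⟨r, mem_nonZeroDivisors_of_ne_zero hr⟩, h x⟩
  obtain ⟨σ, hσ, q, hq, e, ⟨f⟩⟩ := Module.equiv_directSum_of_isTorsion ht
  let g := (Fintype.equivFin σ).symm
  refine ⟨Fintype.card σ, fun j => q (g j) ^ e (g j), fun j => pow_ne_zero _ (hq _).ne_zero, ⟨?_⟩⟩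
  exact f.trans ((DirectSum.linearEquivFunOnFintype R σ
    fun i => R ⧸ Ideal.span {q i ^ e i}).trans
      (LinearEquiv.piCongrLeft' R (fun i => R ⧸ Ideal.span {q i ^ e i}) g.symm))

end FittingLemmas

/-! ### Lattices over valuation rings -/

section Lattices

variable {V L : Type} [CommRing V] [Field L] [Algebra V L]

variable (V L) in
/-- The subring `V` of `L` as a `V`-submodule. -/
def integral : Submodule V L := LinearMap.range (Algebra.linearMap V L)

variable (V L) in
/-- The maximal ideal of `V` as a submodule of `L`. -/
def nonunits [IsLocalRing V] : Submodule V L :=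
  Submodule.map (Algebra.linearMap V L) (IsLocalRing.maximalIdeal V)

lemma algebraMap_mem_integral (v : V) : algebraMap V L v ∈ integral V L := ⟨v, rfl⟩

lemma mul_mem_nonunits [IsLocalRing V] {x y : L} (hx : x ∈ nonunits V L)
    (hy : y ∈ integral V L) : x * y ∈ nonunits V L := by
  obtain ⟨a, ha, rfl⟩ := hx
  obtain ⟨b, rfl⟩ := hy
  exact ⟨a * b, Ideal.mul_mem_right _ _ ha, by simp⟩

lemma basis_mem_of_forall_mem_iff {W : Type} [AddCommGroup W] [Module V W] [Module L W]
    {M : Submodule V W} {n : ℕ} (b : Module.Basis (Fin n) L W)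
    (hb : ∀ f, f ∈ M ↔ ∀ i, b.repr f i ∈ integral V L) (i : Fin n) : b i ∈ M := (hb _).2 fun j => by
  rw [b.repr_self, Finsupp.single_apply]
  split_ifs
  · exact ⟨1, by simp⟩
  · exact zero_mem _

variable [IsDomain V] [ValuationRing V] [IsFractionRing V L]

lemma algebraMap_mem_nonunits {v : V} :
    algebraMap V L v ∈ nonunits V L ↔ v ∈ IsLocalRing.maximalIdeal V := by
  constructor
  · rintro ⟨w, hw, h⟩
    rwa [← IsFractionRing.injective V L h]
  · intro h
    exact ⟨v, h, rfl⟩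

/-- A finitely generated `V`-submodule `M` of an `L`-vector space `W` that spans `W` over `L` is
free, with a basis that is an `L`-basis of `W`. -/
lemma exists_lattice_basis {W : Type} [AddCommGroup W] [Module V W] [Module L W]
    [IsScalarTower V L W] (M : Submodule V W) (hM : M.FG) (hfull : ∀ f, ∃ v : V, v ≠ 0 ∧ v • f ∈ M) :
    ∃ (n : ℕ) (b : Module.Basis (Fin n) L W), ∀ f, f ∈ M ↔ ∀ i, b.repr f i ∈ integral V L := by
  have h1 : Module.Finite V M := Module.Finite.iff_fg.2 hM
  have hinj := IsFractionRing.injective V L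
  have h0 : Module.IsTorsionFree V W := Module.IsTorsionFree.trans_faithfulSMul V L W
  have h2 : Module.Flat V M := by
    rw [Module.Flat.flat_iff_torsion_eq_bot_of_isBezout, ← Submodule.isTorsionFree_iff_torsion_eq_bot]
    infer_instance
  have h3 : Module.Free V M := Module.free_of_flat_of_isLocalRing
  let c := Module.finBasis V M
  have h4 : LinearIndependent L (fun i => (c i : W)) := by
    rw [← LinearIndependent.iff_fractionRing V L]
    exact c.linearIndependent.map' M.subtype (Submodule.ker_subtype _)
  have h5 (f : W) (hf : f ∈ M) : f = ∑ i, c.repr ⟨f, hf⟩ i • (c i : W) := by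
    have h := congrArg M.subtype (c.sum_repr ⟨f, hf⟩)
    rw [map_sum] at h
    exact h.symm
  have h6 : ⊤ ≤ Submodule.span L (Set.range fun i => (c i : W)) := by
    intro f _
    obtain ⟨v, hv, hvf⟩ := hfull f
    have hv' : algebraMap V L v ≠ 0 := by
      rwa [Ne, ← map_zero (algebraMap V L), hinj.eq_iff]
    have h7 : f = (algebraMap V L v)⁻¹ • (v • f) := by
      rw [← algebraMap_smul L v f, inv_smul_smul₀ hv']
    rw [h7, h5 _ hvf]
    refine Submodule.smul_mem _ _ (Submodule.sum_mem _ fun i _ => ?_)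
    rw [← algebraMap_smul L]
    exact Submodule.smul_mem _ _ (Submodule.subset_span ⟨i, rfl⟩)
  let b := Module.Basis.mk h4 h6
  have hb (i) : b i = c i := Module.Basis.mk_apply h4 h6 i
  refine ⟨_, b, fun f => ⟨fun hf i => ?_, fun h => ?_⟩⟩
  · have h8 : f = ∑ i, algebraMap V L (c.repr ⟨f, hf⟩ i) • b i := by
      simp only [hb, algebraMap_smul]
      exact h5 f hf
    have h9 : b.repr f i = algebraMap V L (c.repr ⟨f, hf⟩ i) :=
      (congrArg (fun u => b.repr u i) h8).trans (congrFun (b.repr_sum_self _) i)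
    rw [h9]
    exact algebraMap_mem_integral _
  · rw [← b.sum_repr f]
    refine Submodule.sum_mem _ fun i _ => ?_
    obtain ⟨v, hv⟩ := h i
    rw [← hv, Algebra.linearMap_apply, algebraMap_smul, hb]
    exact M.smul_mem _ (c i).2

end Lattices

/-! ### Hopf orders and integrals -/

section HopfOrders

variable {V L Γ : Type} [CommRing V] [Field L] [Algebra V L] [Group Γ]

/-- An order of Hopf algebras in the algebra of `L`-valued functions on a finite group `Γ`: a finite
`V`-subalgebra which spans all functions over the fraction field `L` of `V` and which is stable
under comultiplication and antipode. These are the finite flat group schemes over `V` with constant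
generic fibre `Γ`. -/
structure IsHopfOrder (A : Subalgebra V (Γ → L)) : Prop where
  fg : (Subalgebra.toSubmodule A).FG
  full : ∀ f, ∃ v : V, v ≠ 0 ∧ v • f ∈ A
  comul : ∀ f ∈ A, ∃ (n : ℕ) (a b : Fin n → Γ → L), (∀ i, a i ∈ A) ∧ (∀ i, b i ∈ A) ∧
    ∀ g h, f (g * h) = ∑ i, a i g * b i h
  inv : ∀ f ∈ A, (fun g => f g⁻¹) ∈ A

namespace IsHopfOrder

variable [IsDomain V] [ValuationRing V] [IsFractionRing V L]
variable {A : Subalgebra V (Γ → L)}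

/-- The elements of a Hopf order have integral values, being integral over `V`. -/
lemma apply_mem (hA : IsHopfOrder A) {f : Γ → L} (hf : f ∈ A) (g : Γ) : f g ∈ integral V L := by
  have h1 : IsIntegral V f := by
    have : Module.Finite V A := Module.Finite.iff_fg.2 hA.fg
    exact (Algebra.IsIntegral.isIntegral (R := V) (⟨f, hf⟩ : A)).map A.val
  have h2 : IsIntegral V (f g) := h1.map (Pi.evalAlgHom V (fun _ : Γ => L) g)
  obtain ⟨v, hv⟩ := IsIntegrallyClosed.isIntegral_iff.1 h2
  exact ⟨v, hv⟩

lemma exists_basis (hA : IsHopfOrder A) :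
    ∃ (n : ℕ) (b : Module.Basis (Fin n) L (Γ → L)), ∀ f, f ∈ A ↔ ∀ i, b.repr f i ∈ integral V L :=
  exists_lattice_basis (Subalgebra.toSubmodule A) hA.fg hA.full

omit [IsDomain V] [ValuationRing V] [IsFractionRing V L] in
/-- The comultiplication can be expressed through a given basis of the order. -/
lemma comul_basis (hA : IsHopfOrder A) {n : ℕ} (b : Module.Basis (Fin n) L (Γ → L))
    (hb : ∀ f, f ∈ A ↔ ∀ i, b.repr f i ∈ integral V L) {f : Γ → L} (hf : f ∈ A) :
    ∃ c : Fin n → Γ → L, (∀ i, c i ∈ A) ∧ ∀ g h, f (g * h) = ∑ i, b i g * c i h := by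
  obtain ⟨m, x, y, hx, hy, hxy⟩ := hA.comul f hf
  refine ⟨fun i => ∑ j, b.repr (x j) i • y j, fun i => ?_, fun g h => ?_⟩
  · refine sum_mem fun j _ => ?_
    obtain ⟨v, hv⟩ := (hb _).1 (hx j) i
    rw [← hv, Algebra.linearMap_apply, algebraMap_smul]
    exact A.smul_mem (hy j) v
  · rw [hxy]
    have hj (j) : x j g = ∑ i, b.repr (x j) i * b i g := by
      conv_lhs => rw [← b.sum_repr (x j)]
      simp
    simp only [hj, Finset.sum_mul, Finset.sum_apply, Finset.mul_sum, Pi.smul_apply, smul_eq_mul]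
    rw [Finset.sum_comm]
    exact Finset.sum_congr rfl fun i _ => Finset.sum_congr rfl fun j _ => by ring

/-- The existence of integrals: if the sums `∑ f(g)` of the values of `f ∈ A` form the ideal
`(c)`, then `c` times the characteristic function of the unit element lies in `A`. -/
lemma exists_integral [Fintype Γ] [DecidableEq Γ] (hA : IsHopfOrder A) :
    ∃ c : V, c ≠ 0 ∧ (∀ f ∈ A, (algebraMap V L c)⁻¹ * ∑ g, f g ∈ integral V L) ∧
      Pi.single 1 (algebraMap V L c) ∈ A := by
  have hinj := IsFractionRing.injective V L
  let s : (Γ → L) →ₗ[V] L := ∑ g, LinearMap.proj g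
  have hs (f) : s f = ∑ g, f g := by simp [s]
  -- the ideal of the sums of values
  let T : Ideal V := Submodule.comap (Algebra.linearMap V L) ((Subalgebra.toSubmodule A).map s)
  have hT1 (v : V) : v ∈ T ↔ ∃ f ∈ A, ∑ g, f g = algebraMap V L v := by
    simp only [T, Submodule.mem_comap, Submodule.mem_map, hs]; rfl
  have hsint (f) (hf : f ∈ A) : ∑ g, f g ∈ integral V L :=
    sum_mem fun g _ => hA.apply_mem hf g
  have hT : T.FG := by
    have h1 : Submodule.map (Algebra.linearMap V L) T = (Subalgebra.toSubmodule A).map s := by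
      apply Submodule.map_comap_eq_self
      rintro _ ⟨f, hf, rfl⟩
      rw [hs]
      exact hsint f hf
    refine Submodule.fg_of_fg_map_injective (Algebra.linearMap V L) hinj ?_
    rw [h1]
    exact hA.fg.map s
  obtain ⟨c, hc⟩ := (IsBezout.isPrincipal_of_FG T hT).principal
  have hc' (v : V) : v ∈ T ↔ ∃ w, v = w * c := by
    rw [hc, Submodule.mem_span_singleton]
    simp only [smul_eq_mul, eq_comm]
  have hc0 : c ≠ 0 := by
    obtain ⟨v, hv, hvA⟩ := hA.full (Pi.single 1 1)
    have h2 : v ∈ T := (hT1 v).2 ⟨_, hvA, by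
      simp [Algebra.smul_def, ← Finset.mul_sum]⟩
    obtain ⟨w, rfl⟩ := (hc' v).1 h2
    exact right_ne_zero_of_mul hv
  set C := algebraMap V L c with hC
  have hC0 : C ≠ 0 := by
    rw [hC, Ne, ← map_zero (algebraMap V L), hinj.eq_iff]; exact hc0
  let lam : (Γ → L) →ₗ[L] L := C⁻¹ • ∑ g, LinearMap.proj g
  have hlam (f) : lam f = C⁻¹ * ∑ g, f g := by simp [lam]
  have hlamA (f) (hf : f ∈ A) : lam f ∈ integral V L := by
    obtain ⟨v, hv⟩ := hsint f hf
    obtain ⟨w, rfl⟩ := (hc' v).1 ((hT1 v).2 ⟨f, hf, hv.symm⟩)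
    refine ⟨w, ?_⟩
    rw [hlam, ← hv]
    simp only [Algebra.linearMap_apply, map_mul]
    rw [← hC]
    field_simp
  refine ⟨c, hc0, fun f hf => hlam f ▸ hlamA f hf, ?_⟩
  obtain ⟨f₀, hf₀, hf₀c⟩ := (hT1 c).1 ((hc' c).2 ⟨1, by simp⟩)
  have hf₀1 : lam f₀ = 1 := by rw [hlam, hf₀c, inv_mul_cancel₀ hC0]
  obtain ⟨n, b, hb⟩ := hA.exists_basis
  have hbA (i) : b i ∈ A := basis_mem_of_forall_mem_iff (M := Subalgebra.toSubmodule A) b hb i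
  choose G hG using fun i j => hlamA _ (A.mul_mem (hbA i) (hbA j))
  -- `lam` induces a perfect pairing on `A`: otherwise its radical `N` modulo the maximal ideal contains
  -- some `a` which is nonzero modulo the maximal ideal; but `N` is a subcomodule, and the antipode
  -- shows that all elements of `N` have values at the unit element in the maximal ideal
  have hdet : IsUnit (Matrix.of G).det := by
    by_contra hdet
    have h1 : ((Matrix.of G).map (IsLocalRing.residue V)).det = 0 := by
      rw [← RingHom.mapMatrix_apply, ← RingHom.map_det, IsLocalRing.residue_eq_zero_iff]
      exact hdet
    obtain ⟨w, hw0, hw⟩ := Matrix.exists_mulVec_eq_zero_iff.2 h1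
    choose w' hw' using fun i => IsLocalRing.residue_surjective (w i)
    let a : Γ → L := ∑ j, w' j • b j
    have haA : a ∈ A := sum_mem fun j _ => A.smul_mem (hbA j) _
    let N : Set (Γ → L) := {f | f ∈ A ∧ ∀ x ∈ A, lam (f * x) ∈ nonunits V L}
    have haN : a ∈ N := by
      refine ⟨haA, fun x hx => ?_⟩
      rw [← b.sum_repr x, Finset.mul_sum, map_sum]
      refine sum_mem fun i _ => ?_
      rw [mul_smul_comm, map_smul, smul_eq_mul, mul_comm]
      refine mul_mem_nonunits ?_ ((hb x).1 hx i)
      have h2 : lam (a * b i) = algebraMap V L (∑ j, G i j * w' j) := by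
        rw [map_sum, Finset.sum_mul, map_sum]
        refine Finset.sum_congr rfl fun j _ => ?_
        rw [← algebraMap_smul L (w' j) (b j), smul_mul_assoc, map_smul, mul_comm (b j), ← hG i j,
          map_mul, smul_eq_mul, Algebra.linearMap_apply, mul_comm]
      rw [h2, algebraMap_mem_nonunits, ← IsLocalRing.residue_eq_zero_iff, map_sum]
      have := congrFun hw i
      simpa [Matrix.mulVec, dotProduct, hw'] using this
    -- the right tensor factors of an element of `N` are again in `N`
    have hkey (f) (hf : f ∈ N) (e : Fin n → Γ → L) (he : ∀ i, e i ∈ A)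
        (hfe : ∀ g h, f (g * h) = ∑ i, b i g * e i h) (i) : e i ∈ N := by
      refine ⟨he i, fun x hx => ?_⟩
      obtain ⟨m, y, z, hy, hz, hyz⟩ := hA.comul x hx
      have h3 : ∑ i, lam (e i * x) • b i = ∑ j, lam (f * z j) • fun g => y j g⁻¹ := by
        ext g
        have h4 : ∑ h, f (g * h) * x h = ∑ h, f h * x (g⁻¹ * h) :=
          Fintype.sum_equiv (Equiv.mulLeft g) _ _ fun h => by simp
        simp only [Finset.sum_apply, Pi.smul_apply, smul_eq_mul, hlam, Pi.mul_apply]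
        calc _ = C⁻¹ * ∑ h, f (g * h) * x h := by
              simp only [hfe, Finset.sum_mul, Finset.mul_sum]
              rw [Finset.sum_comm]
              exact Finset.sum_congr rfl fun i _ => Finset.sum_congr rfl fun j _ => by ring
          _ = _ := by
              rw [h4]
              simp only [hyz, Finset.sum_mul, Finset.mul_sum]
              rw [Finset.sum_comm]
              exact Finset.sum_congr rfl fun i _ => Finset.sum_congr rfl fun j _ => by ring
      have h5 := congrArg (fun u => b.repr u i) h3
      simp only [b.repr_sum_self] at h5
      rw [h5, map_sum, Finset.sum_apply']
      refine sum_mem fun j _ => ?_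
      rw [map_smul, Finsupp.smul_apply, smul_eq_mul]
      exact mul_mem_nonunits (hf.2 _ (hz j)) ((hb _).1 (hA.inv _ (hy j)) i)
    obtain ⟨e, he, hae⟩ := hA.comul_basis b hb haA
    have h6 : ∃ i, e i 1 ∉ nonunits V L := by
      obtain ⟨i, hi⟩ := Function.ne_iff.1 hw0
      refine ⟨i, fun h => hi ?_⟩
      have h7 : a = ∑ i, e i 1 • b i := by
        ext g
        have := hae g 1
        rw [_root_.mul_one] at this
        rw [this]
        simp [mul_comm]
      have h8 : b.repr a i = algebraMap V L (w' i) := by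
        have : a = ∑ j, algebraMap V L (w' j) • b j := by simp [a]
        rw [this, b.repr_sum_self]
      rw [h7, b.repr_sum_self] at h8
      rw [h8, algebraMap_mem_nonunits, ← IsLocalRing.residue_eq_zero_iff, hw'] at h
      exact h
    obtain ⟨i, hi⟩ := h6
    have hiN := hkey a haN e he hae i
    obtain ⟨d, hd, hed⟩ := hA.comul_basis b hb hiN.1
    have hdN := hkey _ hiN d hd hed
    apply hi
    have h9 : e i 1 = ∑ j, lam (d j * ((fun g => b j g⁻¹) * f₀)) := by
      have h10 : (e i 1) • f₀ = ∑ j, d j * ((fun g => b j g⁻¹) * f₀) := by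
        ext g
        have := hed g⁻¹ g
        rw [inv_mul_cancel] at this
        simp only [Pi.smul_apply, smul_eq_mul, this, Finset.sum_apply, Pi.mul_apply,
          Finset.sum_mul]
        exact Finset.sum_congr rfl fun j _ => by ring
      rw [← map_sum, ← h10, map_smul, hf₀1, smul_eq_mul, _root_.mul_one]
    rw [h9]
    exact sum_mem fun j _ => (hdN j).2 _ (A.mul_mem (hA.inv _ (hbA j)) hf₀)
  -- the evaluation at the unit element is represented by an element `t` of `A`
  choose v hv using fun i => hA.apply_mem (hbA i) 1
  let u := (Matrix.of G)⁻¹.mulVec v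
  have hu : (Matrix.of G).mulVec u = v := by
    rw [Matrix.mulVec_mulVec, Matrix.mul_nonsing_inv _ hdet, Matrix.one_mulVec]
  let t : Γ → L := ∑ j, u j • b j
  have ht : t ∈ A := sum_mem fun j _ => A.smul_mem (hbA j) _
  have hlt : lam ∘ₗ LinearMap.mulLeft L t = LinearMap.proj 1 := by
    refine b.ext fun i => ?_
    have h2 : lam (t * b i) = algebraMap V L (∑ j, G i j * u j) := by
      rw [map_sum, Finset.sum_mul, map_sum]
      refine Finset.sum_congr rfl fun j _ => ?_
      rw [← algebraMap_smul L (u j) (b j), smul_mul_assoc, map_smul, mul_comm (b j), ← hG i j,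
        map_mul, smul_eq_mul, Algebra.linearMap_apply, mul_comm]
    have h3 : ∑ j, G i j * u j = v i := congrFun hu i
    simp only [LinearMap.comp_apply, LinearMap.mulLeft_apply, LinearMap.proj_apply, h2, h3]
    exact hv i
  have htc : t = Pi.single 1 C := by
    ext g
    have h3 := LinearMap.congr_fun hlt (Pi.single g 1)
    simp only [LinearMap.comp_apply, LinearMap.mulLeft_apply, LinearMap.proj_apply, hlam,
      Pi.mul_apply] at h3
    rw [Finset.sum_eq_single g (fun h _ hh => by simp [Pi.single_eq_of_ne hh]) (by simp),
      Pi.single_eq_same, _root_.mul_one, inv_mul_eq_iff_eq_mul₀ hC0] at h3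
    rw [h3]
    by_cases hg : g = 1
    · subst hg; simp
    · rw [Pi.single_eq_of_ne hg, Pi.single_eq_of_ne (Ne.symm hg), mul_zero]
  rwa [← htc]

end IsHopfOrder

end HopfOrders

/-! ### Subgroups and quotients of Hopf orders -/

section HopfOrderSequences

variable {V L : Type} [CommRing V] [Field L] [Algebra V L]

variable (V L) in
/-- Pull back of functions along a map. -/
def precomp {S T : Type} (u : S → T) : (T → L) →ₐ[V] (S → L) where
  toFun f := f ∘ u
  map_one' := rfl
  map_mul' _ _ := rfl
  map_zero' := rfl
  map_add' _ _ := rfl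
  commutes' _ := rfl

@[simp]
lemma precomp_apply {S T : Type} (u : S → T) (f : T → L) : precomp V L u f = f ∘ u := rfl

namespace IsHopfOrder

variable {Γ₁ Γ₂ Γ₃ : Type} [Group Γ₁] [Group Γ₂] [Group Γ₃] {A : Subalgebra V (Γ₂ → L)}
  {i : Γ₁ →* Γ₂} {q : Γ₂ →* Γ₃}

/-- The restrictions of the functions in `A` to a subgroup form a Hopf order. This is the closed
subgroup scheme with the given generic fibre. -/
lemma restrict (hA : IsHopfOrder A) (hi : Function.Injective i) :
    IsHopfOrder (A.map (precomp V L i)) where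
  fg := by
    have h : Subalgebra.toSubmodule (A.map (precomp V L i)) =
      (Subalgebra.toSubmodule A).map (precomp V L i).toLinearMap := rfl
    rw [h]
    exact hA.fg.map _
  full f := by
    obtain ⟨f', rfl⟩ : ∃ f' : Γ₂ → L, f' ∘ i = f := hi.surjective_comp_right f
    obtain ⟨v, hv, hf⟩ := hA.full f'
    exact ⟨v, hv, _, hf, rfl⟩
  comul := by
    rintro _ ⟨f, hf, rfl⟩
    obtain ⟨n, a, b, ha, hb, hab⟩ := hA.comul f hf
    exact ⟨n, fun j => a j ∘ i, fun j => b j ∘ i, fun j => ⟨_, ha j, rfl⟩, fun j => ⟨_, hb j, rfl⟩,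
      fun g h => by simp [hab]⟩
  inv := by
    rintro _ ⟨f, hf, rfl⟩
    exact ⟨_, hA.inv f hf, by ext g; simp⟩

variable [IsDomain V] [ValuationRing V] [IsFractionRing V L]

omit [Group Γ₃] in
/-- There is a linear projection of the space of all functions onto the space of functions which
factor through `q` that preserves the order `A`. -/
lemma exists_projection (hA : IsHopfOrder A) (q : Γ₂ → Γ₃) :
    ∃ P : (Γ₂ → L) →ₗ[L] (Γ₂ → L), (∀ f ∈ A, P f ∈ A) ∧ (∀ f, ∃ u : Γ₃ → L, u ∘ q = P f) ∧
      ∀ u : Γ₃ → L, P (u ∘ q) = u ∘ q := by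
  let W := LinearMap.range (LinearMap.funLeft L L q)
  let M : Submodule V ((Γ₂ → L) ⧸ W) :=
    (Subalgebra.toSubmodule A).map (W.mkQ.restrictScalars V)
  obtain ⟨n, b, hb⟩ := exists_lattice_basis (L := L) M (hA.fg.map _) fun f => by
    obtain ⟨f', rfl⟩ := W.mkQ_surjective f
    obtain ⟨v, hv, hf⟩ := hA.full f'
    exact ⟨v, hv, _, hf, by simp⟩
  have hbM := basis_mem_of_forall_mem_iff b hb
  choose a haA ha using hbM
  -- a section of the quotient map which preserves the lattices
  let σ : ((Γ₂ → L) ⧸ W) →ₗ[L] (Γ₂ → L) := b.constr L a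
  have hσ : (W.mkQ ∘ₗ σ : ((Γ₂ → L) ⧸ W) →ₗ[L] ((Γ₂ → L) ⧸ W)) = LinearMap.id := b.ext fun j => by
    simp only [LinearMap.comp_apply, σ, b.constr_basis, LinearMap.id_apply]
    exact ha j
  let P : (Γ₂ → L) →ₗ[L] (Γ₂ → L) := LinearMap.id - σ ∘ₗ W.mkQ
  refine ⟨P, fun f hf => ?_, fun f => ?_, fun u => ?_⟩
  · have h1 := (hb (W.mkQ f)).1 ⟨f, hf, rfl⟩
    refine A.sub_mem hf ?_
    have h2 : σ (W.mkQ f) = ∑ j, b.equivFun (W.mkQ f) j • a j :=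
      b.constr_apply_fintype L a (W.mkQ f)
    rw [LinearMap.comp_apply, h2]
    refine sum_mem fun j _ => ?_
    obtain ⟨v, hv⟩ := h1 j
    rw [b.equivFun_apply, ← hv, Algebra.linearMap_apply, algebraMap_smul]
    exact A.smul_mem (haA j) v
  · have h1 : W.mkQ (P f) = 0 := by
      have := LinearMap.congr_fun hσ (W.mkQ f)
      simp only [LinearMap.comp_apply, LinearMap.id_apply] at this
      simp only [P, LinearMap.sub_apply, LinearMap.comp_apply, LinearMap.id_apply, map_sub, this,
        sub_self]
    rw [Submodule.mkQ_apply, Submodule.Quotient.mk_eq_zero] at h1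
    exact h1
  · have h1 : W.mkQ (u ∘ q) = 0 := by
      rw [Submodule.mkQ_apply, Submodule.Quotient.mk_eq_zero]
      exact ⟨u, rfl⟩
    simp only [P, LinearMap.sub_apply, LinearMap.comp_apply, h1, map_zero, sub_zero,
      LinearMap.id_apply]

/-- The functions in `A` which factor through a quotient of the group form a Hopf order. This is the
quotient of group schemes by the subgroup scheme above. -/
lemma quotient (hA : IsHopfOrder A) (hq : Function.Surjective q) :
    IsHopfOrder (A.comap (precomp V L q)) := by
  obtain ⟨P, hPA, hPq, hP⟩ := hA.exists_projection q
  have hq' : Function.Injective fun u : Γ₃ → L => u ∘ q := hq.injective_comp_right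
  refine ⟨?_, fun f => ?_, fun f hf => ?_, fun f hf => ?_⟩
  · refine Submodule.fg_of_fg_map_injective (precomp V L q).toLinearMap hq' ?_
    have h : (Subalgebra.toSubmodule (A.comap (precomp V L q))).map (precomp V L q).toLinearMap =
        (Subalgebra.toSubmodule A).map (P.restrictScalars V) := by
      ext f
      constructor
      · rintro ⟨u, hu, rfl⟩
        exact ⟨_, hu, hP u⟩
      · rintro ⟨f, hf, rfl⟩
        obtain ⟨u, hu⟩ := hPq f
        refine ⟨u, ?_, hu⟩
        change u ∘ q ∈ A
        rw [hu]
        exact hPA f hf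
    rw [h]
    exact hA.fg.map _
  · obtain ⟨v, hv, h⟩ := hA.full (f ∘ q)
    exact ⟨v, hv, h⟩
  · obtain ⟨n, a, b, ha, hb, hab⟩ := hA.comul _ hf
    choose α hα using fun j => hPq (a j)
    choose β hβ using fun j => hPq (b j)
    refine ⟨n, α, β, fun j => ?_, fun j => ?_, fun g h => ?_⟩
    · change α j ∘ q ∈ A
      exact hα j ▸ hPA _ (ha j)
    · change β j ∘ q ∈ A
      exact hβ j ▸ hPA _ (hb j)
    · obtain ⟨g, rfl⟩ := hq g
      obtain ⟨h, rfl⟩ := hq h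
      have h1 (h) : (fun g => f (g * q h)) ∘ q = ∑ j, b j h • a j := by
        ext g
        have h0 : f (q (g * h)) = ∑ j, a j g * b j h := hab g h
        rw [map_mul] at h0
        simp [h0, mul_comm]
      have h2 (h g) : f (q g * q h) = ∑ j, α j (q g) * b j h := by
        have := congrFun (congrArg P (h1 h)) g
        rw [hP, map_sum] at this
        simp only [map_smul, ← hα, Finset.sum_apply, Pi.smul_apply, Function.comp_apply,
          smul_eq_mul] at this
        rw [this]
        exact Finset.sum_congr rfl fun j _ => mul_comm _ _
      have h3 : (fun h => f (q g * h)) ∘ q = ∑ j, α j (q g) • b j := by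
        ext h
        simp [h2]
      have := congrFun (congrArg P h3) h
      rw [hP, map_sum] at this
      simpa [← hβ] using this
  · have h := hA.inv _ hf
    change (fun g => f g⁻¹) ∘ q ∈ A
    convert h using 1
    ext g
    simp

omit [IsDomain V] [ValuationRing V] [IsFractionRing V L] in
/-- Integration over the fibres of `q` maps the order `A` to its functions which factor through
`q`. -/
lemma exists_fibre_integral [Fintype Γ₁] (hA : IsHopfOrder A)
    (hq : Function.Surjective q) (hiq : ∀ g, q g = 1 ↔ ∃ h, i h = g) {C : L}
    (hC : ∀ f ∈ A.map (precomp V L i), C⁻¹ * ∑ g, f g ∈ integral V L) {u : Γ₂ → L} (hu : u ∈ A) :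
    ∃ w ∈ A.comap (precomp V L q), ∀ g, w (q g) = C⁻¹ * ∑ h, u (g * i h) := by
  let F : Γ₂ → L := fun g => C⁻¹ * ∑ h, u (g * i h)
  have hF (g g') (h : q g = q g') : F g = F g' := by
    obtain ⟨d, hd⟩ := (hiq (g'⁻¹ * g)).1 (by simp [h])
    have h2 : g = g' * i d := by rw [hd]; group
    simp only [F]
    congr 1
    refine Fintype.sum_equiv (Equiv.mulLeft d) _ _ fun h => ?_
    rw [Equiv.coe_mulLeft, map_mul, h2, _root_.mul_assoc]
  have hFA : F ∈ A := by
    obtain ⟨n, a, b, ha, hb, hab⟩ := hA.comul u hu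
    have h3 : F = ∑ j, (C⁻¹ * ∑ h, b j (i h)) • a j := by
      ext g
      simp only [F, hab, Finset.sum_apply, Pi.smul_apply, smul_eq_mul, Finset.mul_sum,
        Finset.sum_mul]
      rw [Finset.sum_comm]
      exact Finset.sum_congr rfl fun j _ => Finset.sum_congr rfl fun k _ => by ring
    rw [h3]
    refine sum_mem fun j _ => ?_
    obtain ⟨v, hv⟩ := hC _ ⟨b j, hb j, rfl⟩
    have h4 : C⁻¹ * ∑ h, b j (i h) = algebraMap V L v := hv.symm
    rw [h4, algebraMap_smul]
    exact A.smul_mem (ha j) v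
  have h5 (g) : F (Function.surjInv hq (q g)) = F g := hF _ _ (Function.surjInv_eq hq _)
  refine ⟨fun k => F (Function.surjInv hq k), ?_, h5⟩
  change (fun k => F (Function.surjInv hq k)) ∘ q ∈ A
  convert hFA using 1
  ext g
  exact h5 g

/-- The functions in `A` which vanish on the kernel of `q` are generated by the pull back of the
augmentation ideal along `q`. -/
lemma eq_sum_of_comp_eq_zero [Finite Γ₁] (hA : IsHopfOrder A) (hi : Function.Injective i)
    (hq : Function.Surjective q) (hiq : ∀ g, q g = 1 ↔ ∃ h, i h = g) {f : Γ₂ → L} (hf : f ∈ A)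
    (hfi : f ∘ i = 0) : ∃ (n : ℕ) (x : Fin n → Γ₂ → L) (y : Fin n → Γ₃ → L), (∀ j, x j ∈ A) ∧
      (∀ j, y j ∈ A.comap (precomp V L q)) ∧ (∀ j, y j 1 = 0) ∧ f = ∑ j, x j * (y j ∘ q) := by
  classical
  have := Fintype.ofFinite Γ₁
  obtain ⟨c, hc0, hc, t, htA, ht⟩ := (hA.restrict hi).exists_integral
  have hC0 : algebraMap V L c ≠ 0 := by
    rwa [Ne, ← map_zero (algebraMap V L), (IsFractionRing.injective V L).eq_iff]
  obtain ⟨n, x, y, hx, hy, hxy⟩ := hA.comul t htA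
  choose w hwA hw using fun j => hA.exists_fibre_integral hq hiq hc (A.mul_mem (hy j) hf)
  refine ⟨n, fun j g => x j g⁻¹, w, fun j => hA.inv _ (hx j), hwA, fun j => ?_, ?_⟩
  · have h1 := hw j 1
    rw [map_one] at h1
    rw [h1]
    have h2 (h) : f (i h) = 0 := congrFun hfi h
    simp [h2]
  · ext g
    have h3 (h) : t (i h) = Pi.single (M := fun _ => L) 1 (algebraMap V L c) h := congrFun ht h
    have h4 : f g = (algebraMap V L c)⁻¹ * ∑ h, t (g⁻¹ * (g * i h)) * f (g * i h) := by
      simp only [inv_mul_cancel_left, h3]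
      rw [Finset.sum_eq_single 1 (fun h _ hh => by simp [Pi.single_eq_of_ne hh]) (by simp),
        Pi.single_eq_same, map_one, _root_.mul_one, inv_mul_cancel_left₀ hC0]
    rw [h4]
    simp only [hxy, Finset.sum_apply, Pi.mul_apply, Function.comp_apply, hw, Finset.mul_sum,
      Finset.sum_mul]
    rw [Finset.sum_comm]
    exact Finset.sum_congr rfl fun j _ => Finset.sum_congr rfl fun k _ => by ring

/-- An element `r` with `r δ₁ ∈ A` is a product of two such elements for the restriction of `A` to
the kernel of `q` and for the functions in `A` which factor through `q`. -/
lemma exists_mul_of_single_mem [Finite Γ₁] [DecidableEq Γ₁] [DecidableEq Γ₂] [DecidableEq Γ₃]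
    (hA : IsHopfOrder A)
    (hi : Function.Injective i) (hq : Function.Surjective q) (hiq : ∀ g, q g = 1 ↔ ∃ h, i h = g)
    {r : V} (hr : Pi.single 1 (algebraMap V L r) ∈ A) : ∃ r₁ r₃ : V, r = r₁ * r₃ ∧
      Pi.single 1 (algebraMap V L r₁) ∈ A.map (precomp V L i) ∧
      Pi.single 1 (algebraMap V L r₃) ∈ A.comap (precomp V L q) := by
  have := Fintype.ofFinite Γ₁
  obtain ⟨c, hc0, hc, ht⟩ := (hA.restrict hi).exists_integral
  have hC0 : algebraMap V L c ≠ 0 := by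
    rwa [Ne, ← map_zero (algebraMap V L), (IsFractionRing.injective V L).eq_iff]
  obtain ⟨w, hwA, hw⟩ := hA.exists_fibre_integral hq hiq hc hr
  have h1 : w = Pi.single 1 ((algebraMap V L c)⁻¹ * algebraMap V L r) := by
    ext k
    obtain ⟨g, rfl⟩ := hq k
    rw [hw]
    by_cases hg : q g = 1
    · obtain ⟨d, rfl⟩ := (hiq g).1 hg
      rw [hg, Pi.single_eq_same, Finset.sum_eq_single d⁻¹]
      · simp
      · intro h _ hh
        rw [Pi.single_eq_of_ne]
        rw [← map_mul, Ne, ← map_one i, hi.eq_iff]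
        intro h5
        exact hh (eq_inv_of_mul_eq_one_right h5)
      · simp
    · rw [Pi.single_eq_of_ne hg, Finset.sum_eq_zero, mul_zero]
      intro h _
      rw [Pi.single_eq_of_ne]
      intro h5
      apply hg
      have := congrArg q h5
      rwa [map_mul, (hiq (i h)).2 ⟨h, rfl⟩, _root_.mul_one, map_one] at this
  obtain ⟨r₃, h3⟩ := (hA.quotient hq).apply_mem hwA 1
  rw [h1, Pi.single_eq_same] at h3
  refine ⟨c, r₃, ?_, ht, ?_⟩
  · apply IsFractionRing.injective V L
    rw [map_mul]
    change _ = _ * Algebra.linearMap V L r₃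
    rw [h3, mul_inv_cancel_left₀ hC0]
  · have h4 : algebraMap V L r₃ = (algebraMap V L c)⁻¹ * algebraMap V L r := h3
    rw [h4, ← h1]
    exact hwA

end IsHopfOrder

/-! ### Cotangent spaces of Hopf orders -/

section Omega

variable {Γ : Type} [Group Γ]

/-- The functions in `A` which vanish at the unit element. -/
def augSubmodule (A : Subalgebra V (Γ → L)) : Submodule V (Γ → L) :=
  Subalgebra.toSubmodule A ⊓ LinearMap.ker (LinearMap.proj (R := V) (φ := fun _ : Γ => L) 1)

lemma mem_augSubmodule {A : Subalgebra V (Γ → L)} {f : Γ → L} :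
    f ∈ augSubmodule A ↔ f ∈ A ∧ f 1 = 0 := Iff.rfl

/-- The cotangent space `I / I²` at the unit section of an order `A` in the functions on `Γ`. -/
abbrev orderOmega (A : Subalgebra V (Γ → L)) : Type :=
  augSubmodule A ⧸ (augSubmodule A * augSubmodule A).comap (augSubmodule A).subtype

lemma augSubmodule_mul_le (A : Subalgebra V (Γ → L)) :
    augSubmodule A * augSubmodule A ≤ augSubmodule A :=
  Submodule.mul_le.2 fun _ hf _ hg => ⟨A.mul_mem hf.1 hg.1, by
    rw [mem_augSubmodule] at hf
    simp [LinearMap.mem_ker, hf.2]⟩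

end Omega

section OmegaExact

variable {Γ Γ' : Type} [Group Γ] [Group Γ']

lemma precomp_mem_augSubmodule {A : Subalgebra V (Γ → L)} {B : Subalgebra V (Γ' → L)}
    {u : Γ' →* Γ} (h : ∀ f ∈ A, precomp V L u f ∈ B) {f : Γ → L} (hf : f ∈ augSubmodule A) :
    (precomp V L u).toLinearMap f ∈ augSubmodule B :=
  ⟨h f hf.1, by
    have := (mem_augSubmodule.1 hf).2
    simpa [LinearMap.mem_ker] using this⟩

/-- The map induced on cotangent spaces by a homomorphism of groups. -/
def orderOmegaMap (A : Subalgebra V (Γ → L)) (B : Subalgebra V (Γ' → L)) (u : Γ' →* Γ)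
    (h : ∀ f ∈ A, precomp V L u f ∈ B) : orderOmega A →ₗ[V] orderOmega B :=
  Submodule.mapQ _ _ ((precomp V L u).toLinearMap.restrict
      fun _ hf => precomp_mem_augSubmodule h hf) <| by
    intro f hf
    rw [Submodule.mem_comap] at hf ⊢
    have h2 : (augSubmodule A * augSubmodule A).map (precomp V L u).toLinearMap ≤
        augSubmodule B * augSubmodule B := by
      rw [Submodule.map_mul]
      refine mul_le_mul' ?_ ?_ <;>
      · rintro _ ⟨g, hg, rfl⟩
        exact precomp_mem_augSubmodule h hg
    exact h2 ⟨_, hf, rfl⟩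

lemma orderOmegaMap_mk (A : Subalgebra V (Γ → L)) (B : Subalgebra V (Γ' → L)) (u : Γ' →* Γ)
    (h : ∀ f ∈ A, precomp V L u f ∈ B) (f : augSubmodule A) :
    orderOmegaMap A B u h (Submodule.Quotient.mk f) =
      Submodule.Quotient.mk ⟨precomp V L u f, precomp_mem_augSubmodule h f.2⟩ := rfl

end OmegaExact

section CotangentExact

variable [IsDomain V] [ValuationRing V] [IsFractionRing V L]
  {Γ₁ Γ₂ Γ₃ : Type} [Group Γ₁] [Group Γ₂] [Group Γ₃] {A : Subalgebra V (Γ₂ → L)}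
  {i : Γ₁ →* Γ₂} {q : Γ₂ →* Γ₃}

/-- Fitting ideals of cotangent spaces are submultiplicative in exact sequences of Hopf orders: the
cotangent sequence is right exact, by `IsHopfOrder.eq_sum_of_comp_eq_zero`. -/
lemma IsHopfOrder.fittingIdeal_mul_le [Finite Γ₁] (hA : IsHopfOrder A)
    (hi : Function.Injective i) (hq : Function.Surjective q) (hiq : ∀ g, q g = 1 ↔ ∃ h, i h = g) :
    fittingIdeal V (orderOmega (A.map (precomp V L i))) *
      fittingIdeal V (orderOmega (A.comap (precomp V L q))) ≤ fittingIdeal V (orderOmega A) := by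
  have hmap : (augSubmodule A).map (precomp V L i).toLinearMap =
      augSubmodule (A.map (precomp V L i)) := by
    ext f
    constructor
    · rintro ⟨g, hg, rfl⟩
      exact precomp_mem_augSubmodule (fun f hf => Subalgebra.mem_map.2 ⟨f, hf, rfl⟩) hg
    · rintro ⟨⟨g, hg, rfl⟩, h⟩
      refine ⟨g, ⟨hg, ?_⟩, rfl⟩
      simpa [LinearMap.mem_ker] using h
  have hmem : ∀ f ∈ A, precomp V L i f ∈ A.map (precomp V L i) := fun f hf => ⟨f, hf, rfl⟩
  have hmem3 : ∀ f ∈ A.comap (precomp V L q), precomp V L q f ∈ A := fun f hf => hf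
  refine PartialDegree.fittingIdeal_mul_le (orderOmegaMap (A.comap (precomp V L q)) A q hmem3)
    (orderOmegaMap A _ i hmem) ?_ ?_
  · intro x
    obtain ⟨⟨f, hf⟩, rfl⟩ := Submodule.Quotient.mk_surjective _ x
    obtain ⟨g, hg, rfl⟩ := hmap.symm ▸ hf
    exact ⟨Submodule.Quotient.mk ⟨g, hg⟩, rfl⟩
  · intro x hx
    obtain ⟨⟨f, hf⟩, rfl⟩ := Submodule.Quotient.mk_surjective _ x
    rw [LinearMap.mem_ker, orderOmegaMap_mk, Submodule.Quotient.mk_eq_zero,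
      Submodule.mem_comap] at hx
    change f ∘ i ∈ _ at hx
    rw [← hmap, ← Submodule.map_mul] at hx
    obtain ⟨e, he, hef⟩ := hx
    have he' := augSubmodule_mul_le A he
    obtain ⟨n, x, y, hx, hy, hy1, hxy⟩ := hA.eq_sum_of_comp_eq_zero hi hq hiq
      (A.sub_mem hf.1 he'.1) (by
        ext g
        have := congrFun hef g
        simp only [Function.comp_apply, Pi.sub_apply, Pi.zero_apply, sub_eq_zero]
        exact this.symm)
    choose v hv using fun j => hA.apply_mem (hx j) 1
    let z : augSubmodule (A.comap (precomp V L q)) := ∑ j, v j • ⟨y j, hy j, hy1 j⟩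
    have hz : z.1 = ∑ j, v j • y j := by
      simp only [z, AddSubmonoidClass.coe_finsetSum, SetLike.val_smul]
    have h6 : z.1 ∘ q - f = - e - ∑ j, (x j - algebraMap V (Γ₂ → L) (v j)) * (y j ∘ q) := by
      have h7 : f = e + ∑ j, x j * (y j ∘ q) := by rw [← hxy]; abel
      have h8 : z.1 ∘ q = ∑ j, v j • (y j ∘ q) := by
        rw [hz]
        ext g
        simp
      rw [h7, h8]
      simp only [sub_mul, Finset.sum_sub_distrib, Algebra.smul_def]
      abel
    refine ⟨Submodule.Quotient.mk z, ?_⟩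
    rw [orderOmegaMap_mk]
    refine (Submodule.Quotient.eq _).2 ?_
    change z.1 ∘ q - f ∈ augSubmodule A * augSubmodule A
    rw [h6]
    refine sub_mem (neg_mem he) (sum_mem fun j _ => Submodule.mul_mem_mul ?_ ?_)
    · refine ⟨A.sub_mem (hx j) (A.algebraMap_mem _), ?_⟩
      have := hv j
      simp only [Algebra.linearMap_apply] at this
      simp [LinearMap.mem_ker, this]
    · exact precomp_mem_augSubmodule (A := A.comap (precomp V L q)) hmem3 ⟨hy j, hy1 j⟩

end CotangentExact

end HopfOrderSequences

/-! ### Derivations modulo an ideal -/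

section ApproximateDerivations

variable {C : Type} [CommRing C] {N : Ideal C} {D : C →+ C}

/-- A derivation modulo `N` maps `I ^ (k + 1)` to `I ^ k` modulo `N`. -/
lemma derivation_mem_pow (hN : ∀ n ∈ N, D n ∈ N)
    (hD : ∀ a b, D (a * b) - (a * D b + b * D a) ∈ N) (I : Ideal C) (k : ℕ) :
    ∀ a ∈ I ^ (k + 1) ⊔ N, D a ∈ I ^ k ⊔ N := by
  induction k with
  | zero => simp
  | succ k ih =>
    intro a ha
    obtain ⟨b, hb, n, hn, rfl⟩ := Submodule.mem_sup.1 ha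
    rw [map_add]
    refine add_mem ?_ (Ideal.mem_sup_right (hN n hn))
    rw [pow_succ'] at hb
    refine Submodule.mul_induction_on hb (fun x hx y hy => ?_) fun x y hx hy => ?_
    · have h1 : D (x * y) = (D (x * y) - (x * D y + y * D x)) + (x * D y + y * D x) := by ring
      rw [h1]
      refine add_mem (Ideal.mem_sup_right (hD x y)) (add_mem ?_ ?_)
      · obtain ⟨u, hu, w, hw, h⟩ := Submodule.mem_sup.1 (ih y (Ideal.mem_sup_left hy))
        rw [← h, mul_add, pow_succ']
        exact add_mem (Ideal.mem_sup_left (Ideal.mul_mem_mul hx hu))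
          (Ideal.mem_sup_right (N.mul_mem_left _ hw))
      · exact Ideal.mem_sup_left (Ideal.mul_mem_right _ _ hy)
    · rw [map_add]
      exact add_mem hx hy

lemma derivation_pow_sub_mem
    (hD : ∀ a b, D (a * b) - (a * D b + b * D a) ∈ N) (x : C) (m : ℕ) :
    D (x ^ (m + 1)) - (m + 1) * x ^ m * D x ∈ N := by
  induction m with
  | zero => simp
  | succ m ih =>
    have h := add_mem (hD x (x ^ (m + 1))) (N.mul_mem_left x ih)
    convert h using 1
    rw [pow_succ' x (m + 1)]
    push_cast
    ring

/-- If `D` is a derivation modulo `N` and `x ∈ I` has `D x ≡ 1` modulo `I + N`, then `xᵐ` does not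
lie in `I ^ (m + 1) + N` as long as the integers up to `m` are invertible. -/
lemma pow_notMem_of_derivation (hN : ∀ n ∈ N, D n ∈ N)
    (hD : ∀ a b, D (a * b) - (a * D b + b * D a) ∈ N) {I : Ideal C} (h1 : (1 : C) ∉ I ⊔ N) {x : C}
    (hx : x ∈ I) (hDx : D x - 1 ∈ I ⊔ N) (m : ℕ) (hm : ∀ k, 1 ≤ k → k ≤ m → IsUnit (k : C)) :
    x ^ m ∉ I ^ (m + 1) ⊔ N := by
  induction m with
  | zero => simpa using h1
  | succ m ih =>
    intro h
    apply ih fun k hk hkm => hm k hk (by omega)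
    have h2 := derivation_mem_pow hN hD I _ _ h
    have h3 := (Ideal.mem_sup_right (S := I ^ (m + 1)) (derivation_pow_sub_mem hD x m))
    have h4 := sub_mem h2 h3
    rw [sub_sub_cancel] at h4
    have h5 : (m + 1 : C) * x ^ m * (D x - 1) ∈ I ^ (m + 1) ⊔ N := by
      obtain ⟨u, hu, w, hw, h⟩ := Submodule.mem_sup.1 hDx
      rw [← h, mul_add, pow_succ]
      refine add_mem (Ideal.mem_sup_left (Ideal.mul_mem_mul ?_ hu))
        (Ideal.mem_sup_right (N.mul_mem_left _ hw))
      exact Ideal.mul_mem_left _ _ (Ideal.pow_mem_pow hx m)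
    have h6 := sub_mem h4 h5
    have h7 : (m + 1 : C) * x ^ m * D x - (m + 1 : C) * x ^ m * (D x - 1) =
      ((m + 1 : ℕ) : C) * x ^ m := by push_cast; ring
    rw [h7] at h6
    obtain ⟨u, hu⟩ := hm (m + 1) (by omega) le_rfl
    rw [← hu] at h6
    simpa using Ideal.mul_mem_left _ (↑u⁻¹ : C) h6

/-- In the situation of `pow_notMem_of_derivation`, the powers of `x` are linearly independent
modulo `N`. -/
lemma coeff_mem_of_sum_mem {V : Type} [CommRing V] [IsLocalRing V] [Algebra V C] {I : Ideal C}
    {x : C} (hx : x ∈ I) {n : ℕ} (h : ∀ m < n, x ^ m ∉ I ^ (m + 1) ⊔ N)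
    (hV : ∀ v ∈ IsLocalRing.maximalIdeal V, algebraMap V C v ∈ N) (v : Fin n → V)
    (hv : ∑ j, v j • x ^ (j : ℕ) ∈ N) (j : Fin n) : v j ∈ IsLocalRing.maximalIdeal V := by
  obtain ⟨j, hj⟩ := j
  induction j using Nat.strong_induction_on with
  | _ j ih =>
  by_contra hu
  have hu : IsUnit (v ⟨j, hj⟩) := by simpa using hu
  apply h j hj
  have h1 : v ⟨j, hj⟩ • x ^ j = ∑ k, v k • x ^ (k : ℕ) -
      ∑ k ∈ Finset.univ.erase ⟨j, hj⟩, v k • x ^ (k : ℕ) := by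
    rw [← Finset.add_sum_erase _ _ (Finset.mem_univ (⟨j, hj⟩ : Fin n))]
    ring
  have h2 : v ⟨j, hj⟩ • x ^ j ∈ I ^ (j + 1) ⊔ N := by
    rw [h1]
    refine sub_mem (Ideal.mem_sup_right hv) (sum_mem fun k hk => ?_)
    rcases lt_trichotomy k.1 j with hkj | hkj | hkj
    · rw [Algebra.smul_def]
      exact Ideal.mem_sup_right (N.mul_mem_right _ (hV _ (ih k.1 hkj k.2)))
    · exact absurd (Fin.ext hkj) (Finset.ne_of_mem_erase hk)
    · rw [Algebra.smul_def]
      exact Ideal.mem_sup_left (Ideal.mul_mem_left _ _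
        (Ideal.pow_le_pow_right hkj (Ideal.pow_mem_pow hx _)))
  obtain ⟨u, hu⟩ := hu
  rw [← hu, Algebra.smul_def] at h2
  have h3 := Ideal.mul_mem_left _ (algebraMap V C ↑u⁻¹) h2
  rwa [← _root_.mul_assoc, ← map_mul, Units.inv_mul, map_one, _root_.one_mul] at h3

end ApproximateDerivations

/-! ### The Fitting ideal of the cotangent space of a Hopf order -/

section CyclicOrder

variable {V L Γ : Type} [CommRing V] [Field L] [Algebra V L] [Group Γ]
  [IsDomain V] [ValuationRing V] [IsFractionRing V L] {A : Subalgebra V (Γ → L)}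

namespace IsHopfOrder

/-- The value at the unit element, as a homomorphism from the order `A` to `V`. -/
lemma exists_counit (hA : IsHopfOrder A) :
    ∃ e : A →ₐ[V] V, ∀ f : A, algebraMap V L (e f) = f.1 1 := by
  have hinj := IsFractionRing.injective V L
  choose e he using fun f : A => hA.apply_mem f.2 1
  simp only [Algebra.linearMap_apply] at he
  exact ⟨{ toFun := e
           map_one' := hinj (by simp [he])
           map_zero' := hinj (by simp [he])
           map_mul' := fun f g => hinj (by simp [he])
           map_add' := fun f g => hinj (by simp [he])
           commutes' := fun v => hinj (by simp [he]) }, he⟩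

lemma augSubmodule_fg (hA : IsHopfOrder A) : (augSubmodule A).FG := by
  obtain ⟨e, he⟩ := hA.exists_counit
  let P : A →ₗ[V] (Γ → L) := A.val.toLinearMap - (Algebra.linearMap V (Γ → L)) ∘ₗ e.toLinearMap
  have h : augSubmodule A = LinearMap.range P := by
    ext f
    constructor
    · rintro ⟨hf, hf1⟩
      have h1 : e ⟨f, hf⟩ = 0 := IsFractionRing.injective V L (by
        rw [he, map_zero]; exact hf1)
      refine ⟨⟨f, hf⟩, ?_⟩
      simp [P, h1]
    · rintro ⟨f, rfl⟩
      refine ⟨A.sub_mem f.2 (A.algebraMap_mem _), ?_⟩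
      simp [P, LinearMap.mem_ker, he]
  have : Module.Finite V A := Module.Finite.iff_fg.2 hA.fg
  rw [h]
  exact Module.Finite.iff_fg.1 inferInstance

/-- A linear form on `I / I²` modulo the maximal ideal of `V`, regarded as a tangent vector at the
unit element, lifts to an invariant operator on `A` which is a derivation modulo the maximal ideal
of `V`. -/
lemma exists_derivation (hA : IsHopfOrder A) (d : A →ₗ[V] V ⧸ IsLocalRing.maximalIdeal V)
    (hd : ∀ (f g : A) (a b : V), algebraMap V L a = f.1 1 → algebraMap V L b = g.1 1 →
      d (f * g) = a • d g + b • d f) :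
    ∃ D : A →ₗ[V] A,
      (∀ a b, D (a * b) - (a * D b + b * D a) ∈
        (IsLocalRing.maximalIdeal V).map (algebraMap V A)) ∧
      ∀ (f : A) (v : V), algebraMap V L v = (D f).1 1 →
        Ideal.Quotient.mk (IsLocalRing.maximalIdeal V) v = d f := by
  have hinj := IsFractionRing.injective V L
  obtain ⟨n, b, hb⟩ := hA.exists_basis
  have hbA (i) : b i ∈ A := basis_mem_of_forall_mem_iff (M := Subalgebra.toSubmodule A) b hb i
  choose w hw using fun i => Ideal.Quotient.mk_surjective (d ⟨b i, hbA i⟩)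
  let d' : (Γ → L) →ₗ[L] L := b.constr L fun i => algebraMap V L (w i)
  -- `d'` lifts `d`
  have hd' (f : A) : ∃ v, algebraMap V L v = d' f ∧
      Ideal.Quotient.mk (IsLocalRing.maximalIdeal V) v = d f := by
    choose u hu using (hb f).1 f.2
    simp only [Algebra.linearMap_apply] at hu
    have h1 : f = ∑ i, u i • (⟨b i, hbA i⟩ : A) := by
      apply Subtype.ext
      have h2 := b.sum_repr f
      rw [← h2, AddSubmonoidClass.coe_finsetSum]
      refine Finset.sum_congr rfl fun i _ => ?_
      rw [← hu, algebraMap_smul]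
      rfl
    refine ⟨∑ i, u i * w i, ?_, ?_⟩
    · have h2 : d' f = ∑ j, b.equivFun f j • algebraMap V L (w j) :=
        b.constr_apply_fintype L _ f
      rw [h2, map_sum]
      refine Finset.sum_congr rfl fun i _ => ?_
      rw [b.equivFun_apply, ← hu, smul_eq_mul, map_mul]
    · conv_rhs => rw [h1]
      rw [map_sum, map_sum]
      refine Finset.sum_congr rfl fun i _ => ?_
      rw [map_smul, ← hw, map_mul]
      rfl
  let D' : (Γ → L) →ₗ[L] (Γ → L) := LinearMap.pi fun g => d' ∘ₗ LinearMap.funLeft L L (g * ·)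
  have hD'1 (f : Γ → L) (g) : D' f g = d' fun h => f (g * h) := rfl
  have hD'2 (f) (c : Fin n → Γ → L) (hc : ∀ g h, f (g * h) = ∑ i, b i g * c i h) (g) :
      D' f g = ∑ i, b i g * d' (c i) := by
    have : (fun h => f (g * h)) = ∑ i, b i g • c i := by
      ext h
      simp [hc]
    rw [hD'1, this, map_sum]
    simp
  have hD'A (f) (hf : f ∈ A) : D' f ∈ A := by
    obtain ⟨c, hcA, hc⟩ := hA.comul_basis b hb hf
    choose v hv using fun i => hd' ⟨c i, hcA i⟩
    have h : D' f = ∑ i, v i • b i := by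
      ext g
      rw [hD'2 f c hc]
      simp only [Finset.sum_apply, Pi.smul_apply, (hv _).1.symm]
      exact Finset.sum_congr rfl fun i _ => by rw [Algebra.smul_def, mul_comm]
    rw [h]
    exact sum_mem fun i _ => A.smul_mem (hbA i) _
  let D : A →ₗ[V] A := (D'.restrictScalars V).restrict (p := Subalgebra.toSubmodule A)
    (q := Subalgebra.toSubmodule A) hD'A
  refine ⟨D, fun f f' => ?_, fun f v hv => ?_⟩
  · obtain ⟨c, hcA, hc⟩ := hA.comul_basis b hb f.2
    obtain ⟨c', hcA', hc'⟩ := hA.comul_basis b hb f'.2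
    choose v hv hv' using fun i => hd' ⟨c i, hcA i⟩
    choose w hw hw' using fun i => hd' ⟨c' i, hcA' i⟩
    choose u hu hu' using fun i j => hd' (⟨c i, hcA i⟩ * ⟨c' j, hcA' j⟩)
    choose x hx using fun i => hA.apply_mem (hcA i) 1
    choose y hy using fun i => hA.apply_mem (hcA' i) 1
    simp only [Algebra.linearMap_apply] at hx hy
    let s (i j) : V := u i j - (x i * w j + y j * v i)
    have hs (i j) : s i j ∈ IsLocalRing.maximalIdeal V := by
      rw [← Ideal.Quotient.eq_zero_iff_mem]
      have := hd ⟨c i, hcA i⟩ ⟨c' j, hcA' j⟩ (x i) (y j) (hx i) (hy j)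
      simp only [s, map_sub, map_add, map_mul, hu', hv', hw', this]
      exact sub_self _
    have h1 : D (f * f') - (f * D f' + f' * D f) =
        ∑ i, ∑ j, s i j • (⟨b i, hbA i⟩ * ⟨b j, hbA j⟩ : A) := by
      apply Subtype.ext
      ext g
      have h2 : D' (f.1 * f'.1) g = ∑ i, ∑ j, (b i g * b j g) * d' (c i * c' j) := by
        have : (fun h => (f.1 * f'.1) (g * h)) = ∑ i, ∑ j, (b i g * b j g) • (c i * c' j) := by
          ext h
          simp only [Pi.mul_apply, hc, hc', Finset.sum_apply, Pi.smul_apply, smul_eq_mul,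
            Finset.sum_mul_sum]
          exact Finset.sum_congr rfl fun i _ => Finset.sum_congr rfl fun j _ => by ring
        rw [hD'1, this]
        simp
      have h3 : f.1 g = ∑ i, b i g * c i 1 := by simpa using hc g 1
      have h4 : f'.1 g = ∑ i, b i g * c' i 1 := by simpa using hc' g 1
      have h5 : (D (f * f') - (f * D f' + f' * D f)).1 g = D' (f.1 * f'.1) g -
        (f.1 g * D' f'.1 g + f'.1 g * D' f.1 g) := rfl
      rw [h5, h2, hD'2 _ c hc, hD'2 _ c' hc', h3, h4]
      have h6 (i j) : algebraMap V L (s i j) =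
          d' (c i * c' j) - (c i 1 * d' (c' j) + c' j 1 * d' (c i)) := by
        simp only [s, map_sub, map_add, map_mul, hu, hv, hw, hx, hy]
        rfl
      have h7 (i j) : (s i j • (⟨b i, hbA i⟩ * ⟨b j, hbA j⟩ : A)).1 g =
          (d' (c i * c' j) - (c i 1 * d' (c' j) + c' j 1 * d' (c i))) * (b i g * b j g) := by
        rw [← h6, ← Algebra.smul_def]
        rfl
      simp only [AddSubmonoidClass.coe_finsetSum, Finset.sum_apply, h7, Finset.sum_mul_sum]
      rw [Finset.sum_comm (f := fun j i => b j g * c' j 1 * _), ← Finset.sum_add_distrib,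
        ← Finset.sum_sub_distrib]
      refine Finset.sum_congr rfl fun i _ => ?_
      rw [← Finset.sum_add_distrib, ← Finset.sum_sub_distrib]
      refine Finset.sum_congr rfl fun j _ => ?_
      ring
    rw [h1]
    refine sum_mem fun i _ => sum_mem fun j _ => ?_
    rw [Algebra.smul_def]
    exact Ideal.mul_mem_right _ _ (Ideal.mem_map_of_mem _ (hs i j))
  · obtain ⟨v', hv', hd⟩ := hd' f
    have h1 : (D f).1 1 = d' f := by
      change d' (fun h => f.1 (1 * h)) = _
      simp
    rw [← hd, hinj (hv.trans (h1.trans hv'.symm))]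

/-- The augmentation ideal `I` of an order of rank `p` is generated modulo `I²` by one element. If
`I / I²` is not zero, take `x ∈ I` on which some tangent vector modulo the maximal ideal takes the
value `1`. By `coeff_mem_of_sum_mem`, the powers `1, x, …, xᵖ⁻¹` are linearly independent modulo the
maximal ideal, so that they form a basis of the order. -/
lemma exists_generator [Finite Γ] {p : ℕ} (hA : IsHopfOrder A) (hp : p.Prime)
    (hpV : (p : V) ∈ IsLocalRing.maximalIdeal V) (hcard : Nat.card Γ = p) :
    ∃ x ∈ augSubmodule A,
      augSubmodule A ≤ Submodule.span V {x} ⊔ augSubmodule A * augSubmodule A := by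
  have hinj := IsFractionRing.injective V L
  let 𝔪 := IsLocalRing.maximalIdeal V
  let U := orderOmega A ⧸ (𝔪 • ⊤ : Submodule V (orderOmega A))
  -- if there is no tangent vector, then `I = I²` by Nakayama's lemma
  rcases subsingleton_or_nontrivial U with hU | hU
  · refine ⟨0, zero_mem _, ?_⟩
    have h1 : Module.Finite V (augSubmodule A) := Module.Finite.iff_fg.2 hA.augSubmodule_fg
    have h2 : (⊤ : Submodule V (orderOmega A)) = ⊥ := by
      refine Submodule.eq_bot_of_le_smul_of_le_jacobson_bot 𝔪 _ Module.Finite.fg_top ?_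
        (IsLocalRing.maximalIdeal_le_jacobson _)
      exact (Submodule.Quotient.subsingleton_iff.1 hU).ge
    intro f hf
    refine Submodule.mem_sup_right ?_
    have h3 : (Submodule.Quotient.mk ⟨f, hf⟩ : orderOmega A) ∈ (⊥ : Submodule V (orderOmega A)) :=
      h2 ▸ Submodule.mem_top
    have h4 : (Submodule.Quotient.mk ⟨f, hf⟩ : orderOmega A) = 0 := h3
    have h5 := (Submodule.Quotient.mk_eq_zero (x := (⟨f, hf⟩ : augSubmodule A)) _).1 h4
    exact h5
  let := Ideal.Quotient.field 𝔪
  -- otherwise a tangent vector `δ` extends to an invariant derivation `D` modulo `𝔪`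
  obtain ⟨u, hu⟩ := exists_ne (0 : U)
  obtain ⟨φ, hφ⟩ := Module.Projective.exists_dual_eq_one (V ⧸ 𝔪) hu
  obtain ⟨u, rfl⟩ := Submodule.Quotient.mk_surjective _ u
  obtain ⟨x, rfl⟩ := Submodule.Quotient.mk_surjective _ u
  let δ : augSubmodule A →ₗ[V] V ⧸ 𝔪 :=
    φ.restrictScalars V ∘ₗ Submodule.mkQ _ ∘ₗ Submodule.mkQ _
  have hδx : δ x = 1 := hφ
  have hδ0 (f : augSubmodule A) (hf : f.1 ∈ augSubmodule A * augSubmodule A) : δ f = 0 := by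
    have h1 : (Submodule.Quotient.mk f : orderOmega A) = 0 := (Submodule.Quotient.mk_eq_zero _).2 hf
    change φ (Submodule.Quotient.mk (Submodule.Quotient.mk f : orderOmega A)) = 0
    rw [h1, Submodule.Quotient.mk_zero, map_zero]
  obtain ⟨e, he⟩ := hA.exists_counit
  let P : A →ₗ[V] augSubmodule A :=
    { toFun := fun f => ⟨f.1 - algebraMap V (Γ → L) (e f),
        A.sub_mem f.2 (A.algebraMap_mem _), by simp [LinearMap.mem_ker, he]⟩
      map_add' := fun f g => Subtype.ext (by
        simp only [map_add, Subalgebra.coe_add, Submodule.coe_add]; ring)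
      map_smul' := fun v f => Subtype.ext (by
        simp [Algebra.smul_def, mul_sub]) }
  have hP (f : A) : (P f).1 = f.1 - algebraMap V (Γ → L) (e f) := rfl
  obtain ⟨D, hD, hDe⟩ := hA.exists_derivation (δ ∘ₗ P) fun f g a b ha hb => by
    have ha : a = e f := hinj (ha.trans (he f).symm)
    have hb : b = e g := hinj (hb.trans (he g).symm)
    subst ha hb
    have h1 : P (f * g) = ⟨(P f).1 * (P g).1, augSubmodule_mul_le A
        (Submodule.mul_mem_mul (P f).2 (P g).2)⟩ + (e f • P g + e g • P f) := by
      apply Subtype.ext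
      simp only [Submodule.coe_add, Submodule.coe_smul, hP, Algebra.smul_def, map_mul,
        Subalgebra.coe_mul]
      ring
    rw [LinearMap.comp_apply, h1, map_add, hδ0 _ (Submodule.mul_mem_mul (P f).2 (P g).2), zero_add,
      map_add, map_smul, map_smul]
    rfl
  let N : Ideal A := 𝔪.map (algebraMap V A)
  let I : Ideal A := RingHom.ker e
  have hNe : I ⊔ N ≤ 𝔪.comap e := by
    refine sup_le (fun f hf => ?_) (Ideal.map_le_iff_le_comap.2 fun v hv => ?_)
    · rw [Ideal.mem_comap, show e f = 0 from hf]
      exact zero_mem _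
    · simpa using hv
  have h1 : (1 : A) ∉ I ⊔ N := fun h => by
    have := hNe h
    rw [Ideal.mem_comap, map_one] at this
    exact (Ideal.ne_top_iff_one _).1 (IsLocalRing.maximalIdeal.isMaximal V).ne_top this
  have hN : ∀ f ∈ N, D f ∈ N := fun f hf => by
    have h2 : f ∈ (𝔪 • ⊤ : Submodule V A) := by
      rw [Ideal.smul_top_eq_map]
      exact hf
    refine Submodule.smul_induction_on h2 (fun v hv f _ => ?_) fun f g hf hg => ?_
    · rw [map_smul, Algebra.smul_def]
      exact Ideal.mul_mem_right _ _ (Ideal.mem_map_of_mem _ hv)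
    · rw [map_add]
      exact add_mem hf hg
  let X : A := ⟨x.1, x.2.1⟩
  have hX1 : X.1 1 = 0 := x.2.2
  have heX : e X = 0 := hinj (by rw [he, map_zero, hX1])
  have hDX : D X - 1 ∈ I ⊔ N := by
    have h2 : Ideal.Quotient.mk (IsLocalRing.maximalIdeal V) (e (D X)) = 1 := by
      rw [hDe X _ (he _), LinearMap.comp_apply]
      have : P X = x := Subtype.ext (by rw [hP, heX, map_zero, sub_zero])
      rw [this, hδx]
    have h3 : e (D X) - 1 ∈ 𝔪 := by
      rw [← Ideal.Quotient.eq_zero_iff_mem, map_sub, h2, map_one, sub_self]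
    have h4 : D X - 1 = (D X - algebraMap V A (e (D X))) + algebraMap V A (e (D X) - 1) := by
      rw [map_sub, map_one]
      ring
    rw [h4]
    refine add_mem (Ideal.mem_sup_left ?_) (Ideal.mem_sup_right (Ideal.mem_map_of_mem _ h3))
    rw [RingHom.mem_ker, map_sub, AlgHom.commutes, Algebra.algebraMap_self_apply, sub_self]
  have hunit (k : ℕ) (hk : 1 ≤ k) (hkp : k < p) : IsUnit (k : V) := by
    by_contra h
    have h2 : IsCoprime (k : ℤ) p :=
      Nat.isCoprime_iff_coprime.2 ((Nat.coprime_of_lt_prime (by omega) hkp hp).symm)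
    obtain ⟨a, b, hab⟩ := h2
    have h3 : (a : V) * k + b * p = 1 := by exact_mod_cast congrArg (Int.cast : ℤ → V) hab
    refine (Ideal.ne_top_iff_one _).1 (IsLocalRing.maximalIdeal.isMaximal V).ne_top ?_
    rw [← h3]
    exact add_mem (Ideal.mul_mem_left _ _ h) (Ideal.mul_mem_left _ _ hpV)
  have hpow (m) (hm : m < p) : X ^ m ∉ I ^ (m + 1) ⊔ N := by
    refine pow_notMem_of_derivation (D := D.toAddMonoidHom) hN hD h1 heX hDX m fun k hk hkm => ?_
    simpa using (hunit k hk (by omega)).map (algebraMap V A)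
  have hcoeff := coeff_mem_of_sum_mem (V := V) heX hpow fun v hv => Ideal.mem_map_of_mem _ hv
  obtain ⟨n, b, hb⟩ := hA.exists_basis
  have hn : n = p := by
    have := Fintype.ofFinite Γ
    have h2 := Module.finrank_eq_card_basis b
    rw [Module.finrank_fintype_fun_eq_card, Fintype.card_fin, ← Nat.card_eq_fintype_card,
      hcard] at h2
    exact h2.symm
  subst hn
  have hbA (i) : b i ∈ A := basis_mem_of_forall_mem_iff (M := Subalgebra.toSubmodule A) b hb i
  choose G hG using fun (j i : Fin n) => (hb _).1 (X ^ (j : ℕ)).2 i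
  simp only [Algebra.linearMap_apply] at hG
  have hG' (j : Fin n) : (X ^ (j : ℕ) : A) = ∑ i, G j i • (⟨b i, hbA i⟩ : A) := by
    apply Subtype.ext
    refine (b.sum_repr _).symm.trans ?_
    rw [AddSubmonoidClass.coe_finsetSum]
    refine Finset.sum_congr rfl fun i _ => ?_
    rw [← hG, algebraMap_smul]
    rfl
  have hsum (w : Fin n → V) : ∑ j, w j • X ^ (j : ℕ) =
      ∑ i, (Matrix.vecMul w (Matrix.of G)) i • (⟨b i, hbA i⟩ : A) := by
    simp only [hG', Finset.smul_sum, Matrix.vecMul, dotProduct, Finset.sum_smul, Matrix.of_apply,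
      mul_smul]
    exact Finset.sum_comm
  -- `G` is the matrix of the powers of `X` in a basis of the order
  have hdet : IsUnit (Matrix.of G).det := by
    by_contra hdet
    have h2 : ((Matrix.of G).map (IsLocalRing.residue V)).det = 0 := by
      rw [← RingHom.mapMatrix_apply, ← RingHom.map_det, IsLocalRing.residue_eq_zero_iff]
      exact hdet
    obtain ⟨w, hw0, hw⟩ := Matrix.exists_vecMul_eq_zero_iff.2 h2
    choose w' hw' using fun i => IsLocalRing.residue_surjective (w i)
    apply hw0
    ext j
    rw [← hw', Pi.zero_apply, IsLocalRing.residue_eq_zero_iff]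
    refine hcoeff w' ?_ j
    rw [hsum]
    refine sum_mem fun i _ => ?_
    rw [Algebra.smul_def]
    refine Ideal.mul_mem_right _ _ (Ideal.mem_map_of_mem _ ?_)
    rw [← IsLocalRing.residue_eq_zero_iff]
    have := congrFun hw i
    simpa [Matrix.vecMul, dotProduct, hw'] using this
  refine ⟨x, x.2, fun f hf => ?_⟩
  choose c hc using (hb _).1 hf.1
  simp only [Algebra.linearMap_apply] at hc
  let w := Matrix.vecMul c (Matrix.of G)⁻¹
  have hw : Matrix.vecMul w (Matrix.of G) = c := by
    rw [Matrix.vecMul_vecMul, Matrix.nonsing_inv_mul _ hdet, Matrix.vecMul_one]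
  have hf1 : f = ∑ j, w j • x.1 ^ (j : ℕ) := by
    have h2 := congrArg Subtype.val (hsum w)
    rw [hw, AddSubmonoidClass.coe_finsetSum, AddSubmonoidClass.coe_finsetSum] at h2
    refine ((b.sum_repr f).symm.trans ?_).trans h2.symm
    refine Finset.sum_congr rfl fun i _ => ?_
    rw [← hc, algebraMap_smul]
    rfl
  have hx1 : x.1 1 = 0 := x.2.2
  have hxpow (k : ℕ) : x.1 ^ (k + 1) ∈ augSubmodule A := by
    refine ⟨A.pow_mem x.2.1 _, ?_⟩
    simp [LinearMap.mem_ker, hx1]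
  rw [hf1]
  refine sum_mem fun j _ => ?_
  rcases hj : j.1 with - | - | k
  · have h2 : f 1 = 0 := hf.2
    have h3 : w j = 0 := by
      apply hinj
      rw [map_zero, ← h2, hf1, Finset.sum_apply, Finset.sum_eq_single j]
      · simp [hj, Algebra.smul_def]
      · intro k _ hk
        have : k.1 ≠ 0 := fun h => hk (Fin.ext (h.trans hj.symm))
        simp [hx1, this]
      · simp
    rw [h3, zero_smul]
    exact zero_mem _
  · rw [zero_add, pow_one]
    exact Submodule.mem_sup_left (Submodule.smul_mem _ _ (Submodule.mem_span_singleton_self _))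
  · rw [pow_succ]
    exact Submodule.mem_sup_right (Submodule.smul_mem _ _
      (Submodule.mul_mem_mul (hxpow k) x.2))

omit [IsDomain V] [ValuationRing V] [IsFractionRing V L] in
/-- If `r δ₁ ∈ A`, then `r` annihilates `I / I²`. -/
lemma smul_mem_of_single_mem [DecidableEq Γ] {r : V} (hr : Pi.single 1 (algebraMap V L r) ∈ A)
    {x : Γ → L} (hx : x ∈ augSubmodule A) : r • x ∈ augSubmodule A * augSubmodule A := by
  have h1 : r • x = - (x * (Pi.single 1 (algebraMap V L r) - algebraMap V (Γ → L) r)) := by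
    ext g
    by_cases hg : g = 1
    · subst hg
      have : x 1 = 0 := hx.2
      simp [this]
    · simp [Pi.single_eq_of_ne hg, Algebra.smul_def, mul_comm]
  rw [h1]
  refine neg_mem (Submodule.mul_mem_mul hx ⟨A.sub_mem hr (A.algebraMap_mem _), ?_⟩)
  simp [LinearMap.mem_ker]

/-- The key estimate for an order of rank `p`: its cotangent space is cyclic, so that the Fitting ideal
is the annihilator. -/
lemma mem_fittingIdeal_of_card_prime [Finite Γ] [DecidableEq Γ] {p : ℕ} (hA : IsHopfOrder A)
    (hp : p.Prime) (hpV : (p : V) ∈ IsLocalRing.maximalIdeal V) (hcard : Nat.card Γ = p) {r : V}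
    (hr : Pi.single 1 (algebraMap V L r) ∈ A) : r ∈ fittingIdeal V (orderOmega A) := by
  obtain ⟨x, hx, hxI⟩ := hA.exists_generator hp hpV hcard
  have h := det_mem_fittingIdeal (fun _ : Fin 1 => (Submodule.Quotient.mk ⟨x, hx⟩ : orderOmega A))
    (Matrix.of fun _ _ => r) ?_ fun _ => ?_
  · simpa using h
  · rw [eq_top_iff]
    rintro y -
    obtain ⟨⟨f, hf⟩, rfl⟩ := Submodule.Quotient.mk_surjective _ y
    obtain ⟨y, hy, z, hz, rfl⟩ := Submodule.mem_sup.1 (hxI hf)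
    obtain ⟨v, rfl⟩ := Submodule.mem_span_singleton.1 hy
    rw [Submodule.mem_span_range_iff_exists_fun]
    refine ⟨fun _ => v, ?_⟩
    rw [Fin.sum_univ_one, ← Submodule.Quotient.mk_smul, Submodule.Quotient.eq]
    change v • x - (v • x + z) ∈ augSubmodule A * augSubmodule A
    rw [sub_add_cancel_left]
    exact neg_mem hz
  · rw [Fin.sum_univ_one, Matrix.of_apply, ← Submodule.Quotient.mk_smul,
      Submodule.Quotient.mk_eq_zero]
    change r • x ∈ augSubmodule A * augSubmodule A
    exact smul_mem_of_single_mem hr hx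

omit [IsDomain V] [ValuationRing V] [IsFractionRing V L] in
lemma mem_fittingIdeal_of_card_one {r : V} (h : Nat.card Γ = 1) :
    r ∈ fittingIdeal V (orderOmega A) := by
  have := (Nat.card_eq_one_iff_unique.1 h).1
  have h0 (f) (hf : f ∈ augSubmodule A) : f = 0 := by
    ext g
    rw [Subsingleton.elim g 1]
    exact hf.2
  have h1 : Subsingleton (augSubmodule A) :=
    ⟨fun a b => Subtype.ext ((h0 _ a.2).trans (h0 _ b.2).symm)⟩
  have h2 := det_mem_fittingIdeal (R := V) (fun i : Fin 0 => (i.elim0 : orderOmega A)) 1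
    (Subsingleton.elim _ _) (fun i => i.elim0)
  rw [Matrix.det_one] at h2
  rw [(Ideal.eq_top_iff_one _).2 h2]
  trivial

/-- The key estimate: `r δ₁ ∈ A` implies that `r` lies in the Fitting ideal of `I / I²`. The proof
is by induction on the order of `Γ`, through a subgroup of order `p`. -/
lemma mem_fittingIdeal {p : ℕ} (hp : p.Prime) (hpV : (p : V) ∈ IsLocalRing.maximalIdeal V) (n : ℕ) :
    ∀ {Γ : Type} [Group Γ] [DecidableEq Γ] (_ : Nat.card Γ = p ^ n) {A : Subalgebra V (Γ → L)}
    (_ : IsHopfOrder A) {r : V} (_ : Pi.single 1 (algebraMap V L r) ∈ A),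
    r ∈ fittingIdeal V (orderOmega A) := by
  classical
  induction n with
  | zero =>
    intro Γ _ _ h A hA r hr
    exact mem_fittingIdeal_of_card_one h
  | succ n ih =>
    intro Γ _ _ h A hA r hr
    have := Fact.mk hp
    have hfin : Finite Γ := Nat.finite_of_card_ne_zero (by rw [h]; exact (pow_pos hp.pos _).ne')
    have hG : IsPGroup p Γ := IsPGroup.of_card h
    have hnt : Nontrivial Γ := hG.nontrivial_iff_card.2 ⟨n + 1, n.succ_pos, h⟩
    have hZ : Nontrivial (Subgroup.center Γ) := hG.center_nontrivial
    obtain ⟨k, hk, hkZ⟩ := (hG.to_subgroup (Subgroup.center Γ)).nontrivial_iff_card.1 hZ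
    obtain ⟨z, hz⟩ := exists_prime_orderOf_dvd_card' (G := Subgroup.center Γ) p
      (hkZ ▸ dvd_pow_self p hk.ne')
    let N := Subgroup.zpowers z.1
    have hN : N.Normal := ⟨fun n hn g => by
      have h1 := Subgroup.mem_center_iff.1 (Subgroup.zpowers_le.2 z.2 hn) g
      rwa [h1, mul_inv_cancel_right]⟩
    have hNcard : Nat.card N = p := by
      rw [Nat.card_zpowers, ← hz, Subgroup.orderOf_coe]
    have hQcard : Nat.card (Γ ⧸ N) = p ^ n := by
      have := N.card_eq_card_quotient_mul_card_subgroup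
      rw [h, hNcard, pow_succ] at this
      exact (Nat.eq_of_mul_eq_mul_right hp.pos this).symm
    have hi : Function.Injective N.subtype := N.subtype_injective
    have hq : Function.Surjective (QuotientGroup.mk' N) := QuotientGroup.mk'_surjective N
    have hiq (g) : QuotientGroup.mk' N g = 1 ↔ ∃ h, N.subtype h = g := by
      simp
    obtain ⟨r₁, r₃, rfl, h1, h3⟩ := hA.exists_mul_of_single_mem hi hq hiq hr
    refine hA.fittingIdeal_mul_le hi hq hiq (Ideal.mul_mem_mul ?_ ?_)
    · exact (hA.restrict hi).mem_fittingIdeal_of_card_prime hp hpV hNcard h1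
    · exact ih hQcard (hA.quotient hq) h3

end IsHopfOrder

end CyclicOrder

/-! ### Invariant derivations in characteristic zero -/

section InvariantDerivations

open TensorProduct Coalgebra

variable {R B : Type} [CommRing R] [CommRing B]

section Bialgebra

variable [Bialgebra R B]

/-- The operator `b ↦ ∑ d(b₂) b₁` on a bialgebra attached to a linear form `d`. -/
def convolutionOperator (d : B →ₗ[R] R) : B →ₗ[R] B :=
  (TensorProduct.rid R B).toLinearMap ∘ₗ d.lTensor B ∘ₗ comul

lemma counit_convolutionOperator (d : B →ₗ[R] R) (b : B) :
    counit (R := R) (convolutionOperator d b) = d b := by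
  have h1 : (counit (R := R) (A := B)) ∘ₗ (TensorProduct.rid R B).toLinearMap ∘ₗ d.lTensor B =
      d ∘ₗ (TensorProduct.lid R B).toLinearMap ∘ₗ (counit (R := R) (A := B)).rTensor B := by
    ext x y
    simp [mul_comm]
  have h2 := LinearMap.congr_fun h1 (comul b)
  simpa [convolutionOperator] using h2

lemma convolutionOperator_mul (d : B →ₗ[R] R)
    (hd : ∀ a b, d (a * b) = counit (R := R) a * d b + counit (R := R) b * d a) (a b : B) :
    convolutionOperator d (a * b) =
      a * convolutionOperator d b + b * convolutionOperator d a := by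
  let T : B ⊗[R] B →ₗ[R] B := (TensorProduct.rid R B).toLinearMap ∘ₗ d.lTensor B
  let E : B ⊗[R] B →ₗ[R] B := (TensorProduct.rid R B).toLinearMap ∘ₗ (counit (R := R)).lTensor B
  have hE (x : B) : E (comul x) = x := by
    simp [E]
  have h (u v : B ⊗[R] B) : T (u * v) = E u * T v + E v * T u := by
    induction u with
    | zero => simp
    | add x y hx hy => simp only [add_mul, map_add, hx, hy, mul_add]; ring
    | tmul x y =>
      induction v with
      | zero => simp
      | add x y hx hy => simp only [add_mul, map_add, hx, hy, mul_add]; ring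
      | tmul z w =>
        simp only [Algebra.TensorProduct.tmul_mul_tmul, T, E, LinearMap.comp_apply,
          LinearMap.lTensor_tmul, LinearEquiv.coe_coe, TensorProduct.rid_tmul, hd, Algebra.smul_def,
          map_mul, map_add]
        ring
  have h1 := h (comul a) (comul b)
  rw [hE, hE, ← Bialgebra.comul_mul] at h1
  exact h1

end Bialgebra

/-- In characteristic zero, the augmentation ideal of a finite dimensional commutative bialgebra is
idempotent: a tangent vector at the unit element would extend to an invariant derivation, and then
the powers of the augmentation ideal would decrease strictly. -/
lemma ker_counit_le_sq {L : Type} [Field L] [CharZero L] [Bialgebra L B] [FiniteDimensional L B] :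
    RingHom.ker (Bialgebra.counitAlgHom L B) ≤
      RingHom.ker (Bialgebra.counitAlgHom L B) * RingHom.ker (Bialgebra.counitAlgHom L B) := by
  set I := RingHom.ker (Bialgebra.counitAlgHom L B) with hI
  have hI' (x) : x ∈ I ↔ counit (R := L) x = 0 := by rw [hI, RingHom.mem_ker]; rfl
  intro x hx
  by_contra hx2
  obtain ⟨f, hf, hf'⟩ := Submodule.exists_dual_map_eq_bot_of_notMem
    (p := (I * I).restrictScalars L) hx2 inferInstance
  have hfI (y) (hy : y ∈ I * I) : f y = 0 := by
    have : f y ∈ ((I * I).restrictScalars L).map f := ⟨y, hy, rfl⟩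
    rwa [hf', Submodule.mem_bot] at this
  let π : B →ₗ[L] B := LinearMap.id - Algebra.linearMap L B ∘ₗ counit
  have hπ (b) : π b = b - algebraMap L B (counit b) := rfl
  have hπI (b) : π b ∈ I := by rw [hI', hπ]; simp
  let d : B →ₗ[L] L := (f x)⁻¹ • f ∘ₗ π
  have hd (a b) : d (a * b) = counit (R := L) a * d b + counit (R := L) b * d a := by
    have h1 : π (a * b) = π a * π b + (counit (R := L) a • π b + counit (R := L) b • π a) := by
      simp only [hπ, Bialgebra.counit_mul, map_mul, Algebra.smul_def]
      ring
    simp only [d, LinearMap.smul_apply, LinearMap.comp_apply, h1, map_add, map_smul,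
      hfI _ (Ideal.mul_mem_mul (hπI a) (hπI b)), smul_eq_mul]
    ring
  have hdx : d x = 1 := by
    have : π x = x := by rw [hπ, (hI' x).1 hx]; simp
    simp only [d, LinearMap.smul_apply, LinearMap.comp_apply, this, smul_eq_mul]
    exact inv_mul_cancel₀ hf
  let D := convolutionOperator d
  have hmem (m : ℕ) : x ^ m ∉ I ^ (m + 1) ⊔ ⊥ := by
    refine pow_notMem_of_derivation (D := D.toAddMonoidHom) (N := ⊥) (fun n hn => ?_)
      (fun a b => ?_) ?_ hx ?_ m fun k hk _ => ?_
    · rw [(Submodule.mem_bot B).1 hn, map_zero]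
      exact zero_mem _
    · rw [Submodule.mem_bot, sub_eq_zero]
      exact convolutionOperator_mul d hd a b
    · rw [sup_bot_eq, hI', Bialgebra.counit_one]
      exact one_ne_zero
    · rw [sup_bot_eq, hI', map_sub, Bialgebra.counit_one, sub_eq_zero, ← hdx]
      exact counit_convolutionOperator d x
    · have : IsUnit (k : L) := by
        rw [isUnit_iff_ne_zero, Nat.cast_ne_zero]
        omega
      simpa using this.map (algebraMap L B)
  have : IsArtinianRing B := IsArtinianRing.of_finite L B
  obtain ⟨n, hn⟩ := IsArtinian.monotone_stabilizes (R := B) (M := B)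
    ⟨fun k => OrderDual.toDual (I ^ k), fun a b h => Ideal.pow_le_pow_right h⟩
  refine hmem n ?_
  rw [sup_bot_eq]
  have h1 : I ^ n = I ^ (n + 1) := hn (n + 1) n.le_succ
  rw [← h1]
  exact Ideal.pow_mem_pow hx n

end InvariantDerivations

/-! ### Cartier's theorem for finite Hopf algebras -/

section GeometricPoints

open TensorProduct Coalgebra WithConv

lemma exists_algHom_ker_eq {L B : Type} [Field L] [IsAlgClosed L] [CommRing B] [Algebra L B]
    [FiniteDimensional L B] (m : Ideal B) [hm : m.IsMaximal] :
    ∃ g : B →ₐ[L] L, RingHom.ker g = m := by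
  let := Ideal.Quotient.field m
  have h := IsAlgClosed.algebraMap_bijective_of_isIntegral (k := L) (K := B ⧸ m)
  let e := AlgEquiv.ofBijective (Algebra.ofId L (B ⧸ m)) h
  refine ⟨(e.symm : (B ⧸ m) →ₐ[L] L).comp (Ideal.Quotient.mkₐ L m), ?_⟩
  ext x
  rw [RingHom.mem_ker]
  refine (EmbeddingLike.map_eq_zero_iff (f := e.symm)).trans ?_
  exact Ideal.Quotient.eq_zero_iff_mem

/-- A finite commutative Hopf algebra over an algebraically closed field of characteristic zero is
reduced (Cartier), so that its elements are determined by their values at the points. -/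
lemma eq_zero_of_forall_algHom {L B : Type} [Field L] [IsAlgClosed L] [CharZero L] [CommRing B]
    [HopfAlgebra L B] [FiniteDimensional L B] {b : B} (hb : ∀ g : B →ₐ[L] L, g b = 0) : b = 0 := by
  by_contra hb0
  set I := RingHom.ker (Bialgebra.counitAlgHom L B) with hI
  have hI' (x) : x ∈ I ↔ counit (R := L) x = 0 := by rw [hI, RingHom.mem_ker]; rfl
  have : IsArtinianRing B := IsArtinianRing.of_finite L B
  obtain ⟨s, hs, hsI⟩ := Submodule.exists_sub_one_mem_and_smul_eq_zero_of_fg_of_le_smul I I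
    (IsNoetherian.noetherian I) ker_counit_le_sq
  have hs1 : counit (R := L) s = 1 := by
    rw [hI', map_sub, Bialgebra.counit_one, sub_eq_zero] at hs
    exact hs
  obtain ⟨m, hm, hbm⟩ := Ideal.exists_le_maximal (Module.annihilator B (Ideal.span {b})) (by
    rw [Ne, Ideal.eq_top_iff_one, Module.mem_annihilator]
    intro h
    have := h ⟨b, Ideal.mem_span_singleton_self b⟩
    rw [one_smul] at this
    exact hb0 congr($this.1))
  obtain ⟨g, rfl⟩ := exists_algHom_ker_eq (L := L) m
  -- translation by the point `g` carries the unit element to `g`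
  let G : WithConv (B →ₐ[L] L) := toConv g
  let j : L →ₐ[L] B := Algebra.ofId L B
  let J (u : WithConv (B →ₐ[L] L)) : WithConv (B →ₐ[L] B) := toConv (j.comp u.ofConv)
  have hJ (u v) : J (u * v) = J u * J v := congrArg toConv (AlgHom.comp_convMul_distrib j u v)
  let τ (u : WithConv (B →ₐ[L] L)) : WithConv (B →ₐ[L] B) := toConv (AlgHom.id L B) * J u
  have hτε (u : WithConv (B →ₐ[L] L)) (x : B) : counit (R := L) ((τ u).ofConv x) = u.ofConv x := by
    have h1 : (Bialgebra.counitAlgHom L B).comp (τ u).ofConv = ofConv (1 * u) := by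
      rw [AlgHom.comp_convMul_distrib]
      congr 2
      ext x
      simp [J, j, Algebra.ofId_apply]
    rw [_root_.one_mul] at h1
    exact DFunLike.congr_fun h1 x
  have hττ (u v : WithConv (B →ₐ[L] L)) (x : B) :
      (τ u).ofConv ((τ v).ofConv x) = (τ (u * v)).ofConv x := by
    have h1 : (τ u).ofConv.comp (τ v).ofConv = (τ (u * v)).ofConv := by
      rw [AlgHom.comp_convMul_distrib]
      simp only [τ, hJ]
      rw [← _root_.mul_assoc]
      congr 2
      ext x
      simp [J, j, Algebra.ofId_apply]
    exact DFunLike.congr_fun h1 x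
  have hτ1 (x : B) : (τ 1).ofConv x = x := by
    have h1 : τ 1 = toConv (AlgHom.id L B) := by
      have : J 1 = 1 := by
        apply WithConv.ofConv_injective
        ext x
        simp [J, j, Algebra.ofId_apply]
      simp only [τ, this, _root_.mul_one]
    rw [h1]
    rfl
  have h2 : (τ G⁻¹).ofConv s * b = 0 := by
    have h3 : s * (τ G).ofConv b = 0 := by
      refine hsI _ ?_
      rw [hI', hτε]
      exact hb g
    have h4 := congrArg (τ G⁻¹).ofConv h3
    rwa [map_mul, hττ, inv_mul_cancel, hτ1, map_zero] at h4
  have h5 : g ((τ G⁻¹).ofConv s) = 1 := by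
    have := hτε G ((τ G⁻¹).ofConv s)
    rw [hττ, mul_inv_cancel, hτ1, hs1] at this
    exact this.symm
  have h6 : (τ G⁻¹).ofConv s ∈ RingHom.ker g := by
    refine hbm (Module.mem_annihilator.2 ?_)
    rintro ⟨y, hy⟩
    obtain ⟨z, rfl⟩ := Ideal.mem_span_singleton'.1 hy
    apply Subtype.ext
    change _ * (z * b) = 0
    rw [mul_left_comm, h2, mul_zero]
  rw [RingHom.mem_ker, h5] at h6
  exact one_ne_zero h6

end GeometricPoints

/-! ### The Hopf order of a finite flat group scheme -/

section PointsOfHopfAlgebras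

open TensorProduct Coalgebra WithConv

variable (R V L A : Type) [CommRing R] [Field L] [Algebra R L] [CommRing A] [HopfAlgebra R A]

/-- The group of `L`-valued points of the group scheme `Spec A`. -/
abbrev Points : Type := WithConv (A →ₐ[R] L)

/-- The inverse is composition with the antipode; the product is convolution. -/
instance : Group (Points R L A) where
  inv g := toConv (g.ofConv.comp (HopfAlgebra.antipodeAlgHom R A))
  inv_mul_cancel g := by
    have h := AlgHom.comp_convMul_distrib g.ofConv
      (toConv (HopfAlgebra.antipodeAlgHom R A)) (toConv (AlgHom.id R A))
    rw [AlgHom.antipode_id_cancel] at h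
    refine (congrArg toConv h.symm).trans ?_
    apply WithConv.ofConv_injective
    ext a
    simp

/-- The values of an element of `A` at the `L`-valued points. -/
def evalPoints : A →ₐ[R] (Points R L A → L) := AlgHom.pi fun g => g.ofConv

variable {R L A}

@[simp]
lemma evalPoints_apply (a : A) (g : Points R L A) : evalPoints R L A a g = g.ofConv a := rfl

lemma point_one_apply (a : A) :
    (1 : Points R L A).ofConv a = algebraMap R L (counit (R := R) a) := rfl

lemma evalPoints_mul_of_comul {n : ℕ} {a : A} {b c : Fin n → A}
    (h : comul (R := R) a = ∑ i, b i ⊗ₜ c i) (g g' : Points R L A) :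
    evalPoints R L A a (g * g') = ∑ i, evalPoints R L A (b i) g * evalPoints R L A (c i) g' := by
  have h1 : (g * g').ofConv a = _ := AlgHom.convMul_apply g g' a
  rw [evalPoints_apply, h1, h]
  simp

/-- The generic fibre is constant: a basis of `A` is a basis of the space of functions on the
group of geometric points. -/
lemma exists_basis_points [IsAlgClosed L] [CharZero L] {n : ℕ} (b : Module.Basis (Fin n) R A) :
    Finite (Points R L A) ∧ Nat.card (Points R L A) = n ∧
      ∃ β : Module.Basis (Fin n) L (Points R L A → L), ∀ i, β i = evalPoints R L A (b i) := by
  have : Module.Finite R A := Module.Finite.of_basis b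
  have h1 : LinearIndependent L fun i => evalPoints R L A (b i) := by
    rw [Fintype.linearIndependent_iff]
    intro c hc i
    have h2 : ∑ i, c i • (b.baseChange L) i = 0 := by
      refine eq_zero_of_forall_algHom (L := L) (B := L ⊗[R] A) fun g => ?_
      have h3 := congrFun hc (toConv ((g.restrictScalars R).comp
        (Algebra.TensorProduct.includeRight (R := R) (A := L) (B := A))))
      simpa using h3
    exact Fintype.linearIndependent_iff.1 (b.baseChange L).linearIndependent c h2 i
  have h2 : LinearIndependent L (fun (g : Points R L A) (i : Fin n) => g.ofConv (b i)) := by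
    have h3 := (linearIndependent_monoidHom A L).comp
      (fun g : Points R L A => (g.ofConv : A →* L)) (fun g g' h => by
        apply WithConv.ofConv_injective
        ext a
        exact DFunLike.congr_fun h a)
    rw [linearIndependent_iff'] at h3 ⊢
    intro s c hc
    refine h3 s c ?_
    ext a
    have h4 (i) : ∑ g ∈ s, c g * g.ofConv (b i) = 0 := by simpa using congrFun hc i
    have h5 : ∑ g ∈ s, c g * g.ofConv a = 0 := by
      rw [← b.sum_repr a]
      simp only [map_sum, map_smul, Finset.mul_sum, mul_smul_comm]
      rw [Finset.sum_comm]
      refine Finset.sum_eq_zero fun i _ => ?_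
      rw [← Finset.smul_sum, h4, smul_zero]
    simpa using h5
  have hfin : Finite (Points R L A) := h2.finite
  have := Fintype.ofFinite (Points R L A)
  have h3 : Nat.card (Points R L A) = n := by
    apply le_antisymm
    · have := h2.fintype_card_le_finrank
      rwa [Module.finrank_fin_fun, ← Nat.card_eq_fintype_card] at this
    · have := h1.fintype_card_le_finrank
      rwa [Fintype.card_fin, Module.finrank_fintype_fun_eq_card, ← Nat.card_eq_fintype_card] at this
  have h4 : Fintype.card (Fin n) = Module.finrank L (Points R L A → L) := by
    rw [Fintype.card_fin, Module.finrank_fintype_fun_eq_card, ← Nat.card_eq_fintype_card, h3]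
  refine ⟨hfin, h3, basisOfLinearIndependentOfCardEqFinrank' _ h1 h4, fun i => ?_⟩
  rw [coe_basisOfLinearIndependentOfCardEqFinrank']

variable [CommRing V] [Algebra R V] [Algebra V L] [IsScalarTower R V L]

variable (R L A) in
/-- The order spanned over `V` by the elements of `A`, in the algebra of functions on the group of
geometric points. -/
def pointsOrder : Subalgebra V (Points R L A → L) :=
  (Algebra.TensorProduct.lift (Algebra.ofId V (Points R L A → L)) (evalPoints R L A)
    fun _ _ => .all _ _).range

variable {V}

lemma evalPoints_mem_pointsOrder (a : A) : evalPoints R L A a ∈ pointsOrder R V L A :=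
  ⟨1 ⊗ₜ a, by simp⟩

lemma mem_pointsOrder {n : ℕ} (b : Module.Basis (Fin n) R A) {f : Points R L A → L} :
    f ∈ pointsOrder R V L A ↔ ∃ v : Fin n → V, f = ∑ i, v i • evalPoints R L A (b i) := by
  constructor
  · rintro ⟨z, rfl⟩
    refine ⟨fun i => (b.baseChange V).repr z i, ?_⟩
    conv_lhs => rw [← (b.baseChange V).sum_repr z]
    simp only [map_sum]
    refine Finset.sum_congr rfl fun i _ => ?_
    simp [Algebra.ofId_apply, Algebra.smul_def]
  · rintro ⟨v, rfl⟩
    exact sum_mem fun i _ => (pointsOrder R V L A).smul_mem (evalPoints_mem_pointsOrder _) _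

/-- A finite free Hopf algebra spans a Hopf order over `V`: its base change to `V` embeds in the functions
on the geometric points because the generic fibre is étale. -/
lemma isHopfOrder_pointsOrder [IsAlgClosed L] [CharZero L] [IsDomain V] [IsFractionRing V L]
    {n : ℕ} (b : Module.Basis (Fin n) R A) : IsHopfOrder (pointsOrder R V L A) := by
  obtain ⟨hfin, hcard, β, hβ⟩ := exists_basis_points (L := L) b
  refine ⟨?_, fun f => ?_, fun f hf => ?_, fun f hf => ?_⟩
  · have h : Subalgebra.toSubmodule (pointsOrder R V L A) =
        Submodule.span V (Set.range fun i => evalPoints R L A (b i)) := by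
      ext f
      rw [Subalgebra.mem_toSubmodule, mem_pointsOrder b, Submodule.mem_span_range_iff_exists_fun]
      simp only [eq_comm]
    rw [h]
    exact Submodule.fg_span (Set.finite_range _)
  · obtain ⟨v, hv⟩ := IsLocalization.exist_integer_multiples_of_finite (nonZeroDivisors V)
      (fun i => β.repr f i)
    choose w hw using hv
    refine ⟨v, nonZeroDivisors.coe_ne_zero v, (mem_pointsOrder b).2 ⟨w, ?_⟩⟩
    conv_lhs => rw [← β.sum_repr f]
    rw [Finset.smul_sum]
    refine Finset.sum_congr rfl fun i _ => ?_
    rw [← hβ, ← smul_assoc, ← algebraMap_smul L (w i), hw]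
  · obtain ⟨v, rfl⟩ := (mem_pointsOrder b).1 hf
    have h1 (i) : ∃ c : Fin n → A, comul (R := R) (b i) = ∑ j, b j ⊗ₜ c j := by
      refine ⟨fun j => TensorProduct.equivFinsuppOfBasisLeft b (comul (R := R) (b i)) j, ?_⟩
      have := (TensorProduct.equivFinsuppOfBasisLeft b).symm_apply_apply (comul (R := R) (b i))
      rw [TensorProduct.equivFinsuppOfBasisLeft_symm_apply, Finsupp.sum_fintype _ _ (by simp)] at this
      exact this.symm
    choose c hc using h1
    refine ⟨n, fun j => evalPoints R L A (b j), fun j => ∑ i, v i • evalPoints R L A (c i j),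
      fun j => evalPoints_mem_pointsOrder _, fun j => sum_mem fun i _ =>
        (pointsOrder R V L A).smul_mem (evalPoints_mem_pointsOrder _) _, fun g h => ?_⟩
    simp only [Finset.sum_apply, Pi.smul_apply, evalPoints_mul_of_comul (hc _), Finset.smul_sum,
      Finset.mul_sum, mul_smul_comm]
    exact Finset.sum_comm
  · obtain ⟨v, rfl⟩ := (mem_pointsOrder b).1 hf
    have h1 (a : A) : (fun g => evalPoints R L A a g⁻¹) =
      evalPoints R L A (HopfAlgebra.antipode R a) := rfl
    have h2 : (fun g => (∑ i, v i • evalPoints R L A (b i)) g⁻¹) =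
        ∑ i, v i • evalPoints R L A (HopfAlgebra.antipode R (b i)) := by
      ext g
      simp only [Finset.sum_apply, Pi.smul_apply, ← h1]
    rw [h2]
    exact sum_mem fun i _ => (pointsOrder R V L A).smul_mem (evalPoints_mem_pointsOrder _) _

end PointsOfHopfAlgebras

/-! ### Fitting ideals and annihilators of augmentation ideals -/

section Annihilators

variable {R A : Type} [CommRing R] [CommRing A] [Algebra R A]

/-- An element of the Fitting ideal of the conormal module of a section `ε` lifts to an element
which annihilates the ideal of the section. The determinant of a relation matrix of `I / I²` lifts to
the determinant of a matrix which annihilates generators of `I` near the section. -/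
lemma exists_annihilator_of_mem_fittingIdeal (ε : A →ₐ[R] R) {I : Ideal A}
    (hI : ∀ x, x ∈ I ↔ ε x = 0) (hfg : I.FG) {r : R} (hr : r ∈ fittingIdeal R I.Cotangent) :
    ∃ t : A, (∀ x ∈ I, t * x = 0) ∧ ε t = r := by
  refine Submodule.span_induction ?_ ⟨0, by simp⟩ ?_ ?_ hr
  · rintro _ ⟨n, m, B, hm, hB, rfl⟩
    choose e he using fun j => I.toCotangent_surjective (m j)
    have hval (c : R) (y : I) : ((c • y : I) : A) = algebraMap R A c * y := Algebra.smul_def c (y : A)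
    have hle : I ≤ Ideal.span (Set.range fun j => (e j : A)) ⊔ I • I := by
      intro x hx
      have h1 : I.toCotangent ⟨x, hx⟩ ∈ Submodule.span R (Set.range m) := hm ▸ Submodule.mem_top
      obtain ⟨c, hc⟩ := (Submodule.mem_span_range_iff_exists_fun R).1 h1
      have h2 : I.toCotangent ⟨x, hx⟩ = I.toCotangent (∑ j, c j • e j) := by
        rw [← hc, map_sum]
        refine Finset.sum_congr rfl fun j _ => ?_
        rw [← he]
        exact ((I.toCotangent.restrictScalars R).map_smul (c j) (e j)).symm
      rw [Ideal.toCotangent_eq, pow_two] at h2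
      have h3 : x = ((∑ j, c j • e j : I) : A) + (x - ((∑ j, c j • e j : I) : A)) := by ring
      rw [h3]
      refine add_mem (Ideal.mem_sup_left ?_) (Ideal.mem_sup_right h2)
      rw [AddSubmonoidClass.coe_finsetSum]
      refine sum_mem fun j _ => ?_
      rw [hval]
      exact Ideal.mul_mem_left _ _ (Ideal.subset_span ⟨j, rfl⟩)
    obtain ⟨s, hs, hsI⟩ := Submodule.exists_sub_one_mem_and_smul_le_of_fg_of_le_sup hfg le_rfl hle
    have hs1 : ε s = 1 := by
      rw [hI, map_sub, map_one, sub_eq_zero] at hs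
      exact hs
    have hsI' (x) (hx : x ∈ I) : s * x ∈ Ideal.span (Set.range fun j => (e j : A)) :=
      hsI (Submodule.smul_mem_pointwise_smul x s I hx)
    have h1 (i) : ∃ c : Fin n → A, (∀ j, ε (c j) = 0) ∧
        s * ∑ j, algebraMap R A (B i j) * e j = ∑ j, c j * e j := by
      have h2 : ∑ j, algebraMap R A (B i j) * (e j : A) ∈ I * I := by
        have h3 : I.toCotangent (∑ j, B i j • e j) = 0 := by
          rw [← hB i, map_sum]
          refine Finset.sum_congr rfl fun j _ => ?_
          rw [← he]
          exact (I.toCotangent.restrictScalars R).map_smul (B i j) (e j)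
        rw [Ideal.toCotangent_eq_zero, pow_two, AddSubmonoidClass.coe_finsetSum] at h3
        simpa only [hval] using h3
      have h3 : s * ∑ j, algebraMap R A (B i j) * (e j : A) ∈
          I • Submodule.span A (Set.range fun j => (e j : A)) := by
        refine Submodule.mul_induction_on h2 (fun x hx y hy => ?_) fun x y hx hy => ?_
        · rw [mul_left_comm]
          exact Submodule.smul_mem_smul hx (hsI' y hy)
        · rw [mul_add]
          exact add_mem hx hy
      obtain ⟨c, hc, hc2⟩ := (Submodule.mem_ideal_smul_span_iff_exists_sum _ _ _).1 h3
      refine ⟨c, fun j => (hI _).1 (hc j), ?_⟩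
      rw [← hc2, Finsupp.sum_fintype _ _ (by simp)]
      simp
    choose c hc hc2 using h1
    let N : Matrix (Fin n) (Fin n) A := s • B.map (algebraMap R A) - Matrix.of c
    have hN : N.mulVec (fun j => (e j : A)) = 0 := by
      ext i
      have := hc2 i
      rw [Finset.mul_sum] at this
      simp only [N, Matrix.mulVec, dotProduct, Matrix.sub_apply, Matrix.smul_apply, Matrix.map_apply,
        Matrix.of_apply, sub_mul, Finset.sum_sub_distrib, smul_eq_mul, Pi.zero_apply, ← this,
        _root_.mul_assoc, sub_self]
    have hdet (j) : N.det * e j = 0 := by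
      have h2 : (N.adjugate * N).mulVec (fun j => (e j : A)) = 0 := by
        rw [← Matrix.mulVec_mulVec, hN, Matrix.mulVec_zero]
      rw [Matrix.adjugate_mul, Matrix.smul_mulVec, Matrix.one_mulVec] at h2
      exact congrFun h2 j
    refine ⟨N.det * s, fun x hx => ?_, ?_⟩
    · have h2 : N.det * (s * x) ∈ (⊥ : Ideal A) := by
        have h3 : Ideal.span (Set.range fun j => (e j : A)) ≤
            Submodule.comap (LinearMap.mulLeft A N.det) ⊥ := by
          rw [Ideal.span_le]
          rintro _ ⟨j, rfl⟩
          exact hdet j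
        exact h3 (hsI' x hx)
      rw [_root_.mul_assoc]
      exact h2
    · rw [map_mul, hs1, _root_.mul_one, AlgHom.map_det]
      congr 1
      ext i j
      simp [N, hs1, hc]
  · rintro _ _ _ _ ⟨t, ht, rfl⟩ ⟨u, hu, rfl⟩
    exact ⟨t + u, fun x hx => by rw [add_mul, ht x hx, hu x hx, add_zero], map_add _ _ _⟩
  · rintro c _ _ ⟨t, ht, rfl⟩
    exact ⟨algebraMap R A c * t, fun x hx => by rw [_root_.mul_assoc, ht x hx, mul_zero],
      by simp⟩

end Annihilators

/-! ### The cotangent space of the Hopf order of a group scheme -/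

section PointsOrder

open TensorProduct Coalgebra WithConv

variable {R V L A : Type} [CommRing R] [Field L] [Algebra R L] [CommRing A] [HopfAlgebra R A]
  [CommRing V] [Algebra R V] [Algebra V L] [IsScalarTower R V L] {I : Ideal A}
  (hI : ∀ x, x ∈ I ↔ counit (R := R) x = 0)

include hI

/-- A function which annihilates the augmentation ideal is supported at the unit section. -/
lemma single_mem_pointsOrder [DecidableEq (Points R L A)] {t : A} (ht : ∀ x ∈ I, t * x = 0) :
    Pi.single 1 (algebraMap V L (algebraMap R V (counit (R := R) t))) ∈ pointsOrder R V L A := by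
  convert evalPoints_mem_pointsOrder (V := V) (L := L) t using 1
  ext g
  by_cases hg : g = 1
  · subst hg
    rw [Pi.single_eq_same, evalPoints_apply, point_one_apply, ← IsScalarTower.algebraMap_apply]
  · rw [Pi.single_eq_of_ne hg, evalPoints_apply]
    by_contra h0
    apply hg
    apply WithConv.ofConv_injective
    ext a
    have h1 : a - algebraMap R A (counit a) ∈ I := by
      rw [hI]
      simp
    have h2 := congrArg g.ofConv (ht _ h1)
    rw [map_mul, map_zero] at h2
    have h3 := (mul_eq_zero.1 h2).resolve_left (Ne.symm h0)
    rw [map_sub, sub_eq_zero, AlgHom.commutes] at h3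
    rw [h3, point_one_apply]

/-- The augmentation ideal of the order spanned by `A` is spanned by the augmentation ideal of `A`. -/
lemma augSubmodule_pointsOrder [FaithfulSMul V L] {n : ℕ} (b : Module.Basis (Fin n) R A) :
    augSubmodule (pointsOrder R V L A) = Submodule.span V (evalPoints R L A '' I) := by
  apply le_antisymm
  · rintro f ⟨hf, hf1⟩
    obtain ⟨v, rfl⟩ := (mem_pointsOrder b).1 hf
    have h1 : ∑ i, v i • algebraMap R V (counit (b i)) = 0 := by
      apply FaithfulSMul.algebraMap_injective V L
      have h2 : (∑ i, v i • evalPoints R L A (b i)) 1 = 0 := hf1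
      rw [map_zero, ← h2, Finset.sum_apply, map_sum]
      refine Finset.sum_congr rfl fun i _ => ?_
      rw [smul_eq_mul, map_mul, ← IsScalarTower.algebraMap_apply, Pi.smul_apply, Algebra.smul_def,
        evalPoints_apply, point_one_apply]
    have h2 : ∑ i, v i • evalPoints R L A (b i) =
        ∑ i, v i • evalPoints R L A (b i - algebraMap R A (counit (b i))) := by
      have h3 (i) : evalPoints R L A (algebraMap R A (counit (b i))) =
          algebraMap V (Points R L A → L) (algebraMap R V (counit (b i))) := by
        ext g
        simp [← IsScalarTower.algebraMap_apply]
      simp only [map_sub, smul_sub, Finset.sum_sub_distrib, h3]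
      simp only [Algebra.smul_def, ← map_mul, ← map_sum]
      simp only [smul_eq_mul] at h1
      rw [h1, map_zero, sub_zero]
    rw [h2]
    refine sum_mem fun i _ => Submodule.smul_mem _ _ (Submodule.subset_span ⟨_, ?_, rfl⟩)
    rw [SetLike.mem_coe, hI]
    simp
  · rw [Submodule.span_le]
    rintro _ ⟨x, hx, rfl⟩
    refine ⟨evalPoints_mem_pointsOrder x, ?_⟩
    have : evalPoints R L A x 1 = 0 := by
      rw [evalPoints_apply, point_one_apply, (hI x).1 hx, map_zero]
    exact this

/-- The cotangent space of the order spanned by `A` over `V` is the base change to `V` of the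
cotangent space of `A`: linear maps extend. -/
lemma exists_orderOmega_lift [IsAlgClosed L] [CharZero L] [FaithfulSMul V L] {n : ℕ}
    (b : Module.Basis (Fin n) R A) {M : Type} [AddCommGroup M] [Module R M] [Module V M]
    [IsScalarTower R V M] (φ : I.Cotangent →ₗ[R] M) :
    ∃ ψ : orderOmega (pointsOrder R V L A) →ₗ[V] M, LinearMap.range φ ≤
      (LinearMap.range ψ).restrictScalars R := by
  obtain ⟨_, _, β, hβ⟩ := exists_basis_points (L := L) b
  let π : A →ₗ[R] I := LinearMap.codRestrict (I.restrictScalars R)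
    (LinearMap.id - Algebra.linearMap R A ∘ₗ counit) fun x => (hI _).2 (by simp)
  have hπ (x) : (π x : A) = x - algebraMap R A (counit x) := rfl
  have hπI (x) (hx : x ∈ I) : π x = ⟨x, hx⟩ := Subtype.ext (by rw [hπ, (hI x).1 hx]; simp)
  let φ' : A →ₗ[R] M := φ ∘ₗ I.toCotangent.restrictScalars R ∘ₗ π
  let c := (Algebra.TensorProduct.lift (Algebra.ofId V (Points R L A → L)) (evalPoints R L A)
    fun _ _ => .all _ _).toLinearMap
  have hc (i) : c ((b.baseChange V) i) = β i := by simp [c, hβ]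
  have hcinj : Function.Injective c := by
    rw [← LinearMap.ker_eq_bot]
    refine LinearMap.ker_eq_bot'.2 fun z hz => ?_
    rw [← (b.baseChange V).sum_repr z] at hz ⊢
    simp only [map_sum, map_smul, hc] at hz
    have h1 := Fintype.linearIndependent_iff.1 β.linearIndependent
      (fun i => algebraMap V L ((b.baseChange V).repr z i)) (by simpa using hz)
    refine Finset.sum_eq_zero fun i _ => ?_
    have h2 := h1 i
    rw [← map_zero (algebraMap V L)] at h2
    rw [FaithfulSMul.algebraMap_injective V L h2, zero_smul]
  let e := LinearEquiv.ofInjective c hcinj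
  let θ : (V ⊗[R] A) →ₗ[V] M := TensorProduct.AlgebraTensorModule.lift
    ((LinearMap.ringLmapEquivSelf V V (A →ₗ[R] M)).symm φ')
  have hθ (a : A) : θ (1 ⊗ₜ a) = φ' a := by simp [θ]
  let θ' : LinearMap.range c →ₗ[V] M := θ ∘ₗ e.symm.toLinearMap
  have hev (a : A) : c (1 ⊗ₜ a) = evalPoints R L A a := by simp [c]
  have hθ' (a : A) (ha : evalPoints R L A a ∈ LinearMap.range c) : θ' ⟨_, ha⟩ = φ' a := by
    have : (⟨_, ha⟩ : LinearMap.range c) = e (1 ⊗ₜ a) := Subtype.ext (hev a).symm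
    rw [this, LinearMap.comp_apply, LinearEquiv.coe_coe, e.symm_apply_apply, hθ]
  have hle : augSubmodule (pointsOrder R V L A) * augSubmodule (pointsOrder R V L A) ≤
      (LinearMap.ker θ').map (LinearMap.range c).subtype := by
    rw [augSubmodule_pointsOrder hI b, Submodule.span_mul_span, Submodule.span_le]
    rintro _ ⟨_, ⟨x, hx, rfl⟩, _, ⟨y, hy, rfl⟩, rfl⟩
    refine ⟨⟨evalPoints R L A (x * y), ⟨_, hev _⟩⟩, ?_, map_mul (evalPoints R L A) x y⟩
    have h1 : x * y ∈ I := I.mul_mem_left x hy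
    have h2 : I.toCotangent ⟨x * y, h1⟩ = 0 := by
      rw [Ideal.toCotangent_eq_zero, pow_two]
      exact Ideal.mul_mem_mul hx hy
    refine LinearMap.mem_ker.2 ((hθ' _ _).trans ?_)
    change φ (I.toCotangent (π (x * y))) = 0
    rw [hπI _ h1, h2, map_zero]
  let ψ₀ : augSubmodule (pointsOrder R V L A) →ₗ[V] M :=
    θ' ∘ₗ Submodule.inclusion (show _ ≤ LinearMap.range c from fun f hf => hf.1)
  let ψ : orderOmega (pointsOrder R V L A) →ₗ[V] M := Submodule.liftQ _ ψ₀ fun f hf => by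
    obtain ⟨f', hf', h⟩ := hle hf
    refine LinearMap.mem_ker.2 (Eq.trans ?_ (LinearMap.mem_ker.1 hf'))
    change θ' _ = θ' f'
    congr 1
    exact Subtype.ext h.symm
  refine ⟨ψ, ?_⟩
  rintro _ ⟨w, rfl⟩
  obtain ⟨⟨x, hx⟩, rfl⟩ := I.toCotangent_surjective w
  have h1 : evalPoints R L A x ∈ augSubmodule (pointsOrder R V L A) := by
    rw [augSubmodule_pointsOrder hI b]
    exact Submodule.subset_span ⟨x, hx, rfl⟩
  refine ⟨Submodule.Quotient.mk ⟨_, h1⟩, ?_⟩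
  refine (hθ' x ⟨_, hev x⟩).trans ?_
  change φ (I.toCotangent (π x)) = _
  rw [hπI x hx]

end PointsOrder

/-! ### Torsion and degree of the cotangent space -/

section DegreeOverValuationRing

open TensorProduct Coalgebra WithConv

variable {R V L A : Type} [CommRing R] [Field L] [Algebra R L] [CommRing A] [HopfAlgebra R A]
  [CommRing V] [Algebra R V] [Algebra V L] [IsScalarTower R V L] {I : Ideal A}
  [IsDomain V] [IsFractionRing V L] [IsAlgClosed L] [CharZero L]

lemma isTorsion_of_forall_dual_eq_zero {M : Type} [IsDomain R] [IsPrincipalIdealRing R]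
    [AddCommGroup M] [Module R M] [Module.Finite R M] (h : ∀ f : M →ₗ[R] R, f = 0) :
    Module.IsTorsion R M := by
  have h1 : Module.Free R (M ⧸ Submodule.torsion R M) := inferInstance
  let b := Module.Free.chooseBasis R (M ⧸ Submodule.torsion R M)
  intro x
  have h2 : (Submodule.torsion R M).mkQ x = 0 := by
    refine b.ext_elem fun i => ?_
    rw [map_zero, Finsupp.zero_apply]
    exact LinearMap.congr_fun (h (b.coord i ∘ₗ (Submodule.torsion R M).mkQ)) x
  rw [Submodule.mkQ_apply, Submodule.Quotient.mk_eq_zero] at h2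
  exact h2

variable (V L) in
include V L in
/-- The generic fibre being étale, the cotangent space is torsion. -/
lemma exists_smul_cotangent_eq_zero [IsDomain R] [IsPrincipalIdealRing R] [FaithfulSMul R V]
    (hI : ∀ x, x ∈ I ↔ counit (R := R) x = 0) {n : ℕ} (b : Module.Basis (Fin n) R A)
    [Module.Finite R I.Cotangent] :
    ∃ r : R, r ≠ 0 ∧ ∀ x : I.Cotangent, r • x = 0 := by
  classical
  have hA : IsHopfOrder (pointsOrder R V L A) := isHopfOrder_pointsOrder b
  have : FaithfulSMul V L := (faithfulSMul_iff_algebraMap_injective V L).2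
    (IsFractionRing.injective V L)
  obtain ⟨v, hv0, hv⟩ := hA.full (Pi.single 1 1)
  have hv' : Pi.single 1 (algebraMap V L v) ∈ pointsOrder R V L A := by
    convert hv using 1
    rw [← Pi.single_smul, Algebra.smul_def, _root_.mul_one]
  have ht : Module.IsTorsion R I.Cotangent := isTorsion_of_forall_dual_eq_zero fun f => by
    obtain ⟨ψ, hψ⟩ := exists_orderOmega_lift (V := V) (L := L) hI b (Algebra.linearMap R V ∘ₗ f)
    ext x
    obtain ⟨w, hw⟩ := hψ ⟨x, rfl⟩
    obtain ⟨u, rfl⟩ := Submodule.Quotient.mk_surjective _ w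
    have h1 : v • (Submodule.Quotient.mk u : orderOmega (pointsOrder R V L A)) = 0 := by
      rw [← Submodule.Quotient.mk_smul, Submodule.Quotient.mk_eq_zero]
      exact IsHopfOrder.smul_mem_of_single_mem hv' u.2
    have h2 := congrArg ψ h1
    rw [map_smul, map_zero, smul_eq_mul, hw] at h2
    apply FaithfulSMul.algebraMap_injective R V
    rw [LinearMap.zero_apply, map_zero]
    exact (mul_eq_zero.1 h2).resolve_left hv0
  obtain ⟨r, hr, hr0⟩ := Submodule.annihilator_top_inter_nonZeroDivisors ht
  exact ⟨r, nonZeroDivisors.ne_zero hr0, fun x => Submodule.mem_annihilator.1 hr x trivial⟩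

/-- The estimate `IsHopfOrder.mem_fittingIdeal` for the order spanned by `A`, in terms of the invariant
factors of the cotangent space of `A`. -/
lemma mem_span_prod_of_single_mem [ValuationRing V] [DecidableEq (Points R L A)]
    (hI : ∀ x, x ∈ I ↔ counit (R := R) x = 0) {p k : ℕ} (hp : p.Prime)
    (hpV : (p : V) ∈ IsLocalRing.maximalIdeal V) (b : Module.Basis (Fin (p ^ k)) R A) {m : ℕ}
    {a : Fin m → R} (e : I.Cotangent ≃ₗ[R] ((j : Fin m) → R ⧸ Ideal.span {a j})) {r : V}
    (hr : Pi.single 1 (algebraMap V L r) ∈ pointsOrder R V L A) :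
    r ∈ Ideal.span {∏ j, algebraMap R V (a j)} := by
  have : FaithfulSMul V L := (faithfulSMul_iff_algebraMap_injective V L).2
    (IsFractionRing.injective V L)
  let ρ (j : Fin m) : (R ⧸ Ideal.span {a j}) →ₗ[R] (V ⧸ Ideal.span {algebraMap R V (a j)}) :=
    Submodule.liftQ _ ((Submodule.mkQ _).restrictScalars R ∘ₗ Algebra.linearMap R V) <| by
      rw [Ideal.span, Submodule.span_singleton_le_iff_mem, LinearMap.mem_ker]
      exact (Submodule.Quotient.mk_eq_zero _).2 (Ideal.mem_span_singleton_self _)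
  obtain ⟨ψ, hψ⟩ := exists_orderOmega_lift (V := V) (L := L) hI b
    (LinearMap.pi (fun j => ρ j ∘ₗ LinearMap.proj j) ∘ₗ e.toLinearMap)
  have hsurj : Function.Surjective ψ := by
    rw [← LinearMap.range_eq_top, eq_top_iff]
    rintro y -
    choose z hz using fun j => Submodule.Quotient.mk_surjective _ (y j)
    have hy : y = ∑ j, z j • Pi.single j 1 := by
      rw [← Finset.univ_sum_single y]
      refine Finset.sum_congr rfl fun j _ => ?_
      rw [← Pi.single_smul, ← hz j]
      congr 1
      change Submodule.Quotient.mk (z j) = Submodule.Quotient.mk (z j • 1)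
      rw [smul_eq_mul, _root_.mul_one]
    rw [hy]
    refine sum_mem fun j _ => Submodule.smul_mem _ _ (hψ ⟨e.symm (Pi.single j 1), ?_⟩)
    ext i
    simp only [LinearMap.comp_apply, LinearEquiv.coe_coe, e.apply_symm_apply, LinearMap.pi_apply,
      LinearMap.proj_apply]
    by_cases hij : i = j
    · subst hij
      rw [Pi.single_eq_same, Pi.single_eq_same]
      change Submodule.Quotient.mk (algebraMap R V 1) = Submodule.Quotient.mk 1
      rw [map_one]
    · rw [Pi.single_eq_of_ne hij, Pi.single_eq_of_ne hij, map_zero]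
  have h1 := IsHopfOrder.mem_fittingIdeal hp hpV k (exists_basis_points (L := L) b).2.1
    (isHopfOrder_pointsOrder b) hr
  have h2 := fittingIdeal_le_of_surjective ψ hsurj h1
  rwa [fittingIdeal_pi_quotient] at h2

end DegreeOverValuationRing

/-! ### Finite faithfully flat homomorphisms -/

section FaithfullyFlat

/-- A finite faithfully flat homomorphism of algebras which are flat over a principal ideal domain
has a linear retraction. -/
lemma exists_retraction {R A B : Type} [CommRing R] [IsDomain R] [IsPrincipalIdealRing R]
    [CommRing A] [CommRing B] [Algebra R A] [Algebra R B] [Module.Finite R B]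
    [Module.IsTorsionFree R B] (j : A →ₐ[R] B)
    (hj : j.toRingHom.FaithfullyFlat) : ∃ ρ : B →ₗ[R] A, ∀ a, ρ (j a) = a := by
  let := j.toRingHom.toAlgebra
  have : Module.FaithfullyFlat A B := hj
  have hcomap (I : Ideal A) : (I.map j).comap j = I := Ideal.comap_map_eq_self_of_faithfullyFlat I
  have hinj : Function.Injective j := by
    rw [injective_iff_map_eq_zero]
    intro a ha
    have h1 := hcomap ⊥
    rw [Ideal.map_bot] at h1
    have h2 : a ∈ (⊥ : Ideal B).comap j := ha
    rwa [h1] at h2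
  let W := LinearMap.range j.toLinearMap
  have htf : Module.IsTorsionFree R (B ⧸ W) := by
    rw [Module.isTorsionFree_iff_smul_eq_zero]
    intro r y hry
    obtain ⟨x, rfl⟩ := W.mkQ_surjective y
    rw [or_iff_not_imp_left]
    intro hr
    rw [← map_smul, Submodule.mkQ_apply, Submodule.Quotient.mk_eq_zero] at hry
    obtain ⟨a, ha : j a = r • x⟩ := hry
    have h1 : a ∈ ((Ideal.span {algebraMap R A r}).map j).comap j := by
      rw [Ideal.mem_comap, ha, Algebra.smul_def, ← j.commutes]
      exact Ideal.mul_mem_right _ _ (Ideal.mem_map_of_mem _ (Ideal.mem_span_singleton_self _))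
    rw [hcomap] at h1
    obtain ⟨a', rfl⟩ := Ideal.mem_span_singleton.1 h1
    rw [map_mul, j.commutes, ← Algebra.smul_def] at ha
    have h2 : j a' = x := smul_right_injective B hr ha
    rw [Submodule.mkQ_apply, Submodule.Quotient.mk_eq_zero]
    exact ⟨a', h2⟩
  have hfree : Module.Free R (B ⧸ W) := inferInstance
  obtain ⟨σ, hσ⟩ := Module.projective_lifting_property W.mkQ LinearMap.id W.mkQ_surjective
  have h1 (b) : b - σ (W.mkQ b) ∈ W := by
    rw [← Submodule.Quotient.mk_eq_zero, ← Submodule.mkQ_apply, map_sub, sub_eq_zero]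
    exact (LinearMap.congr_fun hσ (W.mkQ b)).symm
  let P : B →ₗ[R] W := LinearMap.codRestrict W (LinearMap.id - σ ∘ₗ W.mkQ) h1
  refine ⟨(LinearEquiv.ofInjective j.toLinearMap hinj).symm.toLinearMap ∘ₗ P, fun a => ?_⟩
  rw [LinearMap.comp_apply, LinearEquiv.coe_coe, LinearEquiv.symm_apply_eq]
  apply Subtype.ext
  have h2 : W.mkQ (j a) = 0 := (Submodule.Quotient.mk_eq_zero _).2 ⟨a, rfl⟩
  change j a - σ (W.mkQ (j a)) = j a
  rw [h2, map_zero, sub_zero]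

open TensorProduct in
/-- A point with values in an algebraically closed field lifts along a finite faithfully flat
homomorphism. -/
lemma exists_algHom_comp_eq {R A B L : Type} [CommRing R] [CommRing A] [CommRing B] [Algebra R A]
    [Algebra R B] [Module.Finite R B] [Field L] [IsAlgClosed L] [Algebra R L] (j : A →ₐ[R] B)
    (hj : j.toRingHom.FaithfullyFlat) (g : A →ₐ[R] L) : ∃ h : B →ₐ[R] L, h.comp j = g := by
  let := j.toRingHom.toAlgebra
  let := g.toRingHom.toAlgebra
  have h1 : Module.FaithfullyFlat A B := hj
  have : IsScalarTower R A B := .of_algebraMap_eq fun r => (j.commutes r).symm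
  have : IsScalarTower R A L := .of_algebraMap_eq fun r => (g.commutes r).symm
  have h2 : Module.Finite A B := Module.Finite.of_restrictScalars_finite R A B
  have h3 : Nontrivial (L ⊗[A] B) := (TensorProduct.comm A L B).toEquiv.nontrivial
  obtain ⟨m, hm⟩ := Ideal.exists_maximal (L ⊗[A] B)
  obtain ⟨f, -⟩ := exists_algHom_ker_eq (L := L) m
  refine ⟨((f.restrictScalars A).comp
    Algebra.TensorProduct.includeRight).restrictScalars R, ?_⟩
  ext a
  change f (1 ⊗ₜ (algebraMap A B a)) = algebraMap A L a
  rw [Algebra.algebraMap_eq_smul_one, TensorProduct.tmul_smul, TensorProduct.smul_tmul',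
    ← Algebra.algebraMap_eq_smul_one]
  have : (algebraMap A L a) ⊗ₜ[A] (1 : B) = algebraMap L (L ⊗[A] B) (algebraMap A L a) := rfl
  rw [this, f.commutes]
  rfl

end FaithfullyFlat

/-! ### Superadditivity of the degree -/

section ExactSequences

open TensorProduct Coalgebra WithConv

variable {R V L : Type} [CommRing R] [Field L] [Algebra R L] [CommRing V] [Algebra R V]
  [Algebra V L] [IsScalarTower R V L]

variable (L) in
/-- The map on geometric points induced by a homomorphism of Hopf algebras. -/
def pointsMap {A B : Type} [CommRing A] [HopfAlgebra R A] [CommRing B] [HopfAlgebra R B]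
    (φ : A →ₐc[R] B) : Points R L B →* Points R L A :=
  MonoidHom.mk' (fun g => toConv (g.ofConv.comp (φ : A →ₐ[R] B))) fun g h =>
    congrArg toConv (AlgHom.convMul_comp_bialgHom_distrib g h φ)

lemma pointsMap_apply {A B : Type} [CommRing A] [HopfAlgebra R A] [CommRing B] [HopfAlgebra R B]
    (φ : A →ₐc[R] B) (g : Points R L B) (a : A) : (pointsMap L φ g).ofConv a = g.ofConv (φ a) := rfl

variable {A₁ A₂ A₃ : Type} [CommRing A₁] [HopfAlgebra R A₁] [CommRing A₂]
  [HopfAlgebra R A₂] [CommRing A₃] [HopfAlgebra R A₃] {j : A₃ →ₐc[R] A₂} {π : A₂ →ₐc[R] A₁}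

/-- Functions on the middle term of an exact sequence restrict to functions on the kernel. -/
lemma pointsOrder_map_le [IsAlgClosed L] [CharZero L] {n : ℕ} (b : Module.Basis (Fin n) R A₂) :
    (pointsOrder R V L A₂).map (precomp V L (pointsMap L π)) ≤ pointsOrder R V L A₁ := by
  rintro _ ⟨f, hf, rfl⟩
  obtain ⟨v, rfl⟩ := (mem_pointsOrder b).1 hf
  rw [AlgHom.coe_toRingHom, map_sum]
  refine sum_mem fun i _ => ?_
  rw [map_smul]
  exact Subalgebra.smul_mem _ (evalPoints_mem_pointsOrder (π (b i))) _

/-- A function on the geometric points of the quotient whose pull back is defined over `V` is itself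
defined over `V`, by means of a linear retraction of the pull back of functions. -/
lemma pointsOrder_comap_le [IsAlgClosed L] [CharZero L] {n m : ℕ} (b : Module.Basis (Fin n) R A₂)
    (c : Module.Basis (Fin m) R A₃) (h : ∃ ρ : A₂ →ₗ[R] A₃, ∀ a, ρ (j a) = a) :
    (pointsOrder R V L A₂).comap (precomp V L (pointsMap L j)) ≤ pointsOrder R V L A₃ := by
  obtain ⟨ρ, hρ⟩ := h
  obtain ⟨_, _, β, hβ⟩ := exists_basis_points (L := L) b
  obtain ⟨_, _, κ, hκ⟩ := exists_basis_points (L := L) c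
  -- the extension of `ρ` to functions
  let ρ' : (Points R L A₂ → L) →ₗ[L] (Points R L A₃ → L) :=
    β.constr L fun i => evalPoints R L A₃ (ρ (b i))
  have hρ' (a : A₂) : ρ' (evalPoints R L A₂ a) = evalPoints R L A₃ (ρ a) := by
    rw [← b.sum_repr a]
    simp only [map_sum, map_smul]
    refine Finset.sum_congr rfl fun i _ => ?_
    rw [← hβ, ← algebraMap_smul L, map_smul, β.constr_basis, algebraMap_smul]
  intro f hf
  have h1 : ρ' (f ∘ pointsMap L j) = f := by
    have h2 : ρ' ∘ₗ LinearMap.funLeft L L (pointsMap L j) = LinearMap.id := by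
      refine κ.ext fun i => ?_
      rw [hκ]
      exact (hρ' (j (c i))).trans (by rw [hρ]; rfl)
    exact LinearMap.congr_fun h2 f
  obtain ⟨v, hv⟩ := (mem_pointsOrder (V := V) b).1 hf
  have h3 : f ∘ pointsMap L j = ∑ i, v i • evalPoints R L A₂ (b i) := hv
  rw [← h1, h3, map_sum]
  refine sum_mem fun i _ => ?_
  rw [← algebraMap_smul L, map_smul, hρ', algebraMap_smul]
  exact Subalgebra.smul_mem _ (evalPoints_mem_pointsOrder _) _

/-- The superadditivity of the degree: in an exact sequence of finite flat commutative group schemes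
of `p`-power order, the product of the invariant factors of the cotangent spaces of the outer terms
divides the product of the invariant factors of the cotangent space of the middle term. -/
lemma mem_span_mul_of_exact [IsDomain R] [IsPrincipalIdealRing R] [FaithfulSMul R V]
    [IsDomain V] [ValuationRing V] [IsFractionRing V L] [IsAlgClosed L] [CharZero L]
    {I₁ : Ideal A₁} {I₂ : Ideal A₂} {I₃ : Ideal A₃}
    (hI₁ : ∀ x, x ∈ I₁ ↔ counit (R := R) x = 0) (hI₂ : ∀ x, x ∈ I₂ ↔ counit (R := R) x = 0)
    (hI₃ : ∀ x, x ∈ I₃ ↔ counit (R := R) x = 0)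
    (hπ : Function.Surjective π) (hker : RingHom.ker π = I₃.map j)
    (hj : (j : A₃ →ₐ[R] A₂).toRingHom.FaithfullyFlat)
    {p : ℕ} (hp : p.Prime) (hpV : (p : V) ∈ IsLocalRing.maximalIdeal V) {k₁ k₂ k₃ : ℕ}
    (b₁ : Module.Basis (Fin (p ^ k₁)) R A₁) (b₂ : Module.Basis (Fin (p ^ k₂)) R A₂)
    (b₃ : Module.Basis (Fin (p ^ k₃)) R A₃) {m₁ m₂ m₃ : ℕ} {a₁ : Fin m₁ → R} {a₂ : Fin m₂ → R}
    {a₃ : Fin m₃ → R}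
    (e₁ : I₁.Cotangent ≃ₗ[R] ((j : Fin m₁) → R ⧸ Ideal.span {a₁ j}))
    (e₂ : I₂.Cotangent ≃ₗ[R] ((j : Fin m₂) → R ⧸ Ideal.span {a₂ j}))
    (e₃ : I₃.Cotangent ≃ₗ[R] ((j : Fin m₃) → R ⧸ Ideal.span {a₃ j})) :
    algebraMap R V (∏ i, a₂ i) ∈
      Ideal.span {algebraMap R V (∏ i, a₁ i) * algebraMap R V (∏ i, a₃ i)} := by
  classical
  have hfin₂ : Module.Finite R A₂ := Module.Finite.of_basis b₂
  have hfree₂ : Module.Free R A₂ := Module.Free.of_basis b₂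
  have hnoeth : IsNoetherianRing A₂ := IsNoetherianRing.of_finite R A₂
  obtain ⟨t, ht, htr⟩ := exists_annihilator_of_mem_fittingIdeal (Bialgebra.counitAlgHom R A₂)
    (I := I₂) hI₂ (IsNoetherian.noetherian _) (r := ∏ i, a₂ i) (by
      rw [fittingIdeal_congr e₂, fittingIdeal_pi_quotient]
      exact Ideal.mem_span_singleton_self _)
  have hr := single_mem_pointsOrder (V := V) (L := L) hI₂ ht
  have htr : counit (R := R) t = ∏ i, a₂ i := htr
  rw [htr] at hr
  have hA := isHopfOrder_pointsOrder (V := V) (L := L) b₂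
  have := (exists_basis_points (L := L) b₁).1
  have hi : Function.Injective (pointsMap L π) := fun g h hgh => by
    apply WithConv.ofConv_injective
    ext a
    obtain ⟨a, rfl⟩ := hπ a
    have := congrArg (fun u => u.ofConv a) hgh
    exact this
  have hq : Function.Surjective (pointsMap L j) := fun g => by
    obtain ⟨h, hh⟩ := exists_algHom_comp_eq (j : A₃ →ₐ[R] A₂) hj g.ofConv
    exact ⟨toConv h, WithConv.ofConv_injective hh⟩
  have hiq (g : Points R L A₂) : pointsMap L j g = 1 ↔ ∃ h, pointsMap L π h = g := by
    constructor
    · intro hg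
      have h1 : RingHom.ker (π : A₂ →ₐ[R] A₁) ≤ RingHom.ker g.ofConv := by
        change RingHom.ker π ≤ _
        rw [hker, Ideal.map_le_iff_le_comap]
        intro x hx
        rw [Ideal.mem_comap, RingHom.mem_ker]
        have h2 := congrArg (fun u => u.ofConv x) hg
        refine h2.trans ?_
        rw [point_one_apply, (hI₃ x).1 hx, map_zero]
      refine ⟨toConv (AlgHom.liftOfSurjective (π : A₂ →ₐ[R] A₁) hπ g.ofConv h1), ?_⟩
      apply WithConv.ofConv_injective
      exact AlgHom.liftOfSurjective_comp _ _ _ _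
    · rintro ⟨h, rfl⟩
      apply WithConv.ofConv_injective
      ext a
      rw [pointsMap_apply, pointsMap_apply, point_one_apply]
      have h2 : j (a - algebraMap R A₃ (counit a)) ∈ RingHom.ker π := by
        rw [hker]
        refine Ideal.mem_map_of_mem _ ((hI₃ _).2 ?_)
        simp
      rw [RingHom.mem_ker, map_sub, map_sub, sub_eq_zero, AlgHomClass.commutes,
        AlgHomClass.commutes] at h2
      rw [h2, AlgHom.commutes]
  obtain ⟨r₁, r₃, hr13, h1, h3⟩ := hA.exists_mul_of_single_mem hi hq hiq hr
  have h1' := mem_span_prod_of_single_mem hI₁ hp hpV b₁ e₁ (pointsOrder_map_le b₂ h1)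
  have h3' := mem_span_prod_of_single_mem hI₃ hp hpV b₃ e₃
    (pointsOrder_comap_le b₂ b₃ (exists_retraction (j : A₃ →ₐ[R] A₂) hj) h3)
  rw [hr13, map_prod, map_prod, ← Ideal.span_singleton_mul_span_singleton]
  exact Ideal.mul_mem_mul h1' h3'

end ExactSequences

/-! ### Rings of integers in the algebraic closure of the p-adic numbers -/

section Integers

variable {p : ℕ} [Fact p.Prime]

/-- The norm of `ℚ̄_p` is the spectral norm, that is, it is read off from the coefficients of the minimal
polynomial; an element is integral if these coefficients are in `ℤ_p`. -/
lemma isIntegral_iff_norm_le_one (x : PadicAlgCl p) : IsIntegral ℤ_[p] x ↔ ‖x‖ ≤ 1 := by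
  have hx : IsIntegral ℚ_[p] x := Algebra.IsIntegral.isIntegral x
  rw [← PadicAlgCl.spectralNorm_eq, spectralNorm, spectralValue_le_one_iff (minpoly.monic hx)]
  constructor
  · intro h n
    rw [minpoly.isIntegrallyClosed_eq_field_fractions' ℚ_[p] h, Polynomial.coeff_map]
    exact PadicInt.norm_le_one _
  · intro h
    have h1 : minpoly ℚ_[p] x ∈ Polynomial.lifts (algebraMap ℤ_[p] ℚ_[p]) := by
      rw [Polynomial.lifts_iff_coeff_lifts]
      exact fun n => ⟨⟨_, h n⟩, rfl⟩
    obtain ⟨q, hq, -, hqm⟩ := Polynomial.lifts_and_natDegree_eq_and_monic h1 (minpoly.monic hx)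
    refine ⟨q, hqm, ?_⟩
    rw [← Polynomial.aeval_def, ← Polynomial.aeval_map_algebraMap ℚ_[p], hq, minpoly.aeval]

variable (E : IntermediateField ℚ_[p] (PadicAlgCl p))

instance : IsDomain (integers E) := inferInstanceAs (IsDomain (integralClosure ℤ_[p] E))

instance : Algebra (integers E) E := inferInstanceAs (Algebra (integralClosure ℤ_[p] E) E)

instance : IsIntegralClosure (integers E) ℤ_[p] E :=
  inferInstanceAs (IsIntegralClosure (integralClosure ℤ_[p] E) ℤ_[p] E)

instance : IsScalarTower ℤ_[p] (integers E) E :=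
  inferInstanceAs (IsScalarTower ℤ_[p] (integralClosure ℤ_[p] E) E)

/-- The inclusion of the ring of integers of `E` in `ℚ̄_p`, as a ring homomorphism. -/
def inclHom : integers E →+* PadicAlgCl p := (algebraMap E (PadicAlgCl p)).comp (toField E)

lemma inclHom_apply (x : integers E) : inclHom E x = incl E x := rfl

lemma inclHom_injective : Function.Injective (inclHom E) := fun _ _ h =>
  Subtype.ext (Subtype.ext h)

lemma inclHom_ne_zero {x : integers E} : inclHom E x ≠ 0 ↔ x ≠ 0 :=
  map_ne_zero_iff _ (inclHom_injective E)

lemma inclHom_algebraMap (z : ℤ_[p]) :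
    inclHom E (algebraMap ℤ_[p] (integers E) z) = algebraMap ℚ_[p] (PadicAlgCl p) z := rfl

lemma norm_inclHom_le_one (x : integers E) : ‖inclHom E x‖ ≤ 1 := by
  rw [← isIntegral_iff_norm_le_one]
  have h : IsIntegral ℤ_[p] (toField E x) := x.2
  exact h.map (E.val.restrictScalars ℤ_[p])

variable {E}

lemma exists_inclHom_eq {x : PadicAlgCl p} (hx : x ∈ E) (h : ‖x‖ ≤ 1) :
    ∃ y : integers E, inclHom E y = x := by
  rw [← isIntegral_iff_norm_le_one] at h
  have h2 : IsIntegral ℤ_[p] (⟨x, hx⟩ : E) :=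
    (isIntegral_algHom_iff (E.val.restrictScalars ℤ_[p]) Subtype.val_injective).1 h
  exact ⟨⟨⟨x, hx⟩, h2⟩, rfl⟩

lemma inclHom_mem (x : integers E) : inclHom E x ∈ E := (toField E x).2

/-- The ring of integers of `E` is a valuation ring. -/
lemma dvd_iff_norm_le {x y : integers E} : x ∣ y ↔ ‖inclHom E y‖ ≤ ‖inclHom E x‖ := by
  constructor
  · rintro ⟨z, rfl⟩
    rw [map_mul, norm_mul]
    exact mul_le_of_le_one_right (norm_nonneg _) (norm_inclHom_le_one E z)
  · intro h
    by_cases hx : x = 0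
    · subst hx
      rw [map_zero, norm_zero, norm_le_zero_iff] at h
      rw [inclHom_injective E (h.trans (map_zero _).symm)]
    · have hx' : 0 < ‖inclHom E x‖ := norm_pos_iff.2 ((inclHom_ne_zero E).2 hx)
      obtain ⟨z, hz⟩ := exists_inclHom_eq (x := inclHom E y / inclHom E x)
        (E.div_mem (inclHom_mem y) (inclHom_mem x)) (by
          rw [norm_div]; exact div_le_one_of_le₀ h hx'.le)
      refine ⟨z, inclHom_injective E ?_⟩
      rw [map_mul, hz, mul_div_cancel₀ _ ((inclHom_ne_zero E).2 hx)]

lemma isUnit_iff_norm_eq_one {x : integers E} : IsUnit x ↔ ‖inclHom E x‖ = 1 := by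
  rw [isUnit_iff_dvd_one, dvd_iff_norm_le, map_one, norm_one]
  exact ⟨fun h => le_antisymm (norm_inclHom_le_one E x) h, fun h => h.ge⟩

instance : IsLocalRing (integers E) := by
  refine .of_nonunits_add fun x y hx hy => ?_
  have h (z : integers E) : z ∈ _root_.nonunits (integers E) ↔ ‖inclHom E z‖ < 1 := by
    rw [mem_nonunits_iff, isUnit_iff_norm_eq_one]
    exact ⟨fun h => lt_of_le_of_ne (norm_inclHom_le_one E z) h, fun h => h.ne⟩
  rw [h] at hx hy ⊢
  rw [map_add]
  exact (PadicAlgCl.isNonarchimedean p _ _).trans_lt (max_lt hx hy)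

instance [FiniteDimensional ℚ_[p] E] : Module.Finite ℤ_[p] (integers E) :=
  IsIntegralClosure.finite ℤ_[p] ℚ_[p] E (integers E)

instance [FiniteDimensional ℚ_[p] E] : IsPrincipalIdealRing (integers E) := by
  have h : IsDedekindDomain (integers E) :=
    IsIntegralClosure.isDedekindDomain ℤ_[p] ℚ_[p] E (integers E)
  infer_instance

lemma norm_p : ‖(p : PadicAlgCl p)‖ = (p : ℝ)⁻¹ := by
  rw [← PadicAlgCl.valuation_coe, PadicAlgCl.valuation_p]
  simp

lemma norm_p_lt_one : ‖(p : PadicAlgCl p)‖ < 1 := by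
  rw [norm_p]
  exact inv_lt_one_of_one_lt₀ (by exact_mod_cast (Fact.out : p.Prime).one_lt)

lemma val_mul {x y : PadicAlgCl p} (hx : x ≠ 0) (hy : y ≠ 0) : val (x * y) = val x + val y := by
  rw [val, val, val, norm_mul, Real.logb_mul (norm_ne_zero_iff.2 hx) (norm_ne_zero_iff.2 hy)]
  ring

lemma val_prod {κ : Type} (s : Finset κ) (x : κ → PadicAlgCl p) (hx : ∀ i ∈ s, x i ≠ 0) :
    val (∏ i ∈ s, x i) = ∑ i ∈ s, val (x i) := by
  classical
  induction s using Finset.induction_on with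
  | empty => simp [val]
  | insert a s ha ih =>
    rw [Finset.prod_insert ha, Finset.sum_insert ha, val_mul (hx _ (by simp)), ih]
    · exact fun i hi => hx i (by simp [hi])
    · exact Finset.prod_ne_zero_iff.2 fun i hi => hx i (by simp [hi])

lemma val_le_val_iff {x y : PadicAlgCl p} (hx : x ≠ 0) (hy : y ≠ 0) :
    val x ≤ val y ↔ ‖y‖ ≤ ‖x‖ := by
  rw [val, val, neg_le_neg_iff]
  exact Real.logb_le_logb (by exact_mod_cast (Fact.out : p.Prime).one_lt) (norm_pos_iff.2 hy)
    (norm_pos_iff.2 hx)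

/-- The valuation of a principal ideal does not depend on the generator. -/
lemma idealVal_span (x : integers E) :
    idealVal (Ideal.span {x}) = val (inclHom E x) := by
  have h : ∃ y, Ideal.span {x} = Ideal.span {y} := ⟨x, rfl⟩
  rw [idealVal, dif_pos h]
  have h2 := h.choose_spec
  have h3 : ‖inclHom E h.choose‖ = ‖inclHom E x‖ := by
    apply le_antisymm
    · rw [← dvd_iff_norm_le, ← Ideal.span_singleton_le_span_singleton]
      exact h2.ge
    · rw [← dvd_iff_norm_le, ← Ideal.span_singleton_le_span_singleton]
      exact h2.le
  rw [val, val, ← inclHom_apply, h3]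

end Integers

/-! ### Unramified extensions are normal -/

section UnramifiedExtensions

variable {p : ℕ} [Fact p.Prime] {E : IntermediateField ℚ_[p] (PadicAlgCl p)}

/-- The Teichmüller lift of a residue class: the limit of the powers `a ^ (q ^ n)`. -/
lemma exists_pow_eq_self_and_dvd [FiniteDimensional ℚ_[p] E] {q : ℕ} {f : ℕ} (hf : 1 ≤ f)
    (hq : q = p ^ f) (a : integers E) (ha : (p : integers E) ∣ a ^ q - a) :
    ∃ t : integers E, t ^ q = t ∧ (p : integers E) ∣ t - a := by
  have hp1 : (inclHom E) (p : integers E) = p := map_natCast _ _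
  let x (n : ℕ) : PadicAlgCl p := inclHom E (a ^ (q ^ n))
  have hxE (n) : x n ∈ Subalgebra.toSubmodule E.toSubalgebra := inclHom_mem _
  have hx1 (n) : x (n + 1) = x n ^ q := by
    simp only [x, map_pow, pow_succ, pow_mul]
  have hdist (n) : dist (x n) (x (n + 1)) ≤ 1 * ‖(p : PadicAlgCl p)‖ ^ n := by
    have h1 : (p : integers E) ^ (f * n + 1) ∣ (a ^ q) ^ p ^ (f * n) - a ^ p ^ (f * n) :=
      dvd_sub_pow_of_dvd_sub ha _
    rw [pow_mul, ← hq, ← pow_mul, ← pow_succ', dvd_iff_norm_le, map_pow, hp1, norm_pow,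
      map_sub] at h1
    rw [dist_comm, dist_eq_norm, _root_.one_mul]
    refine h1.trans (pow_le_pow_of_le_one (norm_nonneg _) norm_p_lt_one.le ?_)
    nlinarith
  have hcomplete : IsComplete (Subalgebra.toSubmodule E.toSubalgebra : Set (PadicAlgCl p)) := by
    have : FiniteDimensional ℚ_[p] (Subalgebra.toSubmodule E.toSubalgebra) :=
      inferInstanceAs (FiniteDimensional ℚ_[p] E)
    exact Submodule.complete_of_finiteDimensional _
  obtain ⟨y, hyE, hy⟩ := cauchySeq_tendsto_of_isComplete hcomplete hxE
    (cauchySeq_of_le_geometric _ _ norm_p_lt_one hdist)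
  have hy1 : ‖y‖ ≤ 1 := le_of_tendsto' hy.norm fun n => norm_inclHom_le_one E _
  obtain ⟨t, rfl⟩ := exists_inclHom_eq hyE hy1
  refine ⟨t, inclHom_injective E ?_, ?_⟩
  · rw [map_pow]
    refine tendsto_nhds_unique (hy.pow q) ?_
    have h2 := (Filter.tendsto_add_atTop_iff_nat 1).2 hy
    simpa only [hx1] using h2
  · rw [dvd_iff_norm_le, map_sub]
    refine le_of_tendsto' (hy.sub_const _).norm fun n => ?_
    have h3 : (p : integers E) ∣ a ^ (q ^ n) - a := by
      induction n with
      | zero => simp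
      | succ n ih =>
        have h4 := dvd_add (ih.trans (sub_dvd_pow_sub_pow _ _ q)) ha
        rwa [sub_add_sub_cancel, ← pow_mul, ← pow_succ] at h4
    rw [dvd_iff_norm_le, map_sub] at h3
    exact h3

instance isLocalHom_algebraMap : IsLocalHom (algebraMap ℤ_[p] (integers E)) := ⟨fun z hz => by
  rw [isUnit_iff_norm_eq_one, inclHom_algebraMap] at hz
  rw [PadicInt.isUnit_iff, ← hz]
  exact (PadicAlgCl.norm_extends p (z : ℚ_[p])).symm⟩

lemma maximalIdeal_eq_span [FiniteDimensional ℚ_[p] E]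
    (hE : Algebra.Unramified ℤ_[p] (integers E)) :
    IsLocalRing.maximalIdeal (integers E) = Ideal.span {(p : integers E)} := by
  rw [← Algebra.FormallyUnramified.map_maximalIdeal (R := ℤ_[p]),
    PadicInt.maximalIdeal_eq_span_p, Ideal.map_span, Set.image_singleton, map_natCast]

/-- An unramified extension of `ℚ_p` is normal: its integers are spanned over `ℤ_p` by the roots of
`X ^ q - X`, where `q` is the order of the residue field, and it contains `q` such roots. -/
lemma algHom_mem_of_unramified [FiniteDimensional ℚ_[p] E]
    (hE : Algebra.Unramified ℤ_[p] (integers E)) (s : E →ₐ[ℚ_[p]] PadicAlgCl p) (x : E) :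
    s x ∈ E := by
  classical
  have hp : p.Prime := Fact.out
  let k := IsLocalRing.ResidueField (integers E)
  have hmax := maximalIdeal_eq_span hE
  have hfin : Finite (IsLocalRing.ResidueField ℤ_[p]) :=
    Finite.of_equiv _ PadicInt.residueField.symm.toEquiv
  have hk : Finite k := IsLocalRing.ResidueField.finite_of_finite hfin
  have := Fintype.ofFinite k
  have hres (a : integers E) : IsLocalRing.residue _ a = 0 ↔ (p : integers E) ∣ a := by
    rw [IsLocalRing.residue_eq_zero_iff, hmax, Ideal.mem_span_singleton]
  obtain ⟨p', hchar, f, hp', hcard⟩ := FiniteField.card' k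
  have hpp : p' = p := by
    have h0 : (p : k) = 0 := by
      have h1 := (hres (p : integers E)).2 dvd_rfl
      rwa [map_natCast] at h1
    exact (Nat.prime_dvd_prime_iff_eq hp' hp).1 ((CharP.cast_eq_zero_iff k p' p).1 h0)
  subst hpp
  set q := p' ^ (f : ℕ) with hq
  have hq1 : 1 < q := Nat.one_lt_pow f.pos.ne' hp.one_lt
  have hdvd (a : integers E) : (p' : integers E) ∣ a ^ q - a := by
    rw [← hres, map_sub, map_pow, ← hcard, FiniteField.pow_card, sub_self]
  choose! t ht htd using fun a => exists_pow_eq_self_and_dvd f.pos hq a (hdvd a)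
  -- the chosen roots of `X ^ q - X` in `E` have distinct residues, so they are all the roots
  let P : Polynomial (PadicAlgCl p') := Polynomial.X ^ q - Polynomial.X
  have hP : P ≠ 0 := FiniteField.X_pow_card_sub_X_ne_zero _ hq1
  have hroot (z : PadicAlgCl p') : z ∈ P.roots.toFinset ↔ z ^ q = z := by
    rw [Multiset.mem_toFinset, Polynomial.mem_roots hP]
    simp [P, sub_eq_zero]
  let lift (c : k) : integers E := t (Function.surjInv IsLocalRing.residue_surjective c)
  have hlift (c : k) : IsLocalRing.residue _ (lift c) = c := by
    have h1 := (hres _).2 (htd (Function.surjInv IsLocalRing.residue_surjective c))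
    rw [map_sub, sub_eq_zero] at h1
    exact h1.trans (Function.surjInv_eq _ c)
  let S : Finset (PadicAlgCl p') := Finset.univ.image fun c => inclHom E (lift c)
  have hSq : S.card = q := by
    rw [Finset.card_image_of_injective, Finset.card_univ, hcard]
    intro c d hcd
    rw [← hlift c, ← hlift d, inclHom_injective E hcd]
  have hS : S = P.roots.toFinset := by
    refine Finset.eq_of_subset_of_card_le (fun z hz => ?_) ?_
    · obtain ⟨c, -, rfl⟩ := Finset.mem_image.1 hz
      rw [hroot, ← map_pow, ht]
    · rw [hSq]
      refine (Multiset.toFinset_card_le _).trans ((Polynomial.card_roots' P).trans ?_)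
      rw [FiniteField.X_pow_card_sub_X_natDegree_eq _ hq1]
  have hmem (z : PadicAlgCl p') (hz : z ^ q = z) : z ∈ E := by
    rw [← hroot, ← hS] at hz
    obtain ⟨c, -, rfl⟩ := Finset.mem_image.1 hz
    exact inclHom_mem _
  -- by Nakayama's lemma these roots span the integers of `E`
  let W : Submodule ℤ_[p'] (integers E) := Submodule.span ℤ_[p'] (Set.range t)
  have hW : (⊤ : Submodule ℤ_[p'] (integers E)) ≤ W := by
    refine Submodule.le_of_le_smul_of_le_jacobson_bot (I := Ideal.span {(p' : ℤ_[p'])})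
      Module.Finite.fg_top ?_ ?_
    · rw [← PadicInt.maximalIdeal_eq_span_p, IsLocalRing.jacobson_eq_maximalIdeal _ bot_ne_top]
    · intro a _
      obtain ⟨b, hb⟩ := htd a
      have h1 : a = t a + (p' : ℤ_[p']) • (-b) := by
        rw [Algebra.smul_def, map_natCast, mul_neg, ← hb]; ring
      rw [h1]
      exact Submodule.add_mem_sup (Submodule.subset_span ⟨a, rfl⟩)
        (Submodule.smul_mem_smul (Ideal.mem_span_singleton_self _) trivial)
  have hint (a : integers E) : s (toField E a) ∈ E := by
    have h1 : a ∈ W := hW trivial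
    induction h1 using Submodule.span_induction with
    | mem a ha =>
      obtain ⟨b, rfl⟩ := ha
      refine hmem _ ?_
      rw [← map_pow, ← map_pow, ht]
    | zero => rw [map_zero, map_zero]; exact E.zero_mem
    | add a b _ _ ha hb => rw [map_add, map_add]; exact E.add_mem ha hb
    | smul z a _ ha =>
      have h2 : toField E (z • a) = (z : ℚ_[p']) • toField E a := rfl
      have h3 : s ((z : ℚ_[p']) • toField E a) = (z : ℚ_[p']) • s (toField E a) :=
        s.toLinearMap.map_smul _ _
      rw [h2, h3]
      exact E.smul_mem ha
  obtain ⟨n, hn⟩ : ∃ n : ℕ, ‖((p' : PadicAlgCl p') ^ n * x : PadicAlgCl p')‖ ≤ 1 := by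
    obtain ⟨n, hn⟩ := exists_pow_lt_of_lt_one (y := ‖(p' : PadicAlgCl p')‖)
      (inv_pos.2 (by positivity : 0 < 1 + ‖(x : PadicAlgCl p')‖)) norm_p_lt_one
    refine ⟨n, ?_⟩
    rw [norm_mul, norm_pow]
    calc _ ≤ (1 + ‖(x : PadicAlgCl p')‖)⁻¹ * (1 + ‖(x : PadicAlgCl p')‖) := by gcongr; linarith
      _ = 1 := inv_mul_cancel₀ (by positivity)
  have hp0 : (p' : E) ^ n ≠ 0 := pow_ne_zero _ (Nat.cast_ne_zero.2 hp.ne_zero)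
  obtain ⟨a, ha⟩ := exists_inclHom_eq (E := E) (x := (p' : PadicAlgCl p') ^ n * x)
    (E.mul_mem (pow_mem (natCast_mem E p') n) x.2) hn
  have ha2 : toField E a = (p' : E) ^ n * x := Subtype.ext (ha.trans (by simp))
  have hx : x = ((p' : E) ^ n)⁻¹ * toField E a := by
    rw [ha2, inv_mul_cancel_left₀ hp0]
  rw [hx, map_mul, map_inv₀, map_pow, map_natCast]
  exact E.mul_mem (E.inv_mem (pow_mem (natCast_mem E p') n)) (hint a)

end UnramifiedExtensions

/-! ### Isotypic parts for actions of unramified algebras -/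

section Eigenspaces

open TensorProduct Algebra.FormallyUnramified

variable {Z O R M M' : Type} [CommRing Z] [CommRing O] [CommRing R] [Algebra Z O] [Algebra Z R]
  [AddCommGroup M] [Module R M] [Module Z M] [IsScalarTower Z R M]
  [AddCommGroup M'] [Module R M'] [Module Z M'] [IsScalarTower Z R M']
  (α : O →ₐ[Z] Module.End R M) (α' : O →ₐ[Z] Module.End R M') (σ τ : O →ₐ[Z] R)

/-- The part of `M` on which `O` acts through `σ`. -/
def eigenPart : Submodule R M where
  carrier := {w | ∀ a, α a w = σ a • w}
  add_mem' hx hy a := by rw [map_add, smul_add, hx a, hy a]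
  zero_mem' a := by rw [map_zero, smul_zero]
  smul_mem' c x hx a := by rw [map_smul, hx a, smul_comm]

/-- The action of `O` by scalars through `σ`. -/
def scalarHom : O →ₐ[Z] Module.End R M :=
  ((Algebra.ofId R (Module.End R M)).restrictScalars Z).comp σ

lemma commute_scalarHom (x y : O) : Commute (α x) (scalarHom σ y) :=
  (Algebra.commutes (σ y) (α x)).symm

/-- The homomorphism `x ⊗ y ↦ σ(y) α(x)`. -/
def eigenHom : O ⊗[Z] O →ₐ[Z] Module.End R M :=
  Algebra.TensorProduct.lift α (scalarHom σ) (commute_scalarHom α σ)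

lemma eigenHom_tmul (x y : O) (w : M) : eigenHom α σ (x ⊗ₜ y) w = σ y • α x w := by
  rw [eigenHom, Algebra.TensorProduct.lift_tmul, Module.End.mul_apply]
  exact (α x).map_smul _ _

/-- On the part on which `O` acts through `τ`, the operator of `t ∈ O ⊗ O` is the scalar `(τ ⊗ σ)(t)`. -/
lemma eigenHom_apply_of_mem (t : O ⊗[Z] O) {w : M} (hw : w ∈ eigenPart α τ) :
    eigenHom α σ t w = Algebra.TensorProduct.lift τ σ (fun _ _ => .all _ _) t • w := by
  induction t using TensorProduct.induction_on with
  | zero => simp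
  | tmul x y =>
    rw [eigenHom_tmul, hw x, Algebra.TensorProduct.lift_tmul, smul_smul, mul_comm]
  | add t u ht hu => rw [map_add, map_add, LinearMap.add_apply, ht, hu, add_smul]

lemma map_mem_eigenPart {α : O →ₐ[Z] Module.End R M} {α' : O →ₐ[Z] Module.End R M'}
    {f : M →ₗ[R] M'} (hf : ∀ a w, f (α a w) = α' a (f w)) :
    ∀ w ∈ eigenPart α σ, f w ∈ eigenPart α' σ := by
  intro w hw a
  rw [← hf, hw a, map_smul]

variable [Algebra.FormallyUnramified Z O] [Algebra.EssFiniteType Z O]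

/-- The idempotent of the diagonal is `1` on the diagonal. -/
lemma lift_self_elem : Algebra.TensorProduct.lift σ σ (fun _ _ => .all _ _) (elem Z O) = 1 := by
  have h : Algebra.TensorProduct.lift σ σ (fun _ _ => .all _ _) =
      σ.comp (Algebra.TensorProduct.lmul' Z) := by
    ext <;> simp
  rw [h, AlgHom.comp_apply, lmul_elem, map_one]

/-- The idempotent of the diagonal vanishes at the pairs of distinct points. -/
lemma lift_elem_eq_zero [IsDomain R] (h : σ ≠ τ) :
    Algebra.TensorProduct.lift τ σ (fun _ _ => .all _ _) (elem Z O) = 0 := by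
  obtain ⟨a, ha⟩ := DFunLike.ne_iff.1 h
  have h1 := congrArg (Algebra.TensorProduct.lift τ σ (fun _ _ => .all _ _))
    (one_tmul_mul_elem (R := Z) a)
  rw [map_mul, map_mul, Algebra.TensorProduct.lift_tmul, Algebra.TensorProduct.lift_tmul, map_one,
    map_one, _root_.one_mul, _root_.mul_one] at h1
  have h2 := sub_eq_zero.2 h1
  rw [← sub_mul] at h2
  exact (mul_eq_zero.1 h2).resolve_left (sub_ne_zero.2 ha)

/-- The projection of `M` onto the part on which `O` acts through `σ`. It is given by the element
of `O ⊗ O` which defines the diagonal as an open and closed subscheme. -/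
def eigenProj : Module.End R M := eigenHom α σ (elem Z O)

lemma eigenProj_mem (w : M) : eigenProj α σ w ∈ eigenPart α σ := by
  intro a
  have h1 := congr(eigenHom α σ $(one_tmul_mul_elem (R := Z) a) w)
  rw [map_mul, map_mul, Module.End.mul_apply, Module.End.mul_apply, eigenHom_tmul, eigenHom_tmul,
    map_one, map_one, one_smul] at h1
  exact h1.symm

lemma eigenProj_of_mem {w : M} (hw : w ∈ eigenPart α σ) : eigenProj α σ w = w := by
  rw [eigenProj, eigenHom_apply_of_mem _ _ _ _ hw, lift_self_elem, one_smul]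

lemma eigenProj_of_mem_of_ne [IsDomain R] (h : σ ≠ τ) {w : M} (hw : w ∈ eigenPart α τ) :
    eigenProj α σ w = 0 := by
  rw [eigenProj, eigenHom_apply_of_mem _ _ _ _ hw, lift_elem_eq_zero _ _ h, zero_smul]

/-- The projections add up to the identity, provided that the sum of the conjugates of an element of
`O` is in `Z`. -/
lemma sum_eigenProj [IsDomain R] {S : Type} [Fintype S] [Nonempty S] (ρ : S → O →ₐ[Z] R)
    (hρ : Function.Injective ρ) (hinj : ∀ s, Function.Injective (ρ s)) (tr : O →ₗ[Z] Z)
    (htr : ∀ y, algebraMap Z R (tr y) = ∑ s, ρ s y) (w : M) :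
    ∑ s, eigenProj α (ρ s) w = w := by
  let c : O ⊗[Z] O →ₗ[Z] O := TensorProduct.lift ((LinearMap.lsmul Z O).flip.compl₂ tr)
  have hc (x y : O) : c (x ⊗ₜ y) = tr y • x := rfl
  have h1 (t : O ⊗[Z] O) : ∑ s, eigenHom α (ρ s) t w = α (c t) w := by
    induction t using TensorProduct.induction_on with
    | zero => simp
    | tmul x y =>
      simp only [eigenHom_tmul]
      rw [← Finset.sum_smul, ← htr, hc, map_smul, LinearMap.smul_apply, algebraMap_smul]
    | add t u ht hu =>
      simp only [map_add, LinearMap.add_apply, Finset.sum_add_distrib, ht, hu]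
  have h2 (s₀ : S) (t : O ⊗[Z] O) :
      ∑ s, Algebra.TensorProduct.lift (ρ s₀) (ρ s) (fun _ _ => .all _ _) t = ρ s₀ (c t) := by
    induction t using TensorProduct.induction_on with
    | zero => simp
    | tmul x y =>
      simp only [Algebra.TensorProduct.lift_tmul]
      rw [← Finset.mul_sum, ← htr, hc, map_smul, Algebra.smul_def, mul_comm]
    | add t u ht hu => simp only [map_add, Finset.sum_add_distrib, ht, hu]
  have h3 : c (elem Z O) = 1 := by
    obtain ⟨s₀⟩ := ‹Nonempty S›
    apply hinj s₀
    rw [← h2, map_one, Finset.sum_eq_single s₀ (fun s _ hs => lift_elem_eq_zero _ _ (hρ.ne hs))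
      (by simp), lift_self_elem]
  exact (h1 _).trans (by rw [h3, map_one]; rfl)

/-- The decomposition of `M` into the parts on which `O` acts through the various homomorphisms. -/
def eigenEquiv [IsDomain R] {S : Type} [Fintype S] [Nonempty S] (ρ : S → O →ₐ[Z] R)
    (hρ : Function.Injective ρ) (hinj : ∀ s, Function.Injective (ρ s)) (tr : O →ₗ[Z] Z)
    (htr : ∀ y, algebraMap Z R (tr y) = ∑ s, ρ s y) :
    M ≃ₗ[R] ((s : S) → eigenPart α (ρ s)) :=
  LinearEquiv.ofBijective
    (LinearMap.pi fun s => (eigenProj α (ρ s)).codRestrict _ (eigenProj_mem α (ρ s))) <| by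
  constructor
  · rw [← LinearMap.ker_eq_bot, LinearMap.ker_eq_bot']
    intro w hw
    rw [← sum_eigenProj α ρ hρ hinj tr htr w]
    exact Finset.sum_eq_zero fun s _ => congrArg Subtype.val (congrFun hw s)
  · intro m
    refine ⟨∑ s, (m s : M), funext fun s => Subtype.ext ?_⟩
    change eigenProj α (ρ s) (∑ s, (m s : M)) = m s
    rw [map_sum, Finset.sum_eq_single s
      (fun t _ ht => eigenProj_of_mem_of_ne _ _ _ (hρ.ne ht.symm) (m t).2) (by simp),
      eigenProj_of_mem _ _ (m s).2]

variable {α α'}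

lemma map_eigenProj {f : M →ₗ[R] M'} (hf : ∀ a w, f (α a w) = α' a (f w)) (w : M) :
    f (eigenProj α σ w) = eigenProj α' σ (f w) := by
  rw [eigenProj, eigenProj]
  induction elem Z O using TensorProduct.induction_on with
  | zero => simp
  | tmul x y => rw [eigenHom_tmul, eigenHom_tmul, map_smul, hf]
  | add t u ht hu => rw [map_add, map_add, LinearMap.add_apply, LinearMap.add_apply, map_add, ht, hu]

/-- Passing to the part on which `O` acts through `σ` preserves exact sequences. -/
lemma eigenPart_exact {M'' : Type} [AddCommGroup M''] [Module R M''] [Module Z M'']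
    [IsScalarTower Z R M''] {α'' : O →ₐ[Z] Module.End R M''}
    {f : M →ₗ[R] M'} (hf : ∀ a w, f (α a w) = α' a (f w))
    {g : M' →ₗ[R] M''} (hg : ∀ a w, g (α' a w) = α'' a (g w)) (hsurj : Function.Surjective g)
    (hker : LinearMap.ker g ≤ LinearMap.range f) :
    Function.Surjective (g.restrict (map_mem_eigenPart σ hg)) ∧
      LinearMap.ker (g.restrict (map_mem_eigenPart σ hg)) ≤
        LinearMap.range (f.restrict (map_mem_eigenPart σ hf)) := by
  constructor
  · rintro ⟨w, hw⟩
    obtain ⟨m, rfl⟩ := hsurj w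
    refine ⟨⟨eigenProj α' σ m, eigenProj_mem _ _ _⟩, Subtype.ext ?_⟩
    exact (map_eigenProj σ hg m).trans (eigenProj_of_mem _ _ hw)
  · rintro ⟨m, hm⟩ hgm
    obtain ⟨n, rfl⟩ := hker (congrArg Subtype.val (LinearMap.mem_ker.1 hgm))
    refine ⟨⟨eigenProj α σ n, eigenProj_mem _ _ _⟩, Subtype.ext ?_⟩
    exact (map_eigenProj σ hf n).trans (eigenProj_of_mem _ _ hm)

end Eigenspaces

/-! ### The cotangent sequence -/

section CotangentSequence

open TensorProduct Coalgebra

variable {R A B : Type} [CommRing R] [CommRing A] [CommRing B] [Algebra R B]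

/-- The sum of two homomorphisms of group schemes induces the sum on cotangent spaces. -/
lemma toCotangent_lift_comul [Bialgebra R A] {I : Ideal A} {J : Ideal B}
    (hI : ∀ x, x ∈ I ↔ counit (R := R) x = 0) {f g : A →ₐ[R] B} (hf : I ≤ J.comap f)
    (hg : I ≤ J.comap g) {x : A} (hx : x ∈ I) :
    Algebra.TensorProduct.lift f g (fun _ _ => .all _ _) (comul (R := R) x) - (f x + g x)
      ∈ J ^ 2 := by
  have hsub (a : A) : a - algebraMap R A (counit (R := R) a) ∈ I := by
    rw [hI, map_sub, Bialgebra.counit_algebraMap, sub_self]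
  -- both sides agree modulo `J ^ 2` on the tensor product of the augmentation ideals
  have key (t : A ⊗[R] A) : Algebra.TensorProduct.lift f g (fun _ _ => .all _ _) t -
      f (TensorProduct.rid R A (counit.lTensor A t)) -
      g (TensorProduct.lid R A (counit.rTensor A t)) +
      algebraMap R B (counit (TensorProduct.lid R A (counit.rTensor A t))) ∈ J ^ 2 := by
    induction t using TensorProduct.induction_on with
    | zero => simp
    | tmul a b =>
      have h1 : f (a - _) * g (b - _) ∈ J * J := Ideal.mul_mem_mul (hf (hsub a)) (hg (hsub b))
      rw [← pow_two, map_sub, map_sub, AlgHom.commutes, AlgHom.commutes] at h1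
      convert h1 using 1
      simp only [Algebra.TensorProduct.lift_tmul, LinearMap.lTensor_tmul, LinearMap.rTensor_tmul,
        TensorProduct.rid_tmul, TensorProduct.lid_tmul, map_smul, smul_eq_mul, map_mul]
      rw [Algebra.smul_def, Algebra.smul_def]
      ring
    | add t u ht hu =>
      convert add_mem ht hu using 1
      simp only [map_add]
      ring
  have h2 := key (comul (R := R) x)
  rw [Coalgebra.lTensor_counit_comul, Coalgebra.rTensor_counit_comul, TensorProduct.rid_tmul,
    TensorProduct.lid_tmul, one_smul, (hI x).1 hx, map_zero, add_zero, sub_sub] at h2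
  exact h2

variable {A₁ A₂ A₃ : Type} [CommRing A₁] [Algebra R A₁] [CommRing A₂] [Algebra R A₂] [CommRing A₃]
  [Algebra R A₃] {I₁ : Ideal A₁} {I₂ : Ideal A₂} {I₃ : Ideal A₃} {j : A₃ →ₐ[R] A₂}
  {π : A₂ →ₐ[R] A₁}

/-- The right exactness of the cotangent sequence. -/
lemma mapCotangent_exact (hj : I₃ ≤ I₂.comap j) (hπI : I₂ ≤ I₁.comap π) (hI : I₁.comap π ≤ I₂)
    (hπ : Function.Surjective π) (hker : RingHom.ker π = I₃.map j)
    (hscal : ∀ a : A₂, ∃ r : R, a - algebraMap R A₂ r ∈ I₂) :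
    Function.Surjective (Ideal.mapCotangent I₂ I₁ π hπI) ∧
      LinearMap.ker (Ideal.mapCotangent I₂ I₁ π hπI) ≤
        LinearMap.range (Ideal.mapCotangent I₃ I₂ j hj) := by
  have hmap : I₂.map π = I₁ := by
    refine le_antisymm (Ideal.map_le_iff_le_comap.2 hπI) fun y hy => ?_
    obtain ⟨x, rfl⟩ := hπ y
    exact Ideal.mem_map_of_mem _ (hI hy)
  have hrange (x : A₂) (hx : x ∈ I₃.map j) (hx2 : x ∈ I₂) :
      I₂.toCotangent ⟨x, hx2⟩ ∈ LinearMap.range (Ideal.mapCotangent I₃ I₂ j hj) := by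
    have h : ∃ hx2 : x ∈ I₂,
        I₂.toCotangent ⟨x, hx2⟩ ∈ LinearMap.range (Ideal.mapCotangent I₃ I₂ j hj) := by
      refine Submodule.span_induction (p := fun x _ => ∃ hx2 : x ∈ I₂,
        I₂.toCotangent ⟨x, hx2⟩ ∈ LinearMap.range (Ideal.mapCotangent I₃ I₂ j hj))
        ?_ ?_ ?_ ?_ hx
      · rintro _ ⟨y, hy, rfl⟩
        exact ⟨hj hy, I₃.toCotangent ⟨y, hy⟩, rfl⟩
      · exact ⟨zero_mem _, 0, (map_zero _).trans (map_zero I₂.toCotangent).symm⟩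
      · rintro x y - - ⟨hx, n, hn⟩ ⟨hy, m, hm⟩
        refine ⟨add_mem hx hy, n + m, ?_⟩
        rw [map_add, hn, hm, ← map_add]
        rfl
      · rintro a x - ⟨hx, n, hn⟩
        obtain ⟨r, hr⟩ := hscal a
        refine ⟨I₂.mul_mem_left _ hx, r • n, ?_⟩
        rw [map_smul, hn, ← algebraMap_smul A₂ r, ← map_smul, Ideal.toCotangent_eq, pow_two]
        have h1 := neg_mem (Ideal.mul_mem_mul hr hx)
        rw [← neg_mul, neg_sub, sub_mul] at h1
        exact h1
    exact h.2
  constructor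
  · intro y
    obtain ⟨⟨y, hy⟩, rfl⟩ := I₁.toCotangent_surjective y
    obtain ⟨x, rfl⟩ := hπ y
    exact ⟨I₂.toCotangent ⟨x, hI hy⟩, rfl⟩
  · intro y hy
    obtain ⟨⟨x, hx⟩, rfl⟩ := I₂.toCotangent_surjective y
    rw [LinearMap.mem_ker, Ideal.mapCotangent_toCotangent, Ideal.toCotangent_eq_zero] at hy
    change π x ∈ I₁ ^ 2 at hy
    rw [← hmap, ← Ideal.map_pow, Ideal.mem_map_iff_of_surjective π hπ] at hy
    obtain ⟨z, hz, hzx⟩ := hy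
    have hz2 : z ∈ I₂ := Ideal.pow_le_self two_ne_zero hz
    have hxz : x - z ∈ I₃.map j := by
      rw [← hker, RingHom.mem_ker, map_sub, hzx, sub_self]
    have h1 := hrange (x - z) hxz (sub_mem hx hz2)
    have h2 : I₂.toCotangent ⟨x - z, sub_mem hx hz2⟩ = I₂.toCotangent ⟨x, hx⟩ := by
      rw [Ideal.toCotangent_eq]
      simpa using hz
    rwa [h2] at h1

end CotangentSequence

/-! ### Differentials of group schemes with an action -/

namespace FiniteFlatModuleScheme

variable {R : CommRingCat.{0}} {O : Type} [CommRing O] (H : FiniteFlatModuleScheme R O)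

instance isAffine_left : IsAffine H.X.left := isAffine_of_isAffineHom H.X.hom

instance : Module.Finite R H.functions := finite_functions H.X

instance : Module.Flat R H.functions := flat_functions H.X

lemma mem_augmentationIdeal (x : H.functions) :
    x ∈ H.augmentationIdeal ↔ Coalgebra.counit (R := R) x = 0 := by
  exact Ideal.ext_iff.1 (ker_pullFunctions_one H.X) x

lemma actOmega_toCotangent (a : O) (x : H.augmentationIdeal) :
    H.actOmega a (H.augmentationIdeal.toCotangent x) =
      H.augmentationIdeal.toCotangent ⟨H.actFunctions a x, H.augmentationIdeal_le_comap a x.2⟩ :=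
  rfl

lemma actOmega_one (w : H.omega) : H.actOmega 1 w = w := by
  obtain ⟨x, rfl⟩ := H.augmentationIdeal.toCotangent_surjective w
  rw [actOmega_toCotangent]
  congr 2
  exact congr(pullFunctions $(H.act_one) (x : H.functions)).trans
    congr(($((algΓ R).map_id H.X)).unop.hom (x : H.functions))

lemma actOmega_mul (a b : O) (w : H.omega) :
    H.actOmega (a * b) w = H.actOmega a (H.actOmega b w) := by
  obtain ⟨x, rfl⟩ := H.augmentationIdeal.toCotangent_surjective w
  rw [actOmega_toCotangent, actOmega_toCotangent, actOmega_toCotangent]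
  congr 2
  rw [mul_comm, actFunctions, H.act_mul, Functor.map_comp]
  rfl

lemma actOmega_add (a b : O) (w : H.omega) :
    H.actOmega (a + b) w = H.actOmega a w + H.actOmega b w := by
  obtain ⟨x, rfl⟩ := H.augmentationIdeal.toCotangent_surjective w
  rw [actOmega_toCotangent, actOmega_toCotangent, actOmega_toCotangent, ← map_add,
    Ideal.toCotangent_eq]
  have h : H.actFunctions (a + b) = _ :=
    (congrArg pullFunctions (H.act_add a b)).trans (pullFunctions_mul _ _)
  refine (congrArg (· - _ ∈ _) (DFunLike.congr_fun h _)).mpr ?_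
  exact toCotangent_lift_comul H.mem_augmentationIdeal (H.augmentationIdeal_le_comap a)
    (H.augmentationIdeal_le_comap b) x.2

/-- The action of `O` on the module of differentials. -/
def actRingHom : O →+* Module.End R H.omega where
  toFun := H.actOmega
  map_one' := LinearMap.ext H.actOmega_one
  map_mul' a b := LinearMap.ext (H.actOmega_mul a b)
  map_add' a b := LinearMap.ext (H.actOmega_add a b)
  map_zero' := LinearMap.ext fun w => by
    have h := H.actOmega_add 0 0 w
    rw [add_zero] at h
    exact left_eq_add.1 h

variable {H} {H' : FiniteFlatModuleScheme R O}

lemma augmentationIdeal_le_comap_pullFunctions (f : H.X ⟶ H'.X) [IsMonHom f] :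
    H'.augmentationIdeal ≤ H.augmentationIdeal.comap (pullFunctions f) := by
  intro x hx
  rw [mem_augmentationIdeal] at hx
  rw [Ideal.mem_comap, mem_augmentationIdeal, ← hx]
  exact congr($(BialgHom.counitAlgHom_comp (pullBialgHom f)) x)

/-- Pull back of differentials along a homomorphism of group schemes. -/
def pullOmega (f : H.X ⟶ H'.X) [IsMonHom f] : H'.omega →ₗ[R] H.omega :=
  Ideal.mapCotangent _ _ (pullFunctions f) (augmentationIdeal_le_comap_pullFunctions f)

lemma pullOmega_actOmega (f : H.X ⟶ H'.X) [IsMonHom f] (a : O) (hf : H.act a ≫ f = f ≫ H'.act a)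
    (w : H'.omega) : pullOmega f (H'.actOmega a w) = H.actOmega a (pullOmega f w) := by
  obtain ⟨x, rfl⟩ := H'.augmentationIdeal.toCotangent_surjective w
  refine congrArg H.augmentationIdeal.toCotangent (Subtype.ext ?_)
  have h := congrArg (fun f => pullFunctions f (x : H'.functions)) hf
  simp only [pullFunctions, Functor.map_comp] at h
  exact h.symm

/-- The right exact sequence of differentials `ω₃ → ω₂ → ω₁ → 0` of an exact sequence of group schemes. -/
lemma IsShortExact.pullOmega_exact {H₁ H₂ H₃ : FiniteFlatModuleScheme R O} {i : H₁.X ⟶ H₂.X}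
    {q : H₂.X ⟶ H₃.X} (h : IsShortExact H₁ H₂ H₃ i q) [IsMonHom i] [IsMonHom q] :
    Function.Surjective (pullOmega i) ∧
      LinearMap.ker (pullOmega i) ≤ LinearMap.range (pullOmega q) := by
  obtain ⟨h1, h2⟩ := pullFunctions_kernel i q h.isKernel
  have h3 : H₃.augmentationIdeal =
      RingHom.ker (Bialgebra.counitAlgHom R ((algΓ R).obj H₃.X).unop) := ker_pullFunctions_one H₃.X
  refine mapCotangent_exact _ _ (fun x hx => ?_) h1 (h2.trans (by rw [h3])) fun a => ?_
  · rw [Ideal.mem_comap, mem_augmentationIdeal] at hx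
    rw [mem_augmentationIdeal, ← hx]
    exact congr($(BialgHom.counitAlgHom_comp (pullBialgHom i)) x).symm
  · refine ⟨Coalgebra.counit (R := R) a, ?_⟩
    rw [mem_augmentationIdeal, map_sub, Bialgebra.counit_algebraMap, sub_self]

end FiniteFlatModuleScheme

/-! ### The valuation ring of the algebraic closure of the p-adic numbers -/

section UnitBall

variable (p : ℕ) [Fact p.Prime]

/-- The ring of integers of `ℚ̄_p`. -/
def unitBall : ValuationSubring (PadicAlgCl p) :=
  (Valued.v : Valuation (PadicAlgCl p) NNReal).valuationSubring

lemma p_mem_maximalIdeal_unitBall : (p : unitBall p) ∈ IsLocalRing.maximalIdeal (unitBall p) := by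
  rw [IsLocalRing.mem_maximalIdeal, mem_nonunits_iff]
  intro h
  obtain ⟨y, hy⟩ := h.exists_right_inv
  have h1 : ‖(p : PadicAlgCl p)‖ * ‖(y : PadicAlgCl p)‖ = 1 := by
    rw [← norm_mul, ← norm_one (α := PadicAlgCl p)]
    congr 1
    exact_mod_cast congrArg Subtype.val hy
  have h2 : ‖(y : PadicAlgCl p)‖ ≤ 1 := y.2
  have h3 := mul_le_of_le_one_right (norm_nonneg (p : PadicAlgCl p)) h2
  exact (h1.symm.le.trans h3).not_gt (norm_p_lt_one)

variable {p} (K : IntermediateField ℚ_[p] (PadicAlgCl p))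

instance : Algebra (integers K) (PadicAlgCl p) := (inclHom K).toAlgebra

instance : Algebra (integers K) (unitBall p) :=
  ((inclHom K).codRestrict (unitBall p).toSubring (norm_inclHom_le_one K)).toAlgebra

instance : IsScalarTower (integers K) (unitBall p) (PadicAlgCl p) := .of_algebraMap_eq fun _ => rfl

instance : FaithfulSMul (integers K) (unitBall p) :=
  (faithfulSMul_iff_algebraMap_injective _ _).2 fun _ _ h =>
    inclHom_injective K (congrArg (Subtype.val : unitBall p → PadicAlgCl p) h)

end UnitBall

/-! ### Embeddings and rings of integers -/

section Embeddings

variable {p : ℕ} [Fact p.Prime] {F K : IntermediateField ℚ_[p] (PadicAlgCl p)}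
  (hFK : ∀ (s : F →ₐ[ℚ_[p]] PadicAlgCl p) (x : F), s x ∈ K) (s : F →ₐ[ℚ_[p]] PadicAlgCl p)

include hFK in
lemma exists_inclHom_eq_apply (a : integers F) : ∃ b : integers K, inclHom K b = s (toField F a) := by
  refine exists_inclHom_eq (hFK s _) ?_
  rw [← isIntegral_iff_norm_le_one]
  have h : IsIntegral ℤ_[p] (toField F a) := a.2
  exact h.map (s.restrictScalars ℤ_[p])

/-- The homomorphism between rings of integers induced by an embedding of `F`. -/
def integersHom : integers F →ₐ[ℤ_[p]] integers K where
  toFun a := (exists_inclHom_eq_apply hFK s a).choose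
  map_one' := inclHom_injective K <| (exists_inclHom_eq_apply hFK s 1).choose_spec.trans (by simp)
  map_zero' := inclHom_injective K <| (exists_inclHom_eq_apply hFK s 0).choose_spec.trans (by simp)
  map_mul' a b := inclHom_injective K <| (exists_inclHom_eq_apply hFK s _).choose_spec.trans (by
    rw [map_mul, map_mul, map_mul, (exists_inclHom_eq_apply hFK s a).choose_spec,
      (exists_inclHom_eq_apply hFK s b).choose_spec])
  map_add' a b := inclHom_injective K <| (exists_inclHom_eq_apply hFK s _).choose_spec.trans (by
    rw [map_add, map_add, map_add, (exists_inclHom_eq_apply hFK s a).choose_spec,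
      (exists_inclHom_eq_apply hFK s b).choose_spec])
  commutes' z := inclHom_injective K <| (exists_inclHom_eq_apply hFK s _).choose_spec.trans
    (s.commutes z)

lemma inclHom_integersHom (a : integers F) :
    inclHom K (integersHom hFK s a) = s (toField F a) :=
  (exists_inclHom_eq_apply hFK s a).choose_spec

lemma integersHom_apply_injective : Function.Injective (integersHom hFK s) := by
  intro a b h
  have h1 := congrArg (inclHom K) h
  rw [inclHom_integersHom, inclHom_integersHom] at h1
  exact Subtype.ext (s.injective h1)

instance [FiniteDimensional ℚ_[p] F] : IsFractionRing (integers F) F :=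
  IsIntegralClosure.isFractionRing_of_finite_extension ℤ_[p] ℚ_[p] F (integers F)

lemma integersHom_injective [FiniteDimensional ℚ_[p] F] :
    Function.Injective (integersHom (F := F) hFK) := by
  intro s t h
  have h1 : (s : F →+* PadicAlgCl p) = t := by
    refine IsLocalization.ringHom_ext (nonZeroDivisors (integers F)) (RingHom.ext fun a => ?_)
    have h2 := congrArg (inclHom K) (DFunLike.congr_fun h a)
    rwa [inclHom_integersHom, inclHom_integersHom] at h2
  exact AlgHom.ext fun x => RingHom.congr_fun h1 x

instance : Module.IsTorsionFree ℤ_[p] (integers F) := by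
  have h : FaithfulSMul ℤ_[p] (integers F) :=
    (faithfulSMul_iff_algebraMap_injective _ _).2 fun x y hxy => by
      have h1 := congrArg (inclHom F) hxy
      rw [inclHom_algebraMap, inclHom_algebraMap] at h1
      exact Subtype.ext ((algebraMap ℚ_[p] (PadicAlgCl p)).injective h1)
  exact Module.isTorsionFree_iff_faithfulSMul.2 h

/-- The trace of `F` over `ℚ_p` is the sum over the embeddings. -/
lemma algebraMap_intTrace_eq_sum [FiniteDimensional ℚ_[p] F] (a : integers F) :
    algebraMap ℤ_[p] (integers K) (Algebra.intTrace ℤ_[p] (integers F) a) =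
      ∑ s : F →ₐ[ℚ_[p]] PadicAlgCl p, integersHom hFK s a := by
  apply inclHom_injective K
  rw [inclHom_algebraMap, map_sum]
  have h := Algebra.algebraMap_intTrace (A := ℤ_[p]) (K := ℚ_[p]) (L := F) a
  simp only [inclHom_integersHom]
  have h2 := trace_eq_sum_embeddings (PadicAlgCl p) (K := ℚ_[p]) (x := algebraMap (integers F) F a)
  rw [← h] at h2
  exact h2

end Embeddings

/-! ### Partial degrees -/

section Decomposition

lemma finite_cotangent (R : Type) {A : Type} [CommRing R] [IsNoetherianRing R] [CommRing A]
    [Algebra R A] [Module.Finite R A] (I : Ideal A) : Module.Finite R I.Cotangent := by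
  have h : IsNoetherian R A := isNoetherian_of_isNoetherianRing_of_finite R A
  have h2 : Module.Finite R I := Module.IsNoetherian.finite R (I.restrictScalars R)
  exact Module.Finite.of_surjective (M := I)
    ((I.toCotangent.restrictScalars R : I →ₗ[R] I.Cotangent)) I.toCotangent_surjective

namespace FiniteFlatModuleScheme

/-- Over a local base, the functions on a group scheme of order `pᵏ` form a free module of rank `pᵏ`. -/
lemma exists_basis_functions {R : CommRingCat.{0}} [IsLocalRing R] {O : Type} [CommRing O]
    {H : FiniteFlatModuleScheme R O} {p : ℕ} (h : H.HasPowerOrder p) :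
    ∃ k, Nonempty (Module.Basis (Fin (p ^ k)) R H.functions) := by
  obtain ⟨k, hk⟩ := h
  have hfree : Module.Free R H.functions := Module.free_of_flat_of_isLocalRing
  refine ⟨k, ⟨Module.finBasisOfFinrankEq _ _ ?_⟩⟩
  have h1 := rankAtStalk_functions H.X (IsLocalRing.closedPoint R)
  rw [Module.rankAtStalk_eq_finrank_of_free] at h1
  exact h1.trans (hk _)

variable {R : CommRingCat.{0}} [IsLocalRing R] [IsDomain R] [IsPrincipalIdealRing R] {O : Type}
  [CommRing O] {p : ℕ} (V L : Type) [CommRing V] [IsDomain V] [Field L] [IsAlgClosed L] [CharZero L]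
  [Algebra R V] [Algebra R L] [Algebra V L] [IsScalarTower R V L] [IsFractionRing V L]
  [FaithfulSMul R V]

include V L in
/-- The module of differentials is torsion. The ring `V` only serves to embed the base ring in an
algebraically closed field. -/
lemma exists_smul_omega_eq_zero {H : FiniteFlatModuleScheme R O} (h : H.HasPowerOrder p) :
    ∃ r : R, r ≠ 0 ∧ ∀ w : H.omega, r • w = 0 := by
  obtain ⟨k, ⟨b⟩⟩ := exists_basis_functions h
  have := finite_cotangent (A := H.functions) R H.augmentationIdeal
  exact exists_smul_cotangent_eq_zero V L H.mem_augmentationIdeal b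

variable {V}

include L in
/-- The superadditivity `mem_span_mul_of_exact`, for group schemes. -/
lemma IsShortExact.mem_span_mul [ValuationRing V] {H₁ H₂ H₃ : FiniteFlatModuleScheme R O}
    {i : H₁.X ⟶ H₂.X} {q : H₂.X ⟶ H₃.X} (h₁ : H₁.HasPowerOrder p) (h₂ : H₂.HasPowerOrder p)
    (h₃ : H₃.HasPowerOrder p) (h : IsShortExact H₁ H₂ H₃ i q) (hp : p.Prime)
    (hpV : (p : V) ∈ IsLocalRing.maximalIdeal V) {n₁ n₂ n₃ : ℕ} {a₁ : Fin n₁ → R}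
    {a₂ : Fin n₂ → R} {a₃ : Fin n₃ → R}
    (e₁ : H₁.omega ≃ₗ[R] ((j : Fin n₁) → R ⧸ Ideal.span {a₁ j}))
    (e₂ : H₂.omega ≃ₗ[R] ((j : Fin n₂) → R ⧸ Ideal.span {a₂ j}))
    (e₃ : H₃.omega ≃ₗ[R] ((j : Fin n₃) → R ⧸ Ideal.span {a₃ j})) :
    algebraMap R V (∏ i, a₂ i) ∈
      Ideal.span {algebraMap R V (∏ i, a₁ i) * algebraMap R V (∏ i, a₃ i)} := by
  obtain ⟨k₁, ⟨b₁⟩⟩ := exists_basis_functions h₁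
  obtain ⟨k₂, ⟨b₂⟩⟩ := exists_basis_functions h₂
  obtain ⟨k₃, ⟨b₃⟩⟩ := exists_basis_functions h₃
  have hi := h.isMonHom_left
  have hq := h.isMonHom_right
  have hflat := h.flat
  have hsurj := h.surjective
  obtain ⟨h4, h5⟩ := pullFunctions_kernel i q h.isKernel
  have hcounit : H₃.augmentationIdeal =
      RingHom.ker (Bialgebra.counitAlgHom R ((algΓ R).obj H₃.X).unop) :=
    ker_pullFunctions_one H₃.X
  rw [← hcounit] at h5
  have hff : (pullFunctions q).toRingHom.FaithfullyFlat := by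
    rw [RingHom.FaithfullyFlat.iff_flat_and_comap_surjective]
    exact ⟨flat_pullFunctions q, comap_pullFunctions_surjective q⟩
  exact mem_span_mul_of_exact (L := L) (π := pullBialgHom i) (j := pullBialgHom q)
    H₁.mem_augmentationIdeal H₂.mem_augmentationIdeal H₃.mem_augmentationIdeal h4 h5 hff hp hpV
    b₁ b₂ b₃ e₁ e₂ e₃

end FiniteFlatModuleScheme

variable {p : ℕ} [Fact p.Prime] {F K : IntermediateField ℚ_[p] (PadicAlgCl p)}
  [FiniteDimensional ℚ_[p] K]

instance (H : ModuleScheme F K) : Module.Finite (integers K) H.omega :=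
  have _h : Module.Finite (integers K) H.functions := finite_functions H.X
  finite_cotangent (A := H.functions) (integers K) H.augmentationIdeal

lemma exists_smul_omega_eq_zero {H : ModuleScheme F K} (h : H.HasPowerOrder p) :
    ∃ r : integers K, r ≠ 0 ∧ ∀ w : H.omega, r • w = 0 := by
  exact FiniteFlatModuleScheme.exists_smul_omega_eq_zero (unitBall p) (PadicAlgCl p) h

lemma exists_p_pow_smul_omega_eq_zero {H : ModuleScheme F K} (h : H.HasPowerOrder p) :
    ∃ N : ℕ, ∀ w : H.omega, (p : integers K) ^ N • w = 0 := by
  obtain ⟨r, hr, hw⟩ := exists_smul_omega_eq_zero h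
  obtain ⟨N, hN⟩ := exists_pow_lt_of_lt_one (norm_pos_iff.2 ((inclHom_ne_zero K).2 hr))
    (norm_p_lt_one (p := p))
  obtain ⟨t, ht⟩ : r ∣ (p : integers K) ^ N := by
    rw [dvd_iff_norm_le, map_pow, map_natCast, norm_pow]
    exact hN.le
  exact ⟨N, fun w => by rw [ht, mul_comm, mul_smul, hw, smul_zero]⟩

/-- The structure of a `ℤ_p`-module through the integers of `K`. -/
instance (H : ModuleScheme F K) : Module ℤ_[p] H.omega :=
  Module.compHom _ (algebraMap ℤ_[p] (integers K))

omit [FiniteDimensional ℚ_[p] K] in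
lemma padic_smul_def {H : ModuleScheme F K} (z : ℤ_[p]) (w : H.omega) :
    z • w = algebraMap ℤ_[p] (integers K) z • w := rfl

instance (H : ModuleScheme F K) : IsScalarTower ℤ_[p] (integers K) H.omega :=
  ⟨fun z r w => by rw [padic_smul_def, Algebra.smul_def, mul_smul]⟩

/-- The action of the integers of `F` on the module of differentials is linear over `ℤ_p`, since a
power of `p` kills this module. -/
def actAlgHom {H : ModuleScheme F K} (h : H.HasPowerOrder p) :
    integers F →ₐ[ℤ_[p]] Module.End (integers K) H.omega :=
  { H.actRingHom with
    commutes' := fun z => by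
      obtain ⟨N, hN⟩ := exists_p_pow_smul_omega_eq_zero h
      obtain ⟨y, hy⟩ := Ideal.mem_span_singleton.1 (PadicInt.appr_spec N z)
      have hz : z = (z.appr N : ℤ_[p]) + (p : ℤ_[p]) ^ N * y := by rw [← hy]; ring
      refine LinearMap.ext fun w => ?_
      change H.actRingHom (algebraMap ℤ_[p] (integers F) z) w = algebraMap ℤ_[p] (integers K) z • w
      rw [hz, map_add, map_add, map_add, map_mul, map_mul, map_mul, map_pow, map_pow, map_pow,
        map_natCast, map_natCast, map_natCast, map_natCast, map_natCast, map_natCast, add_smul,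
        mul_smul, hN, add_zero, LinearMap.add_apply, Module.End.mul_apply]
      have h1 (n : ℕ) (w : H.omega) : (n : Module.End (integers K) H.omega) w =
          (n : integers K) • w := by
        rw [Module.End.natCast_apply, Nat.cast_smul_eq_nsmul]
      have h2 (w : H.omega) : ((p : Module.End (integers K) H.omega) ^ N) w = 0 := by
        rw [← Nat.cast_pow, h1, Nat.cast_pow, hN]
      rw [h2, add_zero, h1] }

variable (hFK : ∀ (s : F →ₐ[ℚ_[p]] PadicAlgCl p) (x : F), s x ∈ K)

/-- The isotypic parts, as the parts on which the integers of `F` act through the homomorphisms to the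
integers of `K` induced by the embeddings. -/
lemma isotypic_eq_eigenPart {H : ModuleScheme F K} (h : H.HasPowerOrder p)
    (s : F →ₐ[ℚ_[p]] PadicAlgCl p) :
    isotypic H s = eigenPart (actAlgHom h) (integersHom hFK s) := by
  ext w
  constructor
  · exact fun hw a => hw a _ (inclHom_integersHom hFK s a)
  · intro hw a b hb
    have hb' : b = integersHom hFK s a :=
      inclHom_injective K (Eq.trans hb (inclHom_integersHom hFK s a).symm)
    rw [hb']
    exact hw a

variable [FiniteDimensional ℚ_[p] F] (hF : Algebra.Unramified ℤ_[p] (integers F))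

include hFK hF

/-- As `F` is unramified, the module of differentials is the direct sum of its isotypic parts. -/
lemma nonempty_omega_equiv {H : ModuleScheme F K} (h : H.HasPowerOrder p) :
    Nonempty (H.omega ≃ₗ[integers K] ((s : F →ₐ[ℚ_[p]] PadicAlgCl p) → isotypic H s)) := by
  have hne : Nonempty (F →ₐ[ℚ_[p]] PadicAlgCl p) := ⟨F.val⟩
  have e := eigenEquiv (actAlgHom h) (integersHom hFK) (integersHom_injective hFK)
    (integersHom_apply_injective hFK) (Algebra.intTrace ℤ_[p] (integers F))
    (algebraMap_intTrace_eq_sum hFK)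
  exact ⟨e.trans (LinearEquiv.piCongrRight fun s =>
    LinearEquiv.ofEq _ _ (isotypic_eq_eigenPart hFK h s).symm)⟩

/-- Generators of the Fitting ideals of the isotypic parts; their product generates the Fitting ideal
of the module of differentials. -/
lemma exists_isotypicFitting_eq_span {H : ModuleScheme F K} (h : H.HasPowerOrder p) :
    ∃ D : (F →ₐ[ℚ_[p]] PadicAlgCl p) → integers K, (∀ s, D s ≠ 0) ∧
      (∀ s, isotypicFitting H s = Ideal.span {D s}) ∧
      fittingIdeal (integers K) H.omega = Ideal.span {∏ s, D s} := by
  obtain ⟨r, hr, hr0⟩ := exists_smul_omega_eq_zero h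
  have hdec (s : F →ₐ[ℚ_[p]] PadicAlgCl p) := exists_equiv_pi_quotient (R := integers K)
    (isotypic H s) ⟨r, hr, fun x => Subtype.ext (hr0 x)⟩
  choose n a ha e using hdec
  refine ⟨fun s => ∏ j, a s j, fun s => Finset.prod_ne_zero_iff.2 fun j _ => ha s j, fun s => ?_, ?_⟩
  · rw [isotypicFitting, fittingIdeal_congr (e s).some, fittingIdeal_pi_quotient]
  · obtain ⟨e'⟩ := nonempty_omega_equiv hFK hF h
    have e2 := e'.trans (LinearEquiv.piCongrRight fun s => (e s).some)
    have e3 := e2.trans (LinearEquiv.piCurry (integers K) (fun s (j : Fin (n s)) =>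
      integers K ⧸ Ideal.span {a s j})).symm
    rw [fittingIdeal_congr e3, fittingIdeal_pi_quotient
      (fun x : (s : F →ₐ[ℚ_[p]] PadicAlgCl p) × Fin (n s) => a x.1 x.2), Fintype.prod_sigma]

/-- The partial degrees add up to the valuation of the product of the invariant factors. -/
lemma sum_partialDeg_eq {H : ModuleScheme F K} (h : H.HasPowerOrder p) {n : ℕ}
    {a : Fin n → integers K}
    (e : H.omega ≃ₗ[integers K] ((j : Fin n) → integers K ⧸ Ideal.span {a j})) :
    ∑ s, partialDeg s H = val (inclHom K (∏ j, a j)) := by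
  obtain ⟨D, hD0, hD, hfit⟩ := exists_isotypicFitting_eq_span hFK hF h
  rw [fittingIdeal_congr e, fittingIdeal_pi_quotient] at hfit
  rw [← idealVal_span, hfit, idealVal_span, map_prod,
    val_prod _ _ fun s _ => (inclHom_ne_zero K).2 (hD0 s)]
  exact Finset.sum_congr rfl fun s _ => by rw [partialDeg, hD, idealVal_span]

/-- The Fargues degree exists and is the sum of the partial degrees. -/
lemma isFarguesDegree_iff {H : ModuleScheme F K} (h : H.HasPowerOrder p) (d : ℝ) :
    IsFarguesDegree H d ↔ d = ∑ s, partialDeg s H := by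
  have key {n : ℕ} {a : Fin n → integers K} (ha : ∀ j, a j ≠ 0)
      (e : H.omega ≃ₗ[integers K] ((j : Fin n) → integers K ⧸ Ideal.span {a j})) :
      ∑ s, partialDeg s H = ∑ j, val (incl K (a j)) := by
    rw [sum_partialDeg_eq hFK hF h e, map_prod,
      val_prod _ _ fun j _ => (inclHom_ne_zero K).2 (ha j)]
    rfl
  constructor
  · rintro ⟨n, a, ha, ⟨e⟩, rfl⟩
    exact (key ha e).symm
  · rintro rfl
    obtain ⟨n, a, ha, ⟨e⟩⟩ := exists_equiv_pi_quotient (R := integers K) H.omega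
      (exists_smul_omega_eq_zero h)
    exact ⟨n, a, ha, ⟨e⟩, key ha e⟩

omit [FiniteDimensional ℚ_[p] F] in
lemma fittingIdeal_isotypic_mul_le {H₁ H₂ H₃ : ModuleScheme F K} {i : H₁.X ⟶ H₂.X}
    {q : H₂.X ⟶ H₃.X} (h₁ : H₁.HasPowerOrder p) (h₂ : H₂.HasPowerOrder p)
    (h₃ : H₃.HasPowerOrder p) (h : FiniteFlatModuleScheme.IsShortExact H₁ H₂ H₃ i q)
    (s : F →ₐ[ℚ_[p]] PadicAlgCl p) :
    isotypicFitting H₁ s * isotypicFitting H₃ s ≤ isotypicFitting H₂ s := by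
  have hi := h.isMonHom_left
  have hq := h.isMonHom_right
  obtain ⟨hsurj, hker⟩ := h.pullOmega_exact
  obtain ⟨h4, h5⟩ := eigenPart_exact (α := actAlgHom h₃) (α' := actAlgHom h₂)
    (α'' := actAlgHom h₁) (integersHom hFK s)
    (fun a w => FiniteFlatModuleScheme.pullOmega_actOmega q a (h.equivariant_right a) w)
    (fun a w => FiniteFlatModuleScheme.pullOmega_actOmega i a (h.equivariant_left a) w) hsurj hker
  rw [isotypicFitting, isotypicFitting, isotypicFitting, isotypic_eq_eigenPart hFK h₁,
    isotypic_eq_eigenPart hFK h₂, isotypic_eq_eigenPart hFK h₃]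
  exact fittingIdeal_mul_le _ _ h4 h5

/-- Each partial degree is subadditive in exact sequences, like the Fitting ideals. -/
lemma partialDeg_le_add {H₁ H₂ H₃ : ModuleScheme F K} {i : H₁.X ⟶ H₂.X}
    {q : H₂.X ⟶ H₃.X} (h₁ : H₁.HasPowerOrder p) (h₂ : H₂.HasPowerOrder p)
    (h₃ : H₃.HasPowerOrder p) (h : FiniteFlatModuleScheme.IsShortExact H₁ H₂ H₃ i q)
    (s : F →ₐ[ℚ_[p]] PadicAlgCl p) : partialDeg s H₂ ≤ partialDeg s H₁ + partialDeg s H₃ := by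
  obtain ⟨D₁, hD₁0, hD₁, -⟩ := exists_isotypicFitting_eq_span hFK hF h₁
  obtain ⟨D₂, hD₂0, hD₂, -⟩ := exists_isotypicFitting_eq_span hFK hF h₂
  obtain ⟨D₃, hD₃0, hD₃, -⟩ := exists_isotypicFitting_eq_span hFK hF h₃
  have h4 := fittingIdeal_isotypic_mul_le hFK hF h₁ h₂ h₃ h s
  rw [hD₁, hD₂, hD₃, Ideal.span_singleton_mul_span_singleton, Ideal.span_singleton_le_span_singleton,
    dvd_iff_norm_le, map_mul] at h4
  have h10 := (inclHom_ne_zero K).2 (hD₁0 s)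
  have h30 := (inclHom_ne_zero K).2 (hD₃0 s)
  rwa [partialDeg, partialDeg, partialDeg, hD₁, hD₂, hD₃, idealVal_span, idealVal_span,
    idealVal_span, ← val_mul h10 h30,
    val_le_val_iff ((inclHom_ne_zero K).2 (hD₂0 s)) (mul_ne_zero h10 h30)]

/-- The sum of the partial degrees is superadditive in exact sequences. -/
lemma sum_partialDeg_add_le {H₁ H₂ H₃ : ModuleScheme F K} {i : H₁.X ⟶ H₂.X}
    {q : H₂.X ⟶ H₃.X} (h₁ : H₁.HasPowerOrder p) (h₂ : H₂.HasPowerOrder p)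
    (h₃ : H₃.HasPowerOrder p) (h : FiniteFlatModuleScheme.IsShortExact H₁ H₂ H₃ i q) :
    ∑ s, partialDeg s H₁ + ∑ s, partialDeg s H₃ ≤ ∑ s, partialDeg s H₂ := by
  obtain ⟨n₁, a₁, ha₁, ⟨e₁⟩⟩ := exists_equiv_pi_quotient (R := integers K) H₁.omega
    (exists_smul_omega_eq_zero h₁)
  obtain ⟨n₂, a₂, ha₂, ⟨e₂⟩⟩ := exists_equiv_pi_quotient (R := integers K) H₂.omega
    (exists_smul_omega_eq_zero h₂)
  obtain ⟨n₃, a₃, ha₃, ⟨e₃⟩⟩ := exists_equiv_pi_quotient (R := integers K) H₃.omega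
    (exists_smul_omega_eq_zero h₃)
  have h6 := h.mem_span_mul (V := unitBall p) (PadicAlgCl p) h₁ h₂ h₃ (Fact.out : p.Prime)
    (p_mem_maximalIdeal_unitBall p) e₁ e₂ e₃
  rw [Ideal.mem_span_singleton] at h6
  obtain ⟨c, hc⟩ := h6
  have h7 : ‖inclHom K (∏ j, a₂ j)‖ ≤ ‖inclHom K (∏ j, a₁ j) * inclHom K (∏ j, a₃ j)‖ := by
    have h8 : inclHom K (∏ j, a₂ j) =
        inclHom K (∏ j, a₁ j) * inclHom K (∏ j, a₃ j) * (c : PadicAlgCl p) :=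
      congrArg Subtype.val hc
    rw [h8, norm_mul]
    exact mul_le_of_le_one_right (norm_nonneg _) c.2
  have h10 := (inclHom_ne_zero K).2
    (Finset.prod_ne_zero_iff (s := Finset.univ) (f := a₁) |>.2 fun j _ => ha₁ j)
  have h20 := (inclHom_ne_zero K).2
    (Finset.prod_ne_zero_iff (s := Finset.univ) (f := a₂) |>.2 fun j _ => ha₂ j)
  have h30 := (inclHom_ne_zero K).2
    (Finset.prod_ne_zero_iff (s := Finset.univ) (f := a₃) |>.2 fun j _ => ha₃ j)
  rw [sum_partialDeg_eq hFK hF h₁ e₁, sum_partialDeg_eq hFK hF h₂ e₂, sum_partialDeg_eq hFK hF h₃ e₃,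
    ← val_mul h10 h30]
  exact (val_le_val_iff (mul_ne_zero h10 h30) h20).2 h7

end Decomposition

end PartialDegree

end

theorem mainTheorem10 (p : ℕ) [Fact p.Prime]
    (F K : IntermediateField ℚ_[p] (PadicAlgCl p))
    [FiniteDimensional ℚ_[p] F] [FiniteDimensional ℚ_[p] K] (hFK : F ≤ K)
    (hF : Algebra.Unramified ℤ_[p] (PartialDegree.integers F)) :
    (∀ H : PartialDegree.ModuleScheme F K, H.HasPowerOrder p →
      (∀ s : F →ₐ[ℚ_[p]] PadicAlgCl p,
        (PartialDegree.isotypicFitting H s).IsPrincipal ∧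
          PartialDegree.isotypicFitting H s ≠ ⊥) ∧
      (∀ d : ℝ, PartialDegree.IsFarguesDegree H d ↔
        d = ∑ s : F →ₐ[ℚ_[p]] PadicAlgCl p, PartialDegree.partialDeg s H)) ∧
    (∀ (H₁ H₂ H₃ : PartialDegree.ModuleScheme F K) (i : H₁.X ⟶ H₂.X) (q : H₂.X ⟶ H₃.X),
      H₁.HasPowerOrder p → H₂.HasPowerOrder p → H₃.HasPowerOrder p →
      PartialDegree.FiniteFlatModuleScheme.IsShortExact H₁ H₂ H₃ i q →
      ∀ s : F →ₐ[ℚ_[p]] PadicAlgCl p,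
        PartialDegree.partialDeg s H₂ =
          PartialDegree.partialDeg s H₁ + PartialDegree.partialDeg s H₃) := by
  have hs (s : F →ₐ[ℚ_[p]] PadicAlgCl p) (x : F) : s x ∈ K :=
    hFK (PartialDegree.algHom_mem_of_unramified hF s x)
  refine ⟨fun H h => ⟨fun s => ?_, PartialDegree.isFarguesDegree_iff hs hF h⟩,
    fun H₁ H₂ H₃ i q h₁ h₂ h₃ h s => ?_⟩
  · obtain ⟨D, hD0, hD, -⟩ := PartialDegree.exists_isotypicFitting_eq_span hs hF h
    rw [hD]
    exact ⟨⟨D s, rfl⟩, mt Ideal.span_singleton_eq_bot.1 (hD0 s)⟩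
  · have hle := fun s => PartialDegree.partialDeg_le_add hs hF h₁ h₂ h₃ h s
    -- the sums over `s` of the two sides agree, so all the inequalities are equalities
    have hsum := PartialDegree.sum_partialDeg_add_le hs hF h₁ h₂ h₃ h
    rw [← Finset.sum_add_distrib] at hsum
    exact (Finset.sum_eq_sum_iff_of_le fun s _ => hle s).1
      (le_antisymm (Finset.sum_le_sum fun s _ => hle s) hsum) s (Finset.mem_univ s)
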